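/- Let $n>0$, $s>1$, and let $M$ be a smooth manifold of dimension $2n+s$ with a weak metric $f$-structure $(f,Q,\xi_i,\eta^i,g)$, $1\le i\le s$. That is: $f$ and $Q$ are smooth $(1,1)$-tensors, $f$ of constant rank $2n$ and $Q$ nonsingular, with $f^3+fQ=0$; $\xi_i$ are smooth vector fields and $\eta^i$ smooth 1-forms with $$f^2=-Q+\sum_i\eta^i\otimes\xi_i,\qquad \eta^i(\xi_j)=\delta^i_j,\qquad Q\xi_i=\xi_i;$$ the contact distribution $\mathcal D=\bigcap_i\ker\eta^i$ is $f$-invariant; and $g$ is a Riemannian metric with $g(fX,fY)=g(X,QY)-\sum_i\eta^i(X)\eta^i(Y)$ for all vector fields $X,Y$. Suppose that $M$ is a weak $\beta$-Kenmotsu $f$-manifold, where $\beta$ is a smooth real function on $M$ that is not identically zero. That is, for all smooth vector fields $X,Y$: * (normality) $[f,f](X,Y)+2\sum_i d\eta^i(X,Y)\,\xi_i=0$, where $[f,f](X,Y)=f^2[X,Y]+[fX,fY]-f[fX,Y]-f[X,fY]$ and $2\,d\eta^i(X,Y)=X(\eta^i(Y))-Y(\eta^i(X))-\eta^i([X,Y])$;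 * $(\nabla_Xf)Y=\beta\{g(fX,Y)\,\bar\xi-\bar\eta(Y)\,fX\}$, where $\nabla$ is the Levi-Civita connection of $g$, $\bar\xi=\sum_i\xi_i$ and $\bar\eta=\sum_i\eta^i$. Then for every point $p\in M$ there are a $2n$-dimensional weak Kählerian manifold $(\bar M,\bar g,J)$, i.e. a Riemannian manifold with a smooth skew-symmetric $(1,1)$-tensor $J$ such that $J^2$ is negative definite and $\bar\nabla J=0$ for the Levi-Civita connection $\bar\nabla$ of $\bar g$, a smooth positive function $\sigma$ on $\mathbb R^s\times\bar M$, an open ball $B\subset\mathbb R^s$ centred at $0$, and a diffeomorphism $\Phi$ of $B\times\bar M$ onto an open neighbourhood of $p$ in $M$ such that $\Phi$ is an isometry from the open subset $B\times\bar M$ of the twisted product $\mathbb R^s\times_\sigma\bar M$, whose metric is $g_{\mathbb R^s}\oplus\sigma^2\bar g$ with $g_{\mathbb R^s}$ Euclidean, onto its image. Moreover $\Phi$ carries the coordinate fields $\partial/\partial t_i$ of $\mathbb R^s$ to the fields $\xi_i$ and carries $J$, acting on the slices $\{t\}\times\bar M$, to the restriction of $f$ to $\mathcal D$. If in addition $X(\beta)=0$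 for all $X\in\mathcal D$, then $\sigma$ can moreover be taken of the form $\sigma(t,y)=\rho(t)$ with $\rho$ a smooth function on $\mathbb R^s$, so that the product is a warped product. -/

import Mathlib

open Bundle Manifold VectorField
open scoped ContDiff

namespace WeakKenmotsu

/-! ### Tensor fields on an `m`-dimensional smooth manifold -/

/-- Vector fields, with no regularity condition. -/
abbrev VField (m : ℕ) (M : Type*) [TopologicalSpace M]
    [ChartedSpace (EuclideanSpace ℝ (Fin m)) M] :=
  Π x : M, TangentSpace (𝓡 m) x

/-- (1,1)-tensor fields, with no regularity condition. -/
abbrev EndField (m : ℕ) (M : Type*) [TopologicalSpace M]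
    [ChartedSpace (EuclideanSpace ℝ (Fin m)) M] :=
  Π x : M, TangentSpace (𝓡 m) x →L[ℝ] TangentSpace (𝓡 m) x

/-- Fields of covectors, with no regularity condition. -/
abbrev OneForm (m : ℕ) (M : Type*) [TopologicalSpace M]
    [ChartedSpace (EuclideanSpace ℝ (Fin m)) M] :=
  Π x : M, TangentSpace (𝓡 m) x →L[ℝ] ℝ

section

variable {m : ℕ} {M : Type*} [TopologicalSpace M] [ChartedSpace (EuclideanSpace ℝ (Fin m)) M]

/-- `S X`, for a (1,1)-tensor field `S` and a vector field `X`. -/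
noncomputable def EndField.app (S : EndField m M) (X : VField m M) : VField m M := fun x => S x (X x)

/-- The Nijenhuis torsion
`[S,S](X,Y) = S²[X,Y] + [SX,SY] - S[SX,Y] - S[X,SY]`. -/
noncomputable def nijenhuis (S : EndField m M) (X Y : VField m M) : VField m M := fun x =>
  S x (S x (mlieBracket (𝓡 m) X Y x)) + mlieBracket (𝓡 m) (S.app X) (S.app Y) x
    - S x (mlieBracket (𝓡 m) (S.app X) Y x) - S x (mlieBracket (𝓡 m) X (S.app Y) x)

/-- The exterior derivative of a 1-form, with the normalisation
`dα(X,Y) = ½ {X(α(Y)) - Y(α(X)) - α([X,Y])}`. -/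
noncomputable def extDerivOneForm (α : OneForm m M) (X Y : VField m M) (x : M) : ℝ :=
  (1 / 2 : ℝ) * (mvfderiv (𝓡 m) (fun y => α y (Y y)) x (X x)
    - mvfderiv (𝓡 m) (fun y => α y (X y)) x (Y x) - α x (mlieBracket (𝓡 m) X Y x))

variable [IsManifold (𝓡 m) ∞ M]

/-- Smoothness of a vector field. -/
def IsSmoothVField (X : VField m M) : Prop :=
  ContMDiff (𝓡 m) ((𝓡 m).prod 𝓘(ℝ, EuclideanSpace ℝ (Fin m))) ∞
    (fun x => TotalSpace.mk' (EuclideanSpace ℝ (Fin m)) x (X x))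

/-- Smoothness of a (1,1)-tensor field. -/
def IsSmoothEndField (S : EndField m M) : Prop :=
  ContMDiff (𝓡 m)
    ((𝓡 m).prod 𝓘(ℝ, EuclideanSpace ℝ (Fin m) →L[ℝ] EuclideanSpace ℝ (Fin m))) ∞
    (fun x => TotalSpace.mk' (EuclideanSpace ℝ (Fin m) →L[ℝ] EuclideanSpace ℝ (Fin m))
      (E := fun x : M => TangentSpace (𝓡 m) x →L[ℝ] TangentSpace (𝓡 m) x) x (S x))

/-- Smoothness of a 1-form. -/
def IsSmoothOneForm (α : OneForm m M) : Prop :=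
  ContMDiff (𝓡 m) ((𝓡 m).prod 𝓘(ℝ, EuclideanSpace ℝ (Fin m) →L[ℝ] ℝ)) ∞
    (fun x => TotalSpace.mk' (EuclideanSpace ℝ (Fin m) →L[ℝ] ℝ)
      (E := fun x : M => TangentSpace (𝓡 m) x →L[ℝ] Bundle.Trivial M ℝ x) x (α x))

end

/-! ### Riemannian metrics and the Levi-Civita connection -/

/-- Smooth Riemannian metrics. -/
abbrev RMetric (m : ℕ) (M : Type*) [TopologicalSpace M]
    [ChartedSpace (EuclideanSpace ℝ (Fin m)) M] [IsManifold (𝓡 m) ∞ M] :=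
  ContMDiffRiemannianMetric (𝓡 m) ∞ (EuclideanSpace ℝ (Fin m))
    (fun x : M => TangentSpace (𝓡 m) x)

/-- Linear connections. In Mathlib's order of arguments, `∇ Y x (X x)` is `(∇_X Y)(x)`. -/
abbrev LinearConnection (m : ℕ) (M : Type*) [TopologicalSpace M]
    [ChartedSpace (EuclideanSpace ℝ (Fin m)) M] [IsManifold (𝓡 m) ∞ M] :=
  CovariantDerivative (𝓡 m) (EuclideanSpace ℝ (Fin m)) (fun x : M => TangentSpace (𝓡 m) x)

section

variable {m : ℕ} {M : Type*} [TopologicalSpace M] [ChartedSpace (EuclideanSpace ℝ (Fin m)) M]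
  [IsManifold (𝓡 m) ∞ M]

/-- `nabla` is the Levi-Civita connection of `g`: torsion-free and metric,
`v(g(Y,Z)) = g(∇_v Y, Z) + g(Y, ∇_v Z)`. -/
structure IsLeviCivita (g : RMetric m M) (nabla : LinearConnection m M) : Prop where
  torsion_free : nabla.torsion = 0
  metric : ∀ (Y Z : VField m M), IsSmoothVField Y → IsSmoothVField Z →
    ∀ (x : M) (v : TangentSpace (𝓡 m) x),
      mvfderiv (𝓡 m) (fun y => g.inner y (Y y) (Z y)) x v
        = g.inner x (nabla Y x v) (Z x) + g.inner x (Y x) (nabla Z x v)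

/-- `(∇_X S) Y = ∇_X (S Y) - S (∇_X Y)` for a (1,1)-tensor field `S`. -/
noncomputable def covDerivEnd (nabla : LinearConnection m M) (S : EndField m M) (X Y : VField m M) :
    VField m M :=
  fun x => nabla (S.app Y) x (X x) - S x (nabla Y x (X x))

/-- `(M, g)` with the (1,1)-tensor field `J` is a weak Kählerian manifold: `J` is skew-symmetric,
`J²` is negative definite, and `J` is parallel for the Levi-Civita connection of `g`. -/
structure IsWeakKahlerian (g : RMetric m M) (J : EndField m M) : Prop where
  smooth : IsSmoothEndField J
  skew : ∀ (x : M) (v w : TangentSpace (𝓡 m) x), g.inner x (J x v) w = - g.inner x v (J x w)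
  sq_neg : ∀ (x : M) (v : TangentSpace (𝓡 m) x), v ≠ 0 → g.inner x (J x (J x v)) v < 0
  parallel : ∃ nabla : LinearConnection m M, IsLeviCivita g nabla ∧
    ∀ X Y : VField m M, IsSmoothVField X → IsSmoothVField Y →
      ∀ x, covDerivEnd nabla J X Y x = 0

end

/-! ### Weak metric f-structures -/

/-- A weak metric `f`-structure `(f, Q, ξ_i, η^i, g)` on a manifold of dimension `2n + s`. -/
structure WeakMetricFStructure (n s : ℕ) (M : Type*) [TopologicalSpace M]
    [ChartedSpace (EuclideanSpace ℝ (Fin (2 * n + s))) M]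
    [IsManifold (𝓡 (2 * n + s)) ∞ M] where
  f : EndField (2 * n + s) M
  Q : EndField (2 * n + s) M
  ξ : Fin s → VField (2 * n + s) M
  η : Fin s → OneForm (2 * n + s) M
  g : RMetric (2 * n + s) M
  smooth_f : IsSmoothEndField f
  smooth_Q : IsSmoothEndField Q
  smooth_ξ : ∀ i, IsSmoothVField (ξ i)
  smooth_η : ∀ i, IsSmoothOneForm (η i)
  /-- `f` has rank `2n`. -/
  rank_f : ∀ x, Module.finrank ℝ (LinearMap.range (f x).toLinearMap) = 2 * n
  /-- `Q` is nonsingular. -/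
  nonsingular_Q : ∀ x, Function.Bijective (Q x)
  /-- `f³ + fQ = 0`. -/
  f_cube : ∀ x v, f x (f x (f x v)) + f x (Q x v) = 0
  /-- `f² = -Q + ∑ η^i ⊗ ξ_i`. -/
  f_sq : ∀ x v, f x (f x v) = - Q x v + ∑ i, η i x v • ξ i x
  /-- `η^i(ξ_j) = δ^i_j`. -/
  η_ξ : ∀ x i j, η i x (ξ j x) = if i = j then 1 else 0
  /-- `Q ξ_i = ξ_i`. -/
  Q_ξ : ∀ x i, Q x (ξ i x) = ξ i x
  /-- The contact distribution `⋂ ker η^i` is `f`-invariant. -/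
  f_invariant : ∀ x v, (∀ i, η i x v = 0) → ∀ i, η i x (f x v) = 0
  /-- The metric is compatible: `g(fX, fY) = g(X, QY) - ∑ η^i(X) η^i(Y)`. -/
  compatible : ∀ x v w,
    g.inner x (f x v) (f x w) = g.inner x v (Q x w) - ∑ i, η i x v * η i x w

namespace WeakMetricFStructure

variable {n s : ℕ} {M : Type*} [TopologicalSpace M]
  [ChartedSpace (EuclideanSpace ℝ (Fin (2 * n + s))) M] [IsManifold (𝓡 (2 * n + s)) ∞ M]

/-- `v` belongs to the contact distribution `𝒟 = ⋂ ker η^i`. -/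
def InContact (S : WeakMetricFStructure n s M) {x : M} (v : TangentSpace (𝓡 (2 * n + s)) x) :
    Prop :=
  ∀ i, S.η i x v = 0

/-- `ξ̄ = ∑ ξ_i`. -/
noncomputable def xiBar (S : WeakMetricFStructure n s M) : VField (2 * n + s) M := fun x => ∑ i, S.ξ i x

/-- `η̄ = ∑ η^i`. -/
noncomputable def etaBar (S : WeakMetricFStructure n s M) : OneForm (2 * n + s) M := fun x => ∑ i, S.η i x

/-- Normality: `[f,f](X,Y) + 2 ∑ dη^i(X,Y) ξ_i = 0`. -/
def IsNormal (S : WeakMetricFStructure n s M) : Prop :=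
  ∀ X Y : VField (2 * n + s) M, IsSmoothVField X → IsSmoothVField Y → ∀ x,
    nijenhuis S.f X Y x + ∑ i, (2 * extDerivOneForm (S.η i) X Y x) • S.ξ i x = 0

/-- A weak `β`-Kenmotsu `f`-structure: a normal weak metric `f`-structure with
`(∇_X f)Y = β {g(fX, Y) ξ̄ - η̄(Y) fX}`, where `∇` is the Levi-Civita connection of `g` and
`β` is a smooth function that is not identically zero. -/
structure IsWeakKenmotsu (S : WeakMetricFStructure n s M) (β : M → ℝ) : Prop where
  normal : S.IsNormal
  smooth_β : ContMDiff (𝓡 (2 * n + s)) 𝓘(ℝ, ℝ) ∞ β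
  β_ne_zero : β ≠ 0
  nabla_f : ∃ nabla : LinearConnection (2 * n + s) M, IsLeviCivita S.g nabla ∧
    ∀ X Y : VField (2 * n + s) M, IsSmoothVField X → IsSmoothVField Y → ∀ x,
      covDerivEnd nabla S.f X Y x
        = β x • (S.g.inner x (S.f x (X x)) (Y x) • S.xiBar x - S.etaBar x (Y x) • S.f x (X x))

end WeakMetricFStructure

/-! ### Twisted products `ℝ^s ×_σ N` -/

/-- The metric of the twisted product `ℝ^s ×_σ N` at the point `q = (t, y)`:
`π₁^* g_{ℝ^s} + σ² π₂^* h`, with the Euclidean metric on `ℝ^s` and the metric `h` on `N`. -/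
noncomputable def twistedInner {s k : ℕ} {N : Type*} [TopologicalSpace N]
    [ChartedSpace (EuclideanSpace ℝ (Fin k)) N] [IsManifold (𝓡 k) ∞ N] (h : RMetric k N)
    (σ : EuclideanSpace ℝ (Fin s) × N → ℝ) (q : EuclideanSpace ℝ (Fin s) × N)
    (v w : TangentSpace ((𝓡 s).prod (𝓡 k)) q) : ℝ :=
  inner ℝ (mvfderiv ((𝓡 s).prod (𝓡 k)) (fun z : EuclideanSpace ℝ (Fin s) × N => z.1) q v)
      (mvfderiv ((𝓡 s).prod (𝓡 k)) (fun z : EuclideanSpace ℝ (Fin s) × N => z.1) q w)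
    + σ q ^ 2 *
      h.inner q.2
        (mfderiv ((𝓡 s).prod (𝓡 k)) (𝓡 k) (fun z : EuclideanSpace ℝ (Fin s) × N => z.2) q v)
        (mfderiv ((𝓡 s).prod (𝓡 k)) (𝓡 k) (fun z : EuclideanSpace ℝ (Fin s) × N => z.2) q w)

/-- `Φ` is a parametrisation of a neighbourhood of `p` by the open part `B(0,r) × N` of the twisted
product `ℝ^s ×_σ N`: a diffeomorphism onto an open neighbourhood of `p` that is an isometry,
carries the coordinate fields `∂/∂t_i` of `ℝ^s` to the `ξ_i`, and carries `J` on the slices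
`{t} × N` to `f`. -/
structure IsTwistedProductChart {n s : ℕ} {M : Type*} [TopologicalSpace M]
    [ChartedSpace (EuclideanSpace ℝ (Fin (2 * n + s))) M] [IsManifold (𝓡 (2 * n + s)) ∞ M]
    (S : WeakMetricFStructure n s M) (p : M) {N : Type*} [TopologicalSpace N]
    [ChartedSpace (EuclideanSpace ℝ (Fin (2 * n))) N] [IsManifold (𝓡 (2 * n)) ∞ N]
    (h : RMetric (2 * n) N) (J : EndField (2 * n) N) (σ : EuclideanSpace ℝ (Fin s) × N → ℝ)
    (r : ℝ) (Φ : OpenPartialHomeomorph (EuclideanSpace ℝ (Fin s) × N) M) : Prop where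
  source_eq : Φ.source = Metric.ball (0 : EuclideanSpace ℝ (Fin s)) r ×ˢ (Set.univ : Set N)
  mem_target : p ∈ Φ.target
  smooth : ContMDiffOn ((𝓡 s).prod (𝓡 (2 * n))) (𝓡 (2 * n + s)) ∞ Φ Φ.source
  smooth_symm : ContMDiffOn (𝓡 (2 * n + s)) ((𝓡 s).prod (𝓡 (2 * n))) ∞ Φ.symm Φ.target
  isometry : ∀ q ∈ Φ.source, ∀ v w : TangentSpace ((𝓡 s).prod (𝓡 (2 * n))) q,
    S.g.inner (Φ q) (mfderiv ((𝓡 s).prod (𝓡 (2 * n))) (𝓡 (2 * n + s)) Φ q v)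
        (mfderiv ((𝓡 s).prod (𝓡 (2 * n))) (𝓡 (2 * n + s)) Φ q w)
      = twistedInner h σ q v w
  map_ξ : ∀ q ∈ Φ.source, ∀ i,
    mfderiv (𝓡 s) (𝓡 (2 * n + s)) (fun t => Φ (t, q.2)) q.1 (EuclideanSpace.single i (1 : ℝ))
      = S.ξ i (Φ q)
  map_f : ∀ q ∈ Φ.source, ∀ w : TangentSpace (𝓡 (2 * n)) q.2,
    mfderiv (𝓡 (2 * n)) (𝓡 (2 * n + s)) (fun y => Φ (q.1, y)) q.2 (J q.2 w)
      = S.f (Φ q) (mfderiv (𝓡 (2 * n)) (𝓡 (2 * n + s)) (fun y => Φ (q.1, y)) q.2 w)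

end WeakKenmotsu

namespace WeakKenmotsu

open Set Filter Topology

/-! ### Superposition and integration operators on spaces of continuous paths -/

section Superposition

set_option synthInstance.maxHeartbeats 200000

universe u

variable {K : Type*} [TopologicalSpace K] [CompactSpace K]

/-- Pointwise application of a continuous family of operators to a continuous family of vectors. -/
noncomputable def pointwiseApply (K : Type*) [TopologicalSpace K] [CompactSpace K]
    (E F : Type*) [NormedAddCommGroup E] [NormedSpace ℝ E] [NormedAddCommGroup F]
    [NormedSpace ℝ F] : C(K, E →L[ℝ] F) →L[ℝ] C(K, E) →L[ℝ] C(K, F) :=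
  LinearMap.mkContinuous₂
    (LinearMap.mk₂ ℝ (fun (A : C(K, E →L[ℝ] F)) (γ : C(K, E)) =>
        (⟨fun k => A k (γ k), by fun_prop⟩ : C(K, F)))
      (fun _ _ _ => by ext; simp) (fun _ _ _ => by ext; simp)
      (fun _ _ _ => by ext; simp) (fun _ _ _ => by ext; simp)) 1
    (fun A γ => by
      rw [one_mul]
      refine (ContinuousMap.norm_le _ (mul_nonneg (norm_nonneg A) (norm_nonneg γ))).2 fun k => ?_
      exact (A k).le_opNorm_of_le (γ.norm_coe_le_norm k) |>.trans
        (mul_le_mul_of_nonneg_right (A.norm_coe_le_norm k) (norm_nonneg _)))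

@[simp] lemma pointwiseApply_apply {E F : Type*} [NormedAddCommGroup E] [NormedSpace ℝ E]
    [NormedAddCommGroup F] [NormedSpace ℝ F] (A : C(K, E →L[ℝ] F)) (γ : C(K, E)) (k : K) :
    pointwiseApply K E F A γ k = A k (γ k) := rfl

/-- The mean value inequality bounds the remainder at each point of `K`. The estimate must be
uniform over `K`; this follows from continuity of `γ ↦ f' ∘ γ` in the sup norm. -/
lemma hasFDerivAt_continuousMap_comp {E F : Type*} [NormedAddCommGroup E] [NormedSpace ℝ E]
    [NormedAddCommGroup F] [NormedSpace ℝ F] (f : C(E, F)) (f' : C(E, E →L[ℝ] F))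
    (hf : ∀ x, HasFDerivAt f (f' x) x) (γ : C(K, E)) :
    HasFDerivAt (fun γ : C(K, E) => f.comp γ) (pointwiseApply K E F (f'.comp γ)) γ := by
  rw [hasFDerivAt_iff_isLittleO_nhds_zero, Asymptotics.isLittleO_iff]
  intro c hc
  have hcont : ContinuousAt (fun γ : C(K, E) => f'.comp γ) γ :=
    (ContinuousMap.continuous_postcomp f').continuousAt
  obtain ⟨δ, hδ, hδ'⟩ := (Metric.continuousAt_iff (α := C(K, E)) (β := C(K, E →L[ℝ] F))
    (f := fun γ => f'.comp γ)).1 hcont c hc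
  filter_upwards [Metric.ball_mem_nhds (0 : C(K, E)) hδ] with h hh
  rw [mem_ball_zero_iff] at hh
  refine (ContinuousMap.norm_le _ (by positivity)).2 fun k => ?_
  have hbound : ∀ z ∈ Metric.ball (γ k) δ, ‖f' z - f' (γ k)‖ ≤ c := by
    intro z hz
    -- Translating the whole path by the constant `z - γ k` moves it by exactly that much in the sup
    -- norm, so the radius `δ` serves for every `k`.
    have h1 : dist (γ + ContinuousMap.const K (z - γ k)) γ < δ := by
      rw [dist_eq_norm, add_sub_cancel_left]
      refine lt_of_le_of_lt ((ContinuousMap.norm_le _ (norm_nonneg (z - γ k))).2 fun _ => le_rfl) ?_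
      simpa [dist_eq_norm] using hz
    have h2 := (ContinuousMap.dist_apply_le_dist k).trans_lt (hδ' h1)
    simpa [dist_eq_norm] using h2.le
  have key := Convex.norm_image_sub_le_of_norm_hasFDerivWithin_le' (𝕜 := ℝ) (f := f)
    (fun x _ => (hf x).hasFDerivWithinAt) hbound (convex_ball (γ k) δ)
    (Metric.mem_ball_self hδ) (y := γ k + h k) (by
      simpa [dist_eq_norm] using (h.norm_coe_le_norm k).trans_lt hh)
  rw [add_sub_cancel_left] at key
  exact key.trans (mul_le_mul_of_nonneg_left (h.norm_coe_le_norm k) hc.le)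

/-- The derivative is again a superposition operator, that of `fderiv ℝ f`, followed by a continuous
linear map. The induction therefore passes from the target `F` to `E →L[ℝ] F`, which is why `F` is
generalised and shares a universe with `E`. -/
lemma contDiff_continuousMap_comp_nat {E : Type u} [NormedAddCommGroup E] [NormedSpace ℝ E]
    (n : ℕ) : ∀ {F : Type u} [NormedAddCommGroup F] [NormedSpace ℝ F] (f : C(E, F)),
    ContDiff ℝ ∞ f → ContDiff ℝ n (fun γ : C(K, E) => f.comp γ) := by
  induction n with
  | zero =>
    intro F _ _ f _
    exact contDiff_zero.2 (ContinuousMap.continuous_postcomp f)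
  | succ n ih =>
    intro F _ _ f hf
    have hf' : ContDiff ℝ ∞ (fderiv ℝ f) := hf.fderiv_right (by simp)
    have h1 := ih (⟨fderiv ℝ f, hf'.continuous⟩ : C(E, E →L[ℝ] F)) hf'
    have h2 : ContDiff ℝ n (pointwiseApply K E F) := ContinuousLinearMap.contDiff _
    refine contDiff_succ_iff_hasFDerivAt (n := n) |>.2 ⟨_, h2.comp h1, fun γ => ?_⟩
    exact hasFDerivAt_continuousMap_comp f _
      (fun x => (hf.differentiable (by simp) x).hasFDerivAt) γ

lemma contDiff_continuousMap_comp {E : Type*} [NormedAddCommGroup E] [NormedSpace ℝ E]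
    (f : C(E, E)) (hf : ContDiff ℝ ∞ f) : ContDiff ℝ ∞ (fun γ : C(K, E) => f.comp γ) :=
  contDiff_infty.2 fun n => contDiff_continuousMap_comp_nat n f hf

/-- Integration from the left end point, as an operator on paths. -/
noncomputable def pathIntegral (E : Type*) [NormedAddCommGroup E] [NormedSpace ℝ E] :
    C(unitInterval, E) →L[ℝ] C(unitInterval, E) :=
  LinearMap.mkContinuous
    { toFun := fun γ => ⟨fun τ => ∫ u in (0 : ℝ)..τ, γ (projIcc 0 1 zero_le_one u),
        (intervalIntegral.continuous_primitive
          (fun _ _ => (by fun_prop : Continuous _).intervalIntegrable _ _) 0).comp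
          continuous_subtype_val⟩
      map_add' := fun γ γ' => by
        ext τ
        simpa using intervalIntegral.integral_add
          ((by fun_prop : Continuous fun u => γ (projIcc 0 1 zero_le_one u)).intervalIntegrable _ _)
          ((by fun_prop : Continuous fun u => γ' (projIcc 0 1 zero_le_one u)).intervalIntegrable _ _)
      map_smul' := fun c γ => by
        ext τ
        simp } 1
    (fun γ => by
      rw [one_mul]
      refine (ContinuousMap.norm_le _ (norm_nonneg _)).2 fun τ => ?_
      refine (intervalIntegral.norm_integral_le_of_norm_le_const
        (fun u _ => γ.norm_coe_le_norm _)).trans ?_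
      have h0 := τ.2.1
      have h1 := τ.2.2
      rw [sub_zero, abs_of_nonneg h0]
      exact mul_le_of_le_one_right (norm_nonneg _) h1)

lemma pathIntegral_apply {E : Type*} [NormedAddCommGroup E] [NormedSpace ℝ E]
    (γ : C(unitInterval, E)) (τ : unitInterval) :
    pathIntegral E γ τ = ∫ u in (0 : ℝ)..τ, γ (projIcc 0 1 zero_le_one u) := rfl

/-- If `γ = x + ∫ c` then `τ ↦ τ • v(γ(τ))` is the integral of `v(γ) + τ • Dv(γ) c`. -/
lemma pathIntegral_smul_comp {E : Type*} [NormedAddCommGroup E] [NormedSpace ℝ E] [CompleteSpace E]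
    {v : E → E} (hv : ContDiff ℝ ∞ v) (γ c : C(unitInterval, E)) (x : E)
    (hγ : ∀ τ, γ τ = x + pathIntegral E c τ) (d : C(unitInterval, E))
    (hd : ∀ τ, d τ = v (γ τ) + (τ : ℝ) • fderiv ℝ v (γ τ) (c τ)) (τ : unitInterval) :
    pathIntegral E d τ = (τ : ℝ) • v (γ τ) := by
  have hv' : ContDiff ℝ ∞ (fderiv ℝ v) := hv.fderiv_right (by simp)
  -- Clamping the parameter extends the paths to the whole line, so that two-sided derivatives exist
  -- at the end points as well.
  set C : ℝ → E := fun u => c (projIcc 0 1 zero_le_one u)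
  have hC : Continuous C := by fun_prop
  set G : ℝ → E := fun u => x + ∫ w in (0 : ℝ)..u, C w
  have hG : ∀ u, HasDerivAt G (C u) u := fun u =>
    (hC.integral_hasStrictDerivAt 0 u).hasDerivAt.const_add x
  have hGc : Continuous G := continuous_iff_continuousAt.2 fun u => (hG u).continuousAt
  have hder : ∀ u, HasDerivAt (fun u => u • v (G u)) (u • fderiv ℝ v (G u) (C u) + v (G u)) u := by
    intro u
    have h1 := ((hv.differentiable (by simp) (G u)).hasFDerivAt.comp_hasDerivAt u (hG u))
    exact ((hasDerivAt_id u).smul h1).congr_deriv (by simp)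
  have hint := intervalIntegral.integral_eq_sub_of_hasDerivAt (a := 0) (b := (τ : ℝ))
    (fun u _ => hder u) ((by
      have := hv.continuous
      have := hv'.continuous
      fun_prop : Continuous fun u => u • fderiv ℝ v (G u) (C u) + v (G u)).intervalIntegrable _ _)
  have hGγ : ∀ σ : unitInterval, G σ = γ σ := fun σ => (hγ σ).symm
  rw [pathIntegral_apply, ← hGγ τ]
  rw [zero_smul, sub_zero] at hint
  rw [← hint]
  refine intervalIntegral.integral_congr fun u hu => ?_
  rw [uIcc_of_le τ.2.1] at hu
  have hu' : u ∈ Icc (0 : ℝ) 1 := ⟨hu.1, hu.2.trans τ.2.2⟩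
  simp only [hd, C]
  rw [projIcc_of_mem zero_le_one hu']
  have h2 := hGγ ⟨u, hu'⟩
  simp only at h2
  rw [h2, add_comm]

end Superposition

/-! ### Joint flow of commuting vector fields -/

section Straightening

variable {s : ℕ} {E : Type*} [NormedAddCommGroup E] [NormedSpace ℝ E]

/-- The defect in the integral equation `γ = x + ∫ ∑ tᵢ ξᵢ(γ)`. -/
noncomputable def flowDefect (ξ : Fin s → C(E, E))
    (q : (EuclideanSpace ℝ (Fin s) × E) × C(unitInterval, E)) : C(unitInterval, E) :=
  q.2 - ContinuousMap.const _ q.1.2 - pathIntegral E (∑ i, q.1.1 i • (ξ i).comp q.2)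

/-- Constant paths, as a continuous linear map. -/
noncomputable def constPath (E : Type*) [NormedAddCommGroup E] [NormedSpace ℝ E] :
    E →L[ℝ] C(unitInterval, E) :=
  LinearMap.mkContinuous
    { toFun := fun x => ContinuousMap.const _ x
      map_add' := fun _ _ => rfl
      map_smul' := fun _ _ => rfl } 1
    (fun x => by
      rw [one_mul]
      exact (ContinuousMap.norm_le _ (norm_nonneg _)).2 fun τ => le_rfl)

@[simp] lemma constPath_apply (x : E) (τ : unitInterval) : constPath E x τ = x := rfl

/-- The derivative of the defect. -/
noncomputable def flowDefectDeriv (ξ : Fin s → C(E, E)) (ξ' : Fin s → C(E, E →L[ℝ] E))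
    (q : (EuclideanSpace ℝ (Fin s) × E) × C(unitInterval, E)) :
    (EuclideanSpace ℝ (Fin s) × E) × C(unitInterval, E) →L[ℝ] C(unitInterval, E) :=
  ContinuousLinearMap.snd ℝ _ _ - constPath E ∘L ContinuousLinearMap.snd ℝ _ _ ∘L
      ContinuousLinearMap.fst ℝ _ _
    - pathIntegral E ∘L ∑ i, (q.1.1 i • (pointwiseApply unitInterval E E ((ξ' i).comp q.2)) ∘L
        ContinuousLinearMap.snd ℝ _ _
      + ((EuclideanSpace.proj i : EuclideanSpace ℝ (Fin s) →L[ℝ] ℝ) ∘L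
          ContinuousLinearMap.fst ℝ _ _ ∘L ContinuousLinearMap.fst ℝ _ _).smulRight
          ((ξ i).comp q.2))

lemma hasFDerivAt_flowDefect (ξ : Fin s → C(E, E)) (ξ' : Fin s → C(E, E →L[ℝ] E))
    (hξ : ∀ i x, HasFDerivAt (ξ i) (ξ' i x) x)
    (q : (EuclideanSpace ℝ (Fin s) × E) × C(unitInterval, E)) :
    HasFDerivAt (flowDefect ξ) (flowDefectDeriv ξ ξ' q) q := by
  have h0 : HasFDerivAt (fun q : (EuclideanSpace ℝ (Fin s) × E) × C(unitInterval, E) => q.2)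
      (ContinuousLinearMap.snd ℝ _ _) q := hasFDerivAt_snd
  have h1 := (constPath E ∘L ContinuousLinearMap.snd ℝ (EuclideanSpace ℝ (Fin s)) E ∘L
      ContinuousLinearMap.fst ℝ _ C(unitInterval, E)).hasFDerivAt (x := q)
  have h2 : ∀ i, HasFDerivAt (fun q : (EuclideanSpace ℝ (Fin s) × E) × C(unitInterval, E) =>
      q.1.1 i • (ξ i).comp q.2) _ q := fun i =>
    HasFDerivAt.smul
      (((EuclideanSpace.proj i : EuclideanSpace ℝ (Fin s) →L[ℝ] ℝ) ∘L
          ContinuousLinearMap.fst ℝ _ E ∘L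
          ContinuousLinearMap.fst ℝ _ C(unitInterval, E)).hasFDerivAt (x := q))
      ((hasFDerivAt_continuousMap_comp (ξ i) (ξ' i) (hξ i) q.2).comp q h0)
  have h3 := (pathIntegral E).hasFDerivAt.comp q (HasFDerivAt.fun_sum (u := Finset.univ)
    fun i _ => h2 i)
  exact (h0.sub h1).sub h3

lemma contDiff_flowDefect (ξ : Fin s → C(E, E)) (hξ : ∀ i, ContDiff ℝ ∞ (ξ i)) :
    ContDiff ℝ ∞ (flowDefect ξ) := by
  refine (contDiff_snd.sub ((constPath E).contDiff.comp (contDiff_snd.comp contDiff_fst))).sub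
    ((pathIntegral E).contDiff.comp (ContDiff.sum fun i _ => ?_))
  exact (((EuclideanSpace.proj i : EuclideanSpace ℝ (Fin s) →L[ℝ] ℝ).contDiff.comp
    (contDiff_fst.comp contDiff_fst))).smul
    ((contDiff_continuousMap_comp (ξ i) (hξ i)).comp contDiff_snd)

/-- Commuting vector fields `ξᵢ` have a smooth local joint flow
`Ψ(t, x) = exp(∑ tᵢ ξᵢ)(x)`. -/
theorem exists_joint_flow [CompleteSpace E] (ξ : Fin s → E → E) (hξ : ∀ i, ContDiff ℝ ∞ (ξ i)) {V : Set E}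
    (hV : IsOpen V) {x₀ : E} (hx₀ : x₀ ∈ V)
    (hcomm : ∀ i j, ∀ x ∈ V, fderiv ℝ (ξ i) x (ξ j x) = fderiv ℝ (ξ j) x (ξ i x)) :
    ∃ (Ψ : EuclideanSpace ℝ (Fin s) × E → E) (W : Set (EuclideanSpace ℝ (Fin s) × E)),
      IsOpen W ∧ (0, x₀) ∈ W ∧ ContDiffOn ℝ ∞ Ψ W ∧ MapsTo Ψ W V ∧
      (∀ x, (0, x) ∈ W → Ψ (0, x) = x) ∧
      ∀ q ∈ W, ∀ i, fderiv ℝ Ψ q (EuclideanSpace.single i 1, 0) = ξ i (Ψ q) := by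
  set X : Fin s → C(E, E) := fun i => ⟨ξ i, (hξ i).continuous⟩ with hX
  set X' : Fin s → C(E, E →L[ℝ] E) := fun i =>
    ⟨fderiv ℝ (ξ i), ((hξ i).fderiv_right (m := ∞) (by simp)).continuous⟩ with hX'
  have hXX' : ∀ i x, HasFDerivAt (X i) (X' i x) x := fun i x =>
    ((hξ i).differentiable (by simp) x).hasFDerivAt
  have hG := hasFDerivAt_flowDefect X X' hXX'
  have hGs : ContDiff ℝ ∞ (flowDefect X) := contDiff_flowDefect X hξ
  set P := (EuclideanSpace ℝ (Fin s) × E) with hP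
  set C := C(unitInterval, E) with hC
  -- Keeping the parameters as first component reduces the implicit function theorem for `flowDefect
  -- X = 0` to the inverse function theorem for `K`.
  set K : P × C → P × C := fun q => (q.1, flowDefect X q) with hK
  have hKs : ContDiff ℝ ∞ K := contDiff_fst.prodMk hGs
  have hKd : ∀ q, HasFDerivAt K ((ContinuousLinearMap.fst ℝ P C).prod (flowDefectDeriv X X' q)) q :=
    fun q => hasFDerivAt_fst.prodMk (hG q)
  set q₀ : P × C := ((0, x₀), constPath E x₀) with hq₀
  -- At `t = 0` the integral term does not involve variations of the path, so the derivative of the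
  -- defect in the path is the identity and the derivative of `K` is triangular.
  let eqv : (P × C) ≃L[ℝ] (P × C) :=
    (ContinuousLinearEquiv.refl ℝ P).skewProd (ContinuousLinearEquiv.refl ℝ C)
      ((flowDefectDeriv X X' q₀) ∘L ContinuousLinearMap.inl ℝ P C)
  have heqv : ((ContinuousLinearMap.fst ℝ P C).prod (flowDefectDeriv X X' q₀)) = eqv := by
    refine ContinuousLinearMap.ext fun q => Prod.ext rfl ?_
    obtain ⟨p, c⟩ := q
    have : flowDefectDeriv X X' q₀ (p, c) = flowDefectDeriv X X' q₀ (0, c)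
        + flowDefectDeriv X X' q₀ (p, 0) := by
      rw [← map_add]; simp
    have h0 : flowDefectDeriv X X' q₀ (0, c) = c := by
      simp [flowDefectDeriv, hq₀]
    rw [h0] at this
    exact this
  have hstrict : HasStrictFDerivAt K (eqv : P × C →L[ℝ] P × C) q₀ := by
    rw [← heqv]
    exact hKs.contDiffAt.hasStrictFDerivAt' (hKd q₀) (by simp)
  set e := hstrict.toOpenPartialHomeomorph K with he
  have he_coe : (e : P × C → P × C) = K := hstrict.toOpenPartialHomeomorph_coe
  have hq₀s : q₀ ∈ e.source := hstrict.mem_toOpenPartialHomeomorph_source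
  -- On this open set the linearised equation has a unique solution, and the path stays where the
  -- fields commute.
  set O : Set (P × C) := {q | fderiv ℝ K q ∈ range ((↑) : ((P × C) ≃L[ℝ] (P × C)) → _)} ∩
    {q | ∀ τ, q.2 τ ∈ V} with hO
  have hOo : IsOpen O := by
    refine (ContinuousLinearEquiv.isOpen.preimage (hKs.continuous_fderiv (by simp))).inter ?_
    have h1 : IsOpen {γ : C | MapsTo γ univ V} :=
      ContinuousMap.isOpen_setOfPred_mapsTo isCompact_univ hV
    have h2 : {q : P × C | ∀ τ, q.2 τ ∈ V} = Prod.snd ⁻¹' {γ : C | MapsTo γ univ V} := by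
      ext q; simp [MapsTo]
    rw [h2]
    exact h1.preimage continuous_snd
  have hq₀O : q₀ ∈ O := ⟨⟨eqv, by rw [(hKd q₀).fderiv, heqv]⟩, fun τ => hx₀⟩
  have hKq₀ : K q₀ = ((0, x₀), 0) := by
    refine Prod.ext rfl ?_
    simp only [hK, hq₀, flowDefect]
    ext τ
    simp
  set ι : P → P × C := fun p => (p, 0) with hι
  have hιs : ContDiff ℝ ∞ ι := contDiff_id.prodMk contDiff_const
  -- The last condition puts the constant path at `p.2` in the domain where `e` is injective; for `t
  -- = 0` it solves the equation, hence is the path selected by `e.symm`.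
  set W : Set P := ι ⁻¹' (e.target ∩ e.symm ⁻¹' O) ∩ {p | (p, constPath E p.2) ∈ e.source} with hW
  have hcp : Continuous fun p : P => (p, constPath E p.2) := by fun_prop
  have hWo : IsOpen W := ((e.isOpen_inter_preimage_symm hOo).preimage hιs.continuous).inter
    (e.open_source.preimage hcp)
  have hsymm : ∀ p ∈ W, ContDiffAt ℝ ∞ e.symm (ι p) := by
    intro p hp
    obtain ⟨A, hA⟩ := hp.1.2.1
    refine e.contDiffAt_symm (f₀' := A) hp.1.1 ?_ ?_
    · rw [hA, he_coe]
      exact (hKs.differentiable (by simp) _).hasFDerivAt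
    · rw [he_coe]; exact hKs.contDiffAt
  have hKe : ∀ p ∈ W, K (e.symm (ι p)) = ι p := by
    intro p hp
    rw [← he_coe]
    exact e.right_inv hp.1.1
  set Γ : P → C := fun p => (e.symm (ι p)).2 with hΓ
  have hsΓ : ∀ p ∈ W, e.symm (ι p) = (p, Γ p) := fun p hp =>
    Prod.ext (congrArg Prod.fst (hKe p hp) :) rfl
  have hGΓ : ∀ p ∈ W, flowDefect X (p, Γ p) = 0 := by
    intro p hp
    have := congrArg Prod.snd (hKe p hp)
    rwa [hsΓ p hp] at this
  have hΓs : ∀ p ∈ W, ContDiffAt ℝ ∞ Γ p := fun p hp =>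
    contDiffAt_snd.comp p ((hsymm p hp).comp p hιs.contDiffAt)
  let ev : C →L[ℝ] E := ContinuousMap.evalCLM ℝ (1 : unitInterval)
  refine ⟨fun p => Γ p 1, W, hWo, ?_, ?_, ?_, ?_, ?_⟩
  · refine ⟨⟨?_, ?_⟩, hq₀s⟩
    · have := e.map_source hq₀s
      rwa [he_coe, hKq₀] at this
    · have := e.left_inv hq₀s
      rw [he_coe, hKq₀] at this
      change e.symm ((0, x₀), 0) ∈ O
      rw [this]; exact hq₀O
  · exact fun p hp => (ev.contDiff.contDiffAt.comp p (hΓs p hp)).contDiffWithinAt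
  · exact fun p hp => hp.1.2.2 1
  · intro x hx
    have h1 := e.left_inv hx.2
    have h2 : e ((0, x), constPath E x) = ι (0, x) := by
      rw [he_coe]
      refine Prod.ext rfl ?_
      simp only [hK, hι, flowDefect]
      ext τ
      simp
    simp only at h1
    rw [h2] at h1
    simp only [hΓ, h1]
    rfl
  · intro p hp i
    have hΓd : HasFDerivAt Γ (fderiv ℝ Γ p) p := ((hΓs p hp).differentiableAt (by simp)).hasFDerivAt
    set γ := Γ p with hγ
    set δ : P := (EuclideanSpace.single i 1, 0) with hδ
    set w : C := fderiv ℝ Γ p δ with hw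
    -- The expected derivative of the path in `t_i`: increasing `t_i` by a small `h` should move `γ
    -- τ` by the flow of `ξ i` for time `τ h`, because the fields commute.
    let u : C := ⟨fun τ => (τ : ℝ) • ξ i (γ τ), by have := (hξ i).continuous; fun_prop⟩
    have hγeq : ∀ τ, γ τ = p.2 + pathIntegral E (∑ j, p.1 j • (X j).comp γ) τ := by
      intro τ
      have := congrArg (fun c : C => c τ) (hGΓ p hp)
      change γ τ - p.2 - pathIntegral E (∑ j, p.1 j • (X j).comp γ) τ = 0 at this
      rwa [sub_sub, sub_eq_zero] at this
    have hDw : flowDefectDeriv X X' (p, γ) (δ, w) = 0 := by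
      have h1 : HasFDerivAt (fun p' => flowDefect X (p', Γ p')) (flowDefectDeriv X X' (p, γ) ∘L
          (ContinuousLinearMap.id ℝ P).prod (fderiv ℝ Γ p)) p :=
        HasFDerivAt.comp (f := fun p' => (p', Γ p')) p (hG (p, γ)) ((hasFDerivAt_id p).prodMk hΓd)
      have h2 : (fun p' => flowDefect X (p', Γ p')) =ᶠ[𝓝 p] fun _ => 0 :=
        Filter.eventually_of_mem (hWo.mem_nhds hp) hGΓ
      have h3 := h1.unique ((hasFDerivAt_const (0 : C) p).congr_of_eventuallyEq h2)
      have := congrArg (fun A : P →L[ℝ] C => A δ) h3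
      simpa using this
    -- Commutation replaces `Dξ_j(ξ_i)` by `Dξ_i(ξ_j)` under the integral; the linearised equation
    -- for `u` is then the product rule for `τ • ξ_i(γ τ)`.
    have hDu : flowDefectDeriv X X' (p, γ) (δ, u) = 0 := by
      have hval := pathIntegral_smul_comp (hξ i) γ (∑ j, p.1 j • (X j).comp γ) p.2 hγeq
        (∑ j, (p.1 j • pointwiseApply unitInterval E E ((X' j).comp γ) u
          + (δ.1 j) • (X j).comp γ)) (fun τ => by
            have hτ : γ τ ∈ V := by
              have := hp.1.2.2 τ
              rwa [hsΓ p hp] at this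
            simp only [ContinuousMap.sum_apply, ContinuousMap.add_apply, ContinuousMap.smul_apply,
              pointwiseApply_apply, ContinuousMap.comp_apply, Finset.sum_add_distrib, map_sum,
              Finset.smul_sum, map_smul]
            rw [add_comm]
            congr 1
            · rw [Finset.sum_eq_single i (fun j _ hj => by simp [hδ, hj])
                (fun h => absurd (Finset.mem_univ _) h)]
              simp [hδ, hX]
            · refine Finset.sum_congr rfl fun j _ => ?_
              change p.1 j • fderiv ℝ (ξ j) (γ τ) ((τ : ℝ) • ξ i (γ τ))
                = (τ : ℝ) • p.1 j • fderiv ℝ (ξ i) (γ τ) (ξ j (γ τ))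
              rw [map_smul, smul_comm, hcomm i j _ hτ])
      ext τ
      have := hval τ
      simp only [flowDefectDeriv]
      simp [hδ] at this ⊢
      rw [this]
      simp [u]
    -- Both vectors have the same image under the derivative of `K`, which is invertible at this
    -- point.
    have huw : (δ, w) = (δ, u) := by
      obtain ⟨A, hA⟩ := hp.1.2.1
      rw [hsΓ p hp] at hA
      rw [(hKd (p, γ)).fderiv] at hA
      refine A.injective ?_
      have hA' : ∀ z, A z = (z.1, flowDefectDeriv X X' (p, γ) z) := fun z =>
        congrArg (fun B : P × C →L[ℝ] P × C => B z) hA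
      rw [hA', hA', hDw, hDu]
    have huw' : w = u := congrArg Prod.snd huw
    have hev : HasFDerivAt (fun p => Γ p 1) (ev ∘L fderiv ℝ Γ p) p :=
      ev.hasFDerivAt.comp p hΓd
    rw [hev.fderiv]
    change w 1 = ξ i (γ 1)
    rw [huw']
    exact one_smul ℝ _

end Straightening

/-! ### Coordinates with `ξ_i = ∂/∂t_i` and `η^i = dt_i` -/

section AdaptedCoordinates

variable {s : ℕ} {E : Type*} [NormedAddCommGroup E] [NormedSpace ℝ E]

/-- A smooth map on an open set agrees near each point with a globally smooth map. -/
lemma exists_contDiff_eqOn_ball [FiniteDimensional ℝ E] {F : Type*} [NormedAddCommGroup F]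
    [NormedSpace ℝ F] {V : Set E} (hV : IsOpen V) {x₀ : E} (hx₀ : x₀ ∈ V) :
    ∃ δ > 0, Metric.ball x₀ δ ⊆ V ∧ ∀ f : E → F, ContDiffOn ℝ ∞ f V →
      ∃ f' : E → F, ContDiff ℝ ∞ f' ∧ EqOn f' f (Metric.ball x₀ δ) := by
  obtain ⟨R, hR, hRV⟩ := Metric.isOpen_iff.1 hV x₀ hx₀
  let χ : ContDiffBump x₀ := ⟨R / 4, R / 2, by positivity, by linarith⟩
  refine ⟨R / 4, by positivity, (Metric.ball_subset_ball (by linarith)).trans hRV, fun f hf =>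
    ⟨fun x => χ x • f x, contDiff_iff_contDiffAt.2 fun x => ?_, fun x hx => ?_⟩⟩
  · by_cases hx : x ∈ tsupport χ
    · rw [χ.tsupport_eq] at hx
      have hxV : x ∈ V := hRV (lt_of_le_of_lt (Metric.mem_closedBall.1 hx)
        (show R / 2 < R by linarith))
      exact χ.contDiffAt.smul (hf.contDiffAt (hV.mem_nhds hxV))
    · have : (fun x => χ x • f x) =ᶠ[𝓝 x] fun _ => 0 := by
        filter_upwards [(isClosed_tsupport χ).isOpen_compl.mem_nhds hx] with y hy
        rw [image_eq_zero_of_notMem_tsupport hy, zero_smul]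
      exact contDiffAt_const.congr_of_eventuallyEq this
  · simp only
    rw [χ.one_of_mem_closedBall (Metric.ball_subset_closedBall hx), one_smul]

/-- Coordinates `(t, y)` on an open part of `V` in which `ξᵢ = ∂/∂tᵢ` and `ηⁱ = dtᵢ`. -/
structure IsAdapted {k : ℕ} (V : Set E) (ξ : Fin s → E → E) (η : Fin s → E → E →L[ℝ] ℝ) (r : ℝ)
    (Θ : OpenPartialHomeomorph (EuclideanSpace ℝ (Fin s) × EuclideanSpace ℝ (Fin k)) E) :
    Prop where
  r_pos : 0 < r
  source_eq : Θ.source = Metric.ball 0 r ×ˢ univ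
  target_subset : Θ.target ⊆ V
  contDiffOn : ContDiffOn ℝ ∞ Θ Θ.source
  contDiffOn_symm : ContDiffOn ℝ ∞ Θ.symm Θ.target
  map_single : ∀ q ∈ Θ.source, ∀ i, fderiv ℝ Θ q (EuclideanSpace.single i 1, 0) = ξ i (Θ q)
  η_map : ∀ q ∈ Θ.source, ∀ i w, η i (Θ q) (fderiv ℝ Θ q w) = w.1 i

/-- The inverse function theorem, on a domain reparametrised as the product of a ball and a whole
vector space. -/
lemma exists_openPartialHomeomorph_ball_prod_univ [FiniteDimensional ℝ E] {k : ℕ}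
    (hdim : Module.finrank ℝ E = s + k)
    {U : Set (EuclideanSpace ℝ (Fin s) × EuclideanSpace ℝ (Fin k))} (hUo : IsOpen U)
    (h0U : (0, 0) ∈ U) {Θ₀ : EuclideanSpace ℝ (Fin s) × EuclideanSpace ℝ (Fin k) → E}
    (hΘ₀s : ∀ q ∈ U, ContDiffAt ℝ ∞ Θ₀ q) (hinj : Function.Injective (fderiv ℝ Θ₀ (0, 0))) :
    ∃ (r : ℝ) (Θ : OpenPartialHomeomorph
        (EuclideanSpace ℝ (Fin s) × EuclideanSpace ℝ (Fin k)) E)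
      (u : EuclideanSpace ℝ (Fin k) → EuclideanSpace ℝ (Fin k)),
      0 < r ∧ ContDiff ℝ ∞ u ∧ u 0 = 0 ∧ Θ.source = Metric.ball 0 r ×ˢ univ ∧
      (∀ q, Θ q = Θ₀ (q.1, u q.2)) ∧ (∀ q ∈ Θ.source, (q.1, u q.2) ∈ U) ∧
      ContDiffOn ℝ ∞ Θ Θ.source ∧ ContDiffOn ℝ ∞ Θ.symm Θ.target := by
  have hΘ₀d : ∀ q ∈ U, HasFDerivAt Θ₀ (fderiv ℝ Θ₀ q) q := fun q hq =>
    ((hΘ₀s q hq).differentiableAt (by simp)).hasFDerivAt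
  -- the inverse function theorem
  let A : (EuclideanSpace ℝ (Fin s) × EuclideanSpace ℝ (Fin k)) ≃L[ℝ] E :=
    (LinearEquiv.ofInjectiveOfFinrankEq (fderiv ℝ Θ₀ (0, 0)).toLinearMap hinj
      (by simp [hdim])).toContinuousLinearEquiv
  have hA : (A : _ →L[ℝ] E) = fderiv ℝ Θ₀ (0, 0) := ContinuousLinearMap.ext fun _ => rfl
  have hstrict : HasStrictFDerivAt Θ₀ (A : _ →L[ℝ] E) (0, 0) := by
    rw [hA]
    exact (hΘ₀s _ h0U).hasStrictFDerivAt' (hΘ₀d _ h0U) (by simp)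
  set e := hstrict.toOpenPartialHomeomorph Θ₀ with he
  have he_coe : (e : _ → E) = Θ₀ := hstrict.toOpenPartialHomeomorph_coe
  -- Invertibility of the derivative is required at every point of the domain, not only at the
  -- origin, so that the inverse is smooth on the whole target.
  set O := (U ∩ fderiv ℝ Θ₀ ⁻¹' range
    ((↑) : ((EuclideanSpace ℝ (Fin s) × EuclideanSpace ℝ (Fin k)) ≃L[ℝ] E) → _)) ∩ e.source with hO
  have hOo : IsOpen O := by
    refine (ContinuousOn.isOpen_inter_preimage ?_ hUo ContinuousLinearEquiv.isOpen).inter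
      e.open_source
    exact ContDiffOn.continuousOn_fderiv_of_isOpen (n := ∞)
      (fun q hq => (hΘ₀s q hq).contDiffWithinAt) hUo (by simp)
  have h0O : (0, 0) ∈ O := ⟨⟨h0U, A, hA⟩, hstrict.mem_toOpenPartialHomeomorph_source⟩
  obtain ⟨r, hr, hrO⟩ := Metric.isOpen_iff.1 hOo _ h0O
  rw [← ball_prod_same] at hrO
  -- `univBall` carries the whole space diffeomorphically onto a ball; the slice variable thereby
  -- becomes unrestricted while `t` is left unchanged.
  set P := (OpenPartialHomeomorph.ofSet (Metric.ball (0 : EuclideanSpace ℝ (Fin s)) r)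
    Metric.isOpen_ball).prod
    (OpenPartialHomeomorph.univBall (0 : EuclideanSpace ℝ (Fin k)) r) with hP
  have hPs : P.source = Metric.ball 0 r ×ˢ univ := by simp [hP]
  have hPt : P.target = Metric.ball 0 r ×ˢ Metric.ball 0 r := by
    simp [hP, OpenPartialHomeomorph.univBall_target _ hr]
  have hPO : ∀ q ∈ P.source, P q ∈ O := fun q hq => hrO (by rw [← hPt]; exact P.map_source hq)
  have hPc : ∀ q, P q = (q.1, OpenPartialHomeomorph.univBall (0 : EuclideanSpace ℝ (Fin k)) r q.2) :=
    fun q => rfl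
  have hPsm : ContDiff ℝ ∞ P :=
    contDiff_fst.prodMk (OpenPartialHomeomorph.contDiff_univBall.comp contDiff_snd)
  have hsrc : (P.trans e).source = Metric.ball 0 r ×ˢ univ := by
    rw [OpenPartialHomeomorph.trans_source, hPs]
    refine inter_eq_left.2 fun q hq => (hPO q (by rwa [hPs])).2
  have hcoe : ∀ q, (P.trans e) q = Θ₀ (P q) := fun q => by
    rw [OpenPartialHomeomorph.trans_apply, he_coe]
  have hmemP : ∀ q ∈ (P.trans e).source, P q ∈ O := fun q hq => hPO q (by rwa [hPs, ← hsrc])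
  have hfun : ((P.trans e : OpenPartialHomeomorph _ _) : _ → E) = Θ₀ ∘ P := funext hcoe
  refine ⟨r, P.trans e, OpenPartialHomeomorph.univBall 0 r, hr,
    OpenPartialHomeomorph.contDiff_univBall, OpenPartialHomeomorph.univBall_apply_zero 0 r, hsrc,
    hcoe, fun q hq => (hmemP q hq).1.1, ?_, ?_⟩
  · rw [hfun]
    exact fun q hq => ((hΘ₀s _ (hmemP q hq).1.1).comp q hPsm.contDiffAt).contDiffWithinAt
  · intro x hx
    have hx1 : x ∈ e.target := hx.1
    have hx2 : e.symm x ∈ P.target := hx.2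
    have hx3 : e.symm x ∈ O := hrO (by rw [← hPt]; exact hx2)
    obtain ⟨A', hA'⟩ := hx3.1.2
    have h1 : ContDiffAt ℝ ∞ e.symm x := by
      refine e.contDiffAt_symm (f₀' := A') hx1 ?_ ?_
      · rw [hA', he_coe]; exact hΘ₀d _ hx3.1.1
      · rw [he_coe]; exact hΘ₀s _ hx3.1.1
    have h2 : ContDiffAt ℝ ∞ P.symm (e.symm x) := by
      rw [hPt] at hx2
      have h3 := (OpenPartialHomeomorph.contDiffOn_univBall_symm (n := ⊤)
        (c := (0 : EuclideanSpace ℝ (Fin k))) (r := r)).contDiffAt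
        (Metric.isOpen_ball.mem_nhds hx2.2)
      exact contDiffAt_fst.prodMk (h3.comp _ contDiffAt_snd)
    exact (h2.comp x h1).contDiffWithinAt

/-- Commuting vector fields `ξᵢ` and dual closed `1`-forms `ηⁱ` have adapted coordinates
`(t, y)`, in which `ξᵢ = ∂/∂tᵢ` and `ηⁱ = dtᵢ`. -/
theorem exists_adapted_coordinates [FiniteDimensional ℝ E] {k : ℕ}
    (hdim : Module.finrank ℝ E = s + k) {V : Set E} (hV : IsOpen V)
    {ξ : Fin s → E → E} {η : Fin s → E → E →L[ℝ] ℝ}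
    (hξ : ∀ i, ContDiffOn ℝ ∞ (ξ i) V) (hη : ∀ i, ContDiffOn ℝ ∞ (η i) V)
    (hηξ : ∀ x ∈ V, ∀ i j, η i x (ξ j x) = if i = j then 1 else 0)
    (hcomm : ∀ i j, ∀ x ∈ V, fderiv ℝ (ξ i) x (ξ j x) = fderiv ℝ (ξ j) x (ξ i x))
    (hclosed : ∀ i, ∀ x ∈ V, ∀ v w, fderiv ℝ (η i) x v w = fderiv ℝ (η i) x w v)
    {x₀ : E} (hx₀ : x₀ ∈ V) :
    ∃ (r : ℝ) (Θ : OpenPartialHomeomorph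
        (EuclideanSpace ℝ (Fin s) × EuclideanSpace ℝ (Fin k)) E),
      IsAdapted V ξ η r Θ ∧ Θ (0, 0) = x₀ := by
  obtain ⟨δ, hδ, hδV, hext⟩ := exists_contDiff_eqOn_ball (F := E) hV hx₀
  choose ξ' hξ's hξ'e using fun i => hext (ξ i) (hξ i)
  set B := Metric.ball x₀ δ with hB
  have hBo : IsOpen B := Metric.isOpen_ball
  have hx₀B : x₀ ∈ B := Metric.mem_ball_self hδ
  have hfd : ∀ i, ∀ x ∈ B, fderiv ℝ (ξ' i) x = fderiv ℝ (ξ i) x := fun i x hx =>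
    ((hξ'e i).eventuallyEq_of_mem (hBo.mem_nhds hx)).fderiv_eq
  obtain ⟨Ψ, W₁, hW₁o, hW₁m, hΨs₁, hΨB₁, hΨ0₁, hΨξ₁⟩ := exists_joint_flow ξ' hξ's hBo hx₀B
    (fun i j x hx => by
      rw [hfd i x hx, hfd j x hx, hξ'e i hx, hξ'e j hx]
      exact hcomm i j x (hδV hx))
  obtain ⟨ε, hε, hεW⟩ := Metric.isOpen_iff.1 hW₁o _ hW₁m
  set W := Metric.ball ((0 : EuclideanSpace ℝ (Fin s)), x₀) ε with hW
  have hWo : IsOpen W := Metric.isOpen_ball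
  have hWmem : ∀ t x, (t, x) ∈ W ↔ t ∈ Metric.ball (0 : EuclideanSpace ℝ (Fin s)) ε ∧
      x ∈ Metric.ball x₀ ε := by
    intro t x
    rw [hW, ← ball_prod_same, prodMk_mem_set_prod_eq]
  -- primitives of the forms
  have hprim : ∀ i, ∃ p : E → ℝ, ∀ x ∈ B, HasFDerivAt p (η i x) x := fun i =>
    (convex_ball x₀ δ).exists_forall_hasFDerivAt_of_fderiv_symmetric hBo
      (((hη i).mono hδV).differentiableOn (by simp)) (fun x hx => hclosed i x (hδV hx))
  choose p hp using hprim
  let H : E → EuclideanSpace ℝ (Fin s) := fun x => WithLp.toLp 2 fun i => p i x - p i x₀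
  have hHi : ∀ i, ∀ x ∈ B, HasFDerivAt (fun x => H x i) (η i x) x := fun i x hx =>
    (hp i x hx).sub_const _
  have hHs : ContDiffOn ℝ ∞ H B := by
    refine contDiffOn_euclidean.2 fun i => ?_
    rw [contDiffOn_infty_iff_fderiv_of_isOpen hBo]
    refine ⟨fun x hx => (hHi i x hx).differentiableAt.differentiableWithinAt, ?_⟩
    exact ((hη i).mono hδV).congr fun x hx => (hHi i x hx).fderiv
  have hH0 : H x₀ = 0 := by ext i; simp [H]
  have hHd : ∀ x ∈ B, ∀ v i, (fderiv ℝ H x v) i = η i x v := by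
    intro x hx v i
    have h1 := ((hHs.contDiffAt (hBo.mem_nhds hx)).differentiableAt (by simp)).hasFDerivAt
    have h2 := (EuclideanSpace.proj i : EuclideanSpace ℝ (Fin s) →L[ℝ] ℝ).hasFDerivAt.comp x h1
    have h3 := h2.unique (hHi i x hx)
    exact congrArg (fun A : E →L[ℝ] ℝ => A v) h3
  have hΨat : ∀ q ∈ W, ContDiffAt ℝ ∞ Ψ q := fun q hq =>
    hΨs₁.contDiffAt (hW₁o.mem_nhds (hεW hq))
  have hΨB : ∀ q ∈ W, Ψ q ∈ B := fun q hq => hΨB₁ (hεW hq)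
  have hΨξ : ∀ q ∈ W, ∀ i, fderiv ℝ Ψ q (EuclideanSpace.single i 1, 0) = ξ i (Ψ q) := by
    intro q hq i
    rw [hΨξ₁ q (hεW hq) i, hξ'e i (hΨB q hq)]
  have hΨt : ∀ q ∈ W, ∀ t : EuclideanSpace ℝ (Fin s),
      fderiv ℝ Ψ q (t, 0) = ∑ i, t i • ξ i (Ψ q) := by
    intro q hq t
    have h1 : ((t, 0) : EuclideanSpace ℝ (Fin s) × E)
        = ∑ i, t i • (EuclideanSpace.single i (1 : ℝ), (0 : E)) := by
      refine Prod.ext ?_ ?_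
      · rw [Prod.fst_sum]
        ext j
        simp [Pi.single_apply]
      · rw [Prod.snd_sum]; simp
    rw [h1, map_sum]
    exact Finset.sum_congr rfl fun i _ => by rw [map_smul, hΨξ q hq i]
  -- the primitives grow linearly along the flow
  have hHΨ : ∀ t x, (t, x) ∈ W → x ∈ B → H (Ψ (t, x)) = H x + t := by
    intro t x htx hxB
    have hx := ((hWmem t x).1 htx).2
    have hmem : ∀ t' ∈ Metric.ball (0 : EuclideanSpace ℝ (Fin s)) ε, (t', x) ∈ W := fun t' ht' =>
      (hWmem t' x).2 ⟨ht', hx⟩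
    have hd : ∀ t' ∈ Metric.ball (0 : EuclideanSpace ℝ (Fin s)) ε,
        HasFDerivAt (fun t' => H (Ψ (t', x)) - t') (0 : _ →L[ℝ] EuclideanSpace ℝ (Fin s)) t' := by
      intro t' ht'
      have hq := hmem t' ht'
      have h1 := HasFDerivAt.comp (f := fun t' => (t', x)) t'
        ((hΨat _ hq).differentiableAt (by simp)).hasFDerivAt
        ((hasFDerivAt_id t').prodMk (hasFDerivAt_const x t'))
      have h2 := ((hHs.contDiffAt (hBo.mem_nhds (hΨB _ hq))).differentiableAt
        (by simp)).hasFDerivAt.comp t' h1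
      refine (h2.sub (hasFDerivAt_id t')).congr_fderiv ?_
      ext u j
      have h3 : fderiv ℝ H (Ψ (t', x)) (fderiv ℝ Ψ (t', x) (u, 0)) j = u j := by
        rw [hHd _ (hΨB _ hq), hΨt _ hq, map_sum]
        simp [hηξ _ (hδV (hΨB _ hq))]
      simpa [sub_eq_zero] using h3
    have hconst := (convex_ball (0 : EuclideanSpace ℝ (Fin s)) ε).is_const_of_fderivWithin_eq_zero
      (𝕜 := ℝ) (f := fun t' => H (Ψ (t', x)) - t')
      (fun t' ht' => (hd t' ht').differentiableAt.differentiableWithinAt)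
      (fun t' ht' => by
        rw [fderivWithin_of_isOpen Metric.isOpen_ball ht', (hd t' ht').fderiv])
      ((hWmem t x).1 htx).1 (Metric.mem_ball_self hε)
    have h0 : Ψ (0, x) = x := hΨ0₁ x (hεW (hmem 0 (Metric.mem_ball_self hε)))
    simp only [h0, sub_zero] at hconst
    rw [← hconst]; abel
  -- a transversal
  have hηx₀ := hηξ x₀ hx₀
  obtain ⟨L, hLinj, hL⟩ : ∃ L : EuclideanSpace ℝ (Fin k) →L[ℝ] E, Function.Injective L ∧
      ∀ a i, η i x₀ (L a) = 0 := by
    let T : E →ₗ[ℝ] (Fin s → ℝ) := LinearMap.pi fun i => (η i x₀).toLinearMap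
    have hTs : Function.Surjective T := by
      intro t
      refine ⟨∑ j, t j • ξ j x₀, ?_⟩
      ext i
      simp [T, hηx₀]
    have hk : Module.finrank ℝ (LinearMap.ker T) = k := by
      have h1 := T.finrank_range_add_finrank_ker
      rw [LinearMap.range_eq_top.2 hTs, finrank_top, hdim, Module.finrank_fin_fun] at h1
      omega
    let l : EuclideanSpace ℝ (Fin k) ≃ₗ[ℝ] LinearMap.ker T :=
      LinearEquiv.ofFinrankEq _ _ (by rw [hk, finrank_euclideanSpace_fin])
    refine ⟨LinearMap.toContinuousLinearMap ((LinearMap.ker T).subtype ∘ₗ l.toLinearMap), ?_, ?_⟩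
    · exact Subtype.val_injective.comp l.injective
    · intro a i
      exact congrFun (LinearMap.mem_ker.1 (l a).2) i
  let c : EuclideanSpace ℝ (Fin k) → E := fun y => x₀ + L y
  have hcs : ContDiff ℝ ∞ c := contDiff_const.add L.contDiff
  have hc0 : c 0 = x₀ := by simp [c]
  have hcd : ∀ y, HasFDerivAt c L y := fun y => L.hasFDerivAt.const_add x₀
  -- The affine transversal need only be tangent to `H = 0` at `x₀`. Shifting the flow time by `-H
  -- (c y)` makes `H (Θ₀ (t, y)) = t` exactly, whence `η^i = dt_i`.
  set κ : EuclideanSpace ℝ (Fin s) × EuclideanSpace ℝ (Fin k) → EuclideanSpace ℝ (Fin s) × E :=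
    fun q => (q.1 - H (c q.2), c q.2) with hκ
  have hκs : ∀ q, c q.2 ∈ B → ContDiffAt ℝ ∞ κ q := by
    intro q hq
    have h1 : ContDiffAt ℝ ∞ (fun q : EuclideanSpace ℝ (Fin s) × EuclideanSpace ℝ (Fin k) =>
      c q.2) q := hcs.contDiffAt.comp q contDiffAt_snd
    exact (contDiffAt_fst.sub ((hHs.contDiffAt (hBo.mem_nhds hq)).comp q h1)).prodMk h1
  set B' : Set (EuclideanSpace ℝ (Fin s) × EuclideanSpace ℝ (Fin k)) := {q | c q.2 ∈ B} with hB'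
  have hB'o : IsOpen B' := hBo.preimage (hcs.continuous.comp continuous_snd)
  set U : Set (EuclideanSpace ℝ (Fin s) × EuclideanSpace ℝ (Fin k)) := B' ∩ κ ⁻¹' W with hU
  have hUo : IsOpen U := ContinuousOn.isOpen_inter_preimage
    (fun q hq => (hκs q hq).continuousAt.continuousWithinAt) hB'o hWo
  have hκ0 : κ (0, 0) = (0, x₀) := by simp [hκ, hc0, hH0]
  have h0U : (0, 0) ∈ U := by
    refine ⟨?_, ?_⟩
    · simpa [hB', hc0] using hx₀B
    · rw [mem_preimage, hκ0]; exact Metric.mem_ball_self hε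
  set Θ₀ : EuclideanSpace ℝ (Fin s) × EuclideanSpace ℝ (Fin k) → E := fun q => Ψ (κ q) with hΘ₀
  have hΘ₀s : ∀ q ∈ U, ContDiffAt ℝ ∞ Θ₀ q := fun q hq =>
    (hΨat _ hq.2).comp q (hκs q hq.1)
  have hΘ₀d : ∀ q ∈ U, HasFDerivAt Θ₀ (fderiv ℝ Θ₀ q) q := fun q hq =>
    ((hΘ₀s q hq).differentiableAt (by simp)).hasFDerivAt
  have hΘ₀B : ∀ q ∈ U, Θ₀ q ∈ B := fun q hq => hΨB _ hq.2
  have hHΘ₀ : ∀ q ∈ U, H (Θ₀ q) = q.1 := by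
    intro q hq
    have := hHΨ _ _ hq.2 hq.1
    rw [hΘ₀]
    simp only [hκ] at this ⊢
    rw [this]; abel
  have hκd : ∀ q ∈ U, ∀ w, fderiv ℝ κ q w = (w.1 - fderiv ℝ H (c q.2) (L w.2), L w.2) := by
    intro q hq w
    have h1 := (hcd q.2).comp q (hasFDerivAt_snd (p := q) (𝕜 := ℝ))
    have h2 := ((hHs.contDiffAt (hBo.mem_nhds hq.1)).differentiableAt (by simp)).hasFDerivAt.comp q
      h1
    have h3 : HasFDerivAt κ _ q := ((hasFDerivAt_fst (p := q) (𝕜 := ℝ)).sub h2).prodMk h1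
    rw [h3.fderiv]
    rfl
  have hΘ₀κ : ∀ q ∈ U, ∀ w, fderiv ℝ Θ₀ q w = fderiv ℝ Ψ (κ q) (fderiv ℝ κ q w) := by
    intro q hq w
    have h1 := ((hΨat _ hq.2).differentiableAt (by simp)).hasFDerivAt.comp q
      ((hκs q hq.1).differentiableAt (by simp)).hasFDerivAt
    exact congrArg (fun A : _ →L[ℝ] E => A w) h1.fderiv
  have hΘ₀ξ : ∀ q ∈ U, ∀ i, fderiv ℝ Θ₀ q (EuclideanSpace.single i 1, 0) = ξ i (Θ₀ q) := by
    intro q hq i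
    rw [hΘ₀κ q hq, hκd q hq]
    simp only [map_zero, sub_zero]
    exact hΨξ _ hq.2 i
  have hΘ₀η : ∀ q ∈ U, ∀ i w, η i (Θ₀ q) (fderiv ℝ Θ₀ q w) = w.1 i := by
    intro q hq i w
    rw [← hHd _ (hΘ₀B q hq)]
    have h1 := ((hHs.contDiffAt (hBo.mem_nhds (hΘ₀B q hq))).differentiableAt
      (by simp)).hasFDerivAt.comp q (hΘ₀d q hq)
    have h2 := h1.unique ((hasFDerivAt_fst (p := q) (𝕜 := ℝ)).congr_of_eventuallyEq
      (Filter.eventually_of_mem (hUo.mem_nhds hq) hHΘ₀))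
    have := congrArg (fun A : _ →L[ℝ] EuclideanSpace ℝ (Fin s) => A w) h2
    exact congrArg (fun v : EuclideanSpace ℝ (Fin s) => v i) this
  have hΘ₀0 : Θ₀ (0, 0) = x₀ := by
    rw [hΘ₀]
    simp only [hκ0]
    exact hΨ0₁ x₀ hW₁m
  -- The forms `η^i` recover the `t`-component. A vector `(0, a)` is sent to `L a`, because `dH`
  -- vanishes on the range of `L` at `x₀` and `Ψ (0, ·)` is the identity.
  have hinj : Function.Injective (fderiv ℝ Θ₀ (0, 0)) := by
    rw [injective_iff_map_eq_zero]
    rintro ⟨t, a⟩ hta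
    have ht : t = 0 := by
      ext i
      rw [← hΘ₀η _ h0U i (t, a), hta, map_zero]; rfl
    subst ht
    rw [hΘ₀κ _ h0U, hκd _ h0U, hκ0] at hta
    simp only [hc0] at hta
    have h1 : fderiv ℝ H x₀ (L a) = 0 := by
      ext i
      rw [hHd x₀ hx₀B, hL]; rfl
    rw [h1, sub_zero] at hta
    have hW0 : ((0 : EuclideanSpace ℝ (Fin s)), x₀) ∈ W := Metric.mem_ball_self hε
    have h2 : fderiv ℝ Ψ (0, x₀) (0, L a) = L a := by
      have h3 := HasFDerivAt.comp (f := fun x => ((0 : EuclideanSpace ℝ (Fin s)), x)) x₀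
        ((hΨat _ hW0).differentiableAt (by simp)).hasFDerivAt
        ((hasFDerivAt_const (0 : EuclideanSpace ℝ (Fin s)) x₀).prodMk (hasFDerivAt_id x₀))
      have h4 := h3.unique ((hasFDerivAt_id x₀).congr_of_eventuallyEq (by
        filter_upwards [Metric.ball_mem_nhds x₀ hε] with x hx
        exact hΨ0₁ x (hεW ((hWmem 0 x).2 ⟨Metric.mem_ball_self hε, hx⟩))))
      exact congrArg (fun A : E →L[ℝ] E => A (L a)) h4
    rw [h2] at hta
    rw [hLinj (hta.trans (map_zero L).symm)]; rfl
  obtain ⟨r, Θ, u, hr, hu, hu0, hsrc, hcoe, hmem, hs, hss⟩ :=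
    exists_openPartialHomeomorph_ball_prod_univ hdim hUo h0U hΘ₀s hinj
  have hchain : ∀ q ∈ Θ.source, ∀ w, fderiv ℝ Θ q w
      = fderiv ℝ Θ₀ (q.1, u q.2) (w.1, fderiv ℝ u q.2 w.2) := by
    intro q hq w
    have h1 := (hasFDerivAt_fst (p := q) (𝕜 := ℝ)).prodMk
      (HasFDerivAt.comp q (hu.differentiable (by simp) q.2).hasFDerivAt
        (hasFDerivAt_snd (p := q) (𝕜 := ℝ)))
    have hfun : (Θ : _ → E) = Θ₀ ∘ fun q => (q.1, u q.2) := funext hcoe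
    rw [hfun, (HasFDerivAt.comp (f := fun q => (q.1, u q.2)) q
      (hΘ₀d _ (hmem q hq)) h1).fderiv]
    rfl
  refine ⟨r, Θ, ⟨hr, hsrc, fun x hx => ?_, hs, hss, fun q hq i => ?_, fun q hq i w => ?_⟩, ?_⟩
  · rw [← Θ.right_inv hx, hcoe]
    exact hδV (hΘ₀B _ (hmem _ (Θ.map_target hx)))
  · rw [hchain q hq, hcoe]
    simp only [map_zero]
    exact hΘ₀ξ _ (hmem q hq) i
  · rw [hchain q hq, hcoe]
    exact hΘ₀η _ (hmem q hq) i _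
  · rw [hcoe, hu0]
    exact hΘ₀0

end AdaptedCoordinates

/-! ### Slice metrics and slice endomorphisms in adapted coordinates -/

section LocalStructure

set_option synthInstance.maxHeartbeats 200000

variable {s k : ℕ} {E : Type*} [NormedAddCommGroup E] [NormedSpace ℝ E]

lemma minSmoothness_two_le : minSmoothness ℝ 2 ≤ ∞ := by
  rw [minSmoothness_of_isRCLikeNormedField]
  exact WithTop.coe_le_coe.2 (le_top : (2 : ℕ∞) ≤ ⊤)

/-- Derivatives along the rays `τ ↦ (τ t, y)`. -/
lemma hasDerivAt_ray {G : Type*} [NormedAddCommGroup G] [NormedSpace ℝ G]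
    {φ : EuclideanSpace ℝ (Fin s) × EuclideanSpace ℝ (Fin k) → G}
    {t : EuclideanSpace ℝ (Fin s)} {y : EuclideanSpace ℝ (Fin k)} {τ : ℝ}
    {φ' : _ →L[ℝ] G} (hφ : HasFDerivAt φ φ' (τ • t, y)) :
    HasDerivAt (fun τ : ℝ => φ (τ • t, y)) (φ' (t, 0)) τ := by
  have h1 : HasDerivAt (fun τ : ℝ => (τ • t, y)) (t, 0) τ :=
    (by simpa using (hasDerivAt_id τ).smul_const t : HasDerivAt (fun τ : ℝ => τ • t) t τ).prodMk
      (hasDerivAt_const τ y)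
  exact hφ.comp_hasDerivAt τ h1

/-- The covariant derivative `g((∇_v f) y, z)` for the Levi-Civita connection of `g` on a vector
space, `f` being skew-symmetric, by the Koszul formula. -/
noncomputable def koszulDeriv {F : Type*} [NormedAddCommGroup F] [NormedSpace ℝ F]
    (g : F → F →L[ℝ] F →L[ℝ] ℝ) (f : F → F →L[ℝ] F) (x v y z : F) : ℝ :=
  g x (fderiv ℝ f x v y) z
    + (fderiv ℝ g x v (f x y) z + fderiv ℝ g x (f x y) v z - fderiv ℝ g x z v (f x y)) / 2
    + (fderiv ℝ g x v y (f x z) + fderiv ℝ g x y v (f x z) - fderiv ℝ g x (f x z) v y) / 2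

/-- The tensor identities of a weak `β`-Kenmotsu `f`-structure that are used in a chart. -/
structure IsLocalKenmotsu (V : Set E) (ξ : Fin s → E → E) (η : Fin s → E → E →L[ℝ] ℝ)
    (f : E → E →L[ℝ] E) (g : E → E →L[ℝ] E →L[ℝ] ℝ) (β : E → ℝ) : Prop where
  isOpen : IsOpen V
  smooth_ξ : ∀ i, ContDiffOn ℝ ∞ (ξ i) V
  smooth_η : ∀ i, ContDiffOn ℝ ∞ (η i) V
  smooth_f : ContDiffOn ℝ ∞ f V
  smooth_g : ContDiffOn ℝ ∞ g V
  smooth_β : ContDiffOn ℝ ∞ β V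
  η_ξ : ∀ x ∈ V, ∀ i j, η i x (ξ j x) = if i = j then 1 else 0
  η_f : ∀ x ∈ V, ∀ i v, η i x (f x v) = 0
  g_ξ : ∀ x ∈ V, ∀ i v, g x (ξ i x) v = η i x v
  g_symm : ∀ x ∈ V, ∀ v w, g x v w = g x w v
  g_pos : ∀ x ∈ V, ∀ v, v ≠ 0 → 0 < g x v v
  f_skew : ∀ x ∈ V, ∀ v w, g x (f x v) w = - g x v (f x w)
  f_inj : ∀ x ∈ V, ∀ v, (∀ i, η i x v = 0) → f x v = 0 → v = 0
  comm : ∀ i j, ∀ x ∈ V, fderiv ℝ (ξ i) x (ξ j x) = fderiv ℝ (ξ j) x (ξ i x)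
  closed : ∀ i, ∀ x ∈ V, ∀ v w, fderiv ℝ (η i) x v w = fderiv ℝ (η i) x w v
  lie_g : ∀ i, ∀ x ∈ V, ∀ v w, (∀ j, η j x v = 0) → (∀ j, η j x w = 0) →
    fderiv ℝ g x (ξ i x) v w + g x (fderiv ℝ (ξ i) x v) w + g x v (fderiv ℝ (ξ i) x w)
      = 2 * β x * g x v w
  lie_f : ∀ i, ∀ x ∈ V, ∀ v,
    fderiv ℝ f x (ξ i x) v + f x (fderiv ℝ (ξ i) x v) = fderiv ℝ (ξ i) x (f x v)
  parallel : ∀ x ∈ V, ∀ v y z, (∀ j, η j x y = 0) → (∀ j, η j x z = 0) →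
    koszulDeriv g f x v y z = 0

variable {V : Set E} {ξ : Fin s → E → E} {η : Fin s → E → E →L[ℝ] ℝ}
  {f : E → E →L[ℝ] E} {g : E → E →L[ℝ] E →L[ℝ] ℝ} {β : E → ℝ} {r : ℝ}
  {Θ : OpenPartialHomeomorph (EuclideanSpace ℝ (Fin s) × EuclideanSpace ℝ (Fin k)) E}

namespace IsAdapted

variable (hΘ : IsAdapted V ξ η r Θ)
include hΘ

lemma mem_source {t : EuclideanSpace ℝ (Fin s)} (ht : t ∈ Metric.ball 0 r)
    (y : EuclideanSpace ℝ (Fin k)) : (t, y) ∈ Θ.source := by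
  rw [hΘ.source_eq]; exact ⟨ht, mem_univ _⟩

lemma zero_mem_source (y : EuclideanSpace ℝ (Fin k)) : (0, y) ∈ Θ.source :=
  hΘ.mem_source (Metric.mem_ball_self hΘ.r_pos) y

lemma smul_mem_source {t : EuclideanSpace ℝ (Fin s)} (ht : t ∈ Metric.ball 0 r)
    (y : EuclideanSpace ℝ (Fin k)) {τ : ℝ} (hτ : τ ∈ Icc (0 : ℝ) 1) : (τ • t, y) ∈ Θ.source := by
  refine hΘ.mem_source ?_ y
  rw [mem_ball_zero_iff] at ht ⊢
  rw [norm_smul, Real.norm_of_nonneg hτ.1]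
  exact (mul_le_of_le_one_left (norm_nonneg _) hτ.2).trans_lt ht

lemma mem_V {q} (hq : q ∈ Θ.source) : Θ q ∈ V := hΘ.target_subset (Θ.map_source hq)

lemma contDiffAt {q} (hq : q ∈ Θ.source) : ContDiffAt ℝ ∞ Θ q :=
  hΘ.contDiffOn.contDiffAt (Θ.open_source.mem_nhds hq)

lemma contDiffAt_symm {x} (hx : x ∈ Θ.target) : ContDiffAt ℝ ∞ Θ.symm x :=
  hΘ.contDiffOn_symm.contDiffAt (Θ.open_target.mem_nhds hx)

lemma hasFDerivAt {q} (hq : q ∈ Θ.source) : HasFDerivAt Θ (fderiv ℝ Θ q) q :=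
  ((hΘ.contDiffAt hq).differentiableAt (by simp)).hasFDerivAt

lemma contDiffAt_fderiv {q} (hq : q ∈ Θ.source) : ContDiffAt ℝ ∞ (fderiv ℝ Θ) q :=
  (hΘ.contDiffAt hq).fderiv_right (by simp)

lemma hasFDerivAt_fderiv {q} (hq : q ∈ Θ.source) :
    HasFDerivAt (fderiv ℝ Θ) (fderiv ℝ (fderiv ℝ Θ) q) q :=
  ((hΘ.contDiffAt_fderiv hq).differentiableAt (by simp)).hasFDerivAt

lemma hasFDerivAt_symm {q} (hq : q ∈ Θ.source) :
    HasFDerivAt Θ.symm (fderiv ℝ Θ.symm (Θ q)) (Θ q) :=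
  ((hΘ.contDiffAt_symm (Θ.map_source hq)).differentiableAt (by simp)).hasFDerivAt

lemma fderiv_symm_fderiv {q} (hq : q ∈ Θ.source) (w) :
    fderiv ℝ Θ.symm (Θ q) (fderiv ℝ Θ q w) = w := by
  have h1 := (hΘ.hasFDerivAt_symm hq).comp q (hΘ.hasFDerivAt hq)
  have h2 := h1.unique ((hasFDerivAt_id q).congr_of_eventuallyEq (Θ.eventually_left_inverse hq))
  exact congrArg (fun A : _ →L[ℝ] _ => A w) h2

lemma fderiv_fderiv_symm {q} (hq : q ∈ Θ.source) (v : E) :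
    fderiv ℝ Θ q (fderiv ℝ Θ.symm (Θ q) v) = v := by
  have h0 := hΘ.hasFDerivAt hq
  rw [← Θ.left_inv hq] at h0
  have h1 := h0.comp (Θ q) (hΘ.hasFDerivAt_symm hq)
  have h2 := h1.unique ((hasFDerivAt_id (Θ q)).congr_of_eventuallyEq
    (Θ.eventually_right_inverse (Θ.map_source hq)))
  have := congrArg (fun A : _ →L[ℝ] _ => A v) h2
  simp only [Θ.left_inv hq] at this
  exact this

lemma η_slice {q} (hq : q ∈ Θ.source) (a : EuclideanSpace ℝ (Fin k)) (i : Fin s) :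
    η i (Θ q) (fderiv ℝ Θ q (0, a)) = 0 := by
  rw [hΘ.η_map q hq]; rfl

lemma fderiv_fst {q} (hq : q ∈ Θ.source) (t : EuclideanSpace ℝ (Fin s)) :
    fderiv ℝ Θ q (t, 0) = ∑ i, t i • ξ i (Θ q) := by
  have h1 : ((t, 0) : EuclideanSpace ℝ (Fin s) × EuclideanSpace ℝ (Fin k))
      = ∑ i, t i • (EuclideanSpace.single i (1 : ℝ), (0 : EuclideanSpace ℝ (Fin k))) := by
    refine Prod.ext ?_ ?_
    · rw [Prod.fst_sum]
      ext j
      simp [Pi.single_apply]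
    · rw [Prod.snd_sum]; simp
  rw [h1, map_sum]
  exact Finset.sum_congr rfl fun i _ => by rw [map_smul, hΘ.map_single q hq i]

/-- By symmetry of the second derivative, this is the derivative of `∑ t_i ξ_i ∘ Θ` in the direction
`w`. It governs how slice vectors, pushed forward by `Θ`, vary along rays. -/
lemma fderiv_fderiv_fst (hV : IsOpen V) (hξ : ∀ i, ContDiffOn ℝ ∞ (ξ i) V) {q}
    (hq : q ∈ Θ.source) (t : EuclideanSpace ℝ (Fin s)) (w) :
    fderiv ℝ (fderiv ℝ Θ) q (t, 0) w
      = ∑ i, t i • fderiv ℝ (ξ i) (Θ q) (fderiv ℝ Θ q w) := by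
  have hsymm : IsSymmSndFDerivAt ℝ Θ q := (hΘ.contDiffAt hq).isSymmSndFDerivAt minSmoothness_two_le
  rw [hsymm.eq]
  have h1 := (hΘ.hasFDerivAt_fderiv hq).clm_apply (hasFDerivAt_const (t, 0) q)
  have h2 : HasFDerivAt (fun q => ∑ i, t i • ξ i (Θ q))
      (∑ i, t i • (fderiv ℝ (ξ i) (Θ q) ∘L fderiv ℝ Θ q)) q :=
    HasFDerivAt.fun_sum fun i _ => ((((hξ i).contDiffAt (hV.mem_nhds (hΘ.mem_V hq))).differentiableAt
      (by simp)).hasFDerivAt.comp q (hΘ.hasFDerivAt hq)).const_smul (t i)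
  have h3 := h1.unique (h2.congr_of_eventuallyEq (Filter.eventually_of_mem
    (Θ.open_source.mem_nhds hq) fun q hq => hΘ.fderiv_fst hq t))
  have := congrArg (fun A : _ →L[ℝ] _ => A w) h3
  simpa using this

end IsAdapted

/-- The metric induced on the slice of constant `t`, in adapted coordinates. -/
noncomputable def sliceMetric (g : E → E →L[ℝ] E →L[ℝ] ℝ)
    (Θ : EuclideanSpace ℝ (Fin s) × EuclideanSpace ℝ (Fin k) → E)
    (q : EuclideanSpace ℝ (Fin s) × EuclideanSpace ℝ (Fin k)) :
    EuclideanSpace ℝ (Fin k) →L[ℝ] EuclideanSpace ℝ (Fin k) →L[ℝ] ℝ :=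
  (g (Θ q)).bilinearComp (fderiv ℝ Θ q ∘L ContinuousLinearMap.inr ℝ _ _)
    (fderiv ℝ Θ q ∘L ContinuousLinearMap.inr ℝ _ _)

lemma sliceMetric_apply (q : EuclideanSpace ℝ (Fin s) × EuclideanSpace ℝ (Fin k))
    (a b : EuclideanSpace ℝ (Fin k)) :
    sliceMetric g Θ q a b = g (Θ q) (fderiv ℝ Θ q (0, a)) (fderiv ℝ Θ q (0, b)) := rfl

/-- The endomorphism induced by `f` on the slice `t = 0`, in adapted coordinates. -/
noncomputable def sliceEnd (f : E → E →L[ℝ] E)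
    (Θ : OpenPartialHomeomorph (EuclideanSpace ℝ (Fin s) × EuclideanSpace ℝ (Fin k)) E)
    (y : EuclideanSpace ℝ (Fin k)) : EuclideanSpace ℝ (Fin k) →L[ℝ] EuclideanSpace ℝ (Fin k) :=
  ContinuousLinearMap.snd ℝ _ _ ∘L fderiv ℝ Θ.symm (Θ (0, y)) ∘L f (Θ (0, y)) ∘L
    fderiv ℝ Θ (0, y) ∘L ContinuousLinearMap.inr ℝ _ _

lemma IsAdapted.injective (hΘ : IsAdapted V ξ η r Θ) {q} (hq : q ∈ Θ.source) :
    Function.Injective (fderiv ℝ Θ q) :=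
  Function.LeftInverse.injective (hΘ.fderiv_symm_fderiv hq)

lemma IsAdapted.injective_inr (hΘ : IsAdapted V ξ η r Θ) {q} (hq : q ∈ Θ.source)
    {a : EuclideanSpace ℝ (Fin k)} (ha : fderiv ℝ Θ q (0, a) = 0) : a = 0 :=
  congrArg Prod.snd (hΘ.injective hq (ha.trans (map_zero _).symm))

namespace IsLocalKenmotsu

variable (hK : IsLocalKenmotsu V ξ η f g β) (hΘ : IsAdapted V ξ η r Θ)
include hK hΘ

lemma sliceMetric_pos {q} (hq : q ∈ Θ.source) {a : EuclideanSpace ℝ (Fin k)} (ha : a ≠ 0) :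
    0 < sliceMetric g Θ q a a :=
  hK.g_pos _ (hΘ.mem_V hq) _ fun h => ha (hΘ.injective_inr hq h)

lemma sliceMetric_symm {q} (hq : q ∈ Θ.source) (a b : EuclideanSpace ℝ (Fin k)) :
    sliceMetric g Θ q a b = sliceMetric g Θ q b a := hK.g_symm _ (hΘ.mem_V hq) _ _

lemma hasFDerivAt_g {q} (hq : q ∈ Θ.source) :
    HasFDerivAt (fun q => g (Θ q)) (fderiv ℝ g (Θ q) ∘L fderiv ℝ Θ q) q :=
  (((hK.smooth_g.contDiffAt (hK.isOpen.mem_nhds (hΘ.mem_V hq))).differentiableAt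
    (by simp)).hasFDerivAt).comp q (hΘ.hasFDerivAt hq)

lemma hasFDerivAt_f {q} (hq : q ∈ Θ.source) :
    HasFDerivAt (fun q => f (Θ q)) (fderiv ℝ f (Θ q) ∘L fderiv ℝ Θ q) q :=
  (((hK.smooth_f.contDiffAt (hK.isOpen.mem_nhds (hΘ.mem_V hq))).differentiableAt
    (by simp)).hasFDerivAt).comp q (hΘ.hasFDerivAt hq)

lemma contDiffAt_sliceMetric {q} (hq : q ∈ Θ.source) (a b : EuclideanSpace ℝ (Fin k)) :
    ContDiffAt ℝ ∞ (fun q => sliceMetric g Θ q a b) q := by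
  have h1 := (hK.smooth_g.contDiffAt (hK.isOpen.mem_nhds (hΘ.mem_V hq))).comp q (hΘ.contDiffAt hq)
  have h2 := hΘ.contDiffAt_fderiv hq
  exact (h1.clm_apply (h2.clm_apply contDiffAt_const)).clm_apply (h2.clm_apply contDiffAt_const)

lemma contDiff_sliceMetric_zero : ContDiff ℝ ∞ (fun y => sliceMetric g Θ (0, y)) :=
  contDiff_clm_apply_iff.2 fun a => contDiff_clm_apply_iff.2 fun b =>
    contDiff_iff_contDiffAt.2 fun y => ContDiffAt.comp y
      (f := fun y : EuclideanSpace ℝ (Fin k) => ((0 : EuclideanSpace ℝ (Fin s)), y))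
      (hK.contDiffAt_sliceMetric hΘ (hΘ.zero_mem_source y) a b)
      (contDiffAt_const.prodMk contDiffAt_id)

/-- The variations of `g` and of the two slice vectors add up to the Lie derivative of `g` along `∑
t_i ξ_i`, which is known from `lie_g` because slice vectors lie in D. -/
lemma hasDerivAt_sliceMetric {t : EuclideanSpace ℝ (Fin s)} {y : EuclideanSpace ℝ (Fin k)} {τ : ℝ}
    (hq : (τ • t, y) ∈ Θ.source) (a b : EuclideanSpace ℝ (Fin k)) :
    HasDerivAt (fun τ : ℝ => sliceMetric g Θ (τ • t, y) a b)
      (2 * ((∑ i, t i) * β (Θ (τ • t, y))) * sliceMetric g Θ (τ • t, y) a b) τ := by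
  have hD := hΘ.hasFDerivAt_fderiv hq
  have h1 := ((hK.hasFDerivAt_g hΘ hq).clm_apply (hD.clm_apply
    (hasFDerivAt_const (0, a) _))).clm_apply (hD.clm_apply (hasFDerivAt_const (0, b) _))
  refine (hasDerivAt_ray h1).congr_deriv ?_
  simp only [add_apply, ContinuousLinearMap.comp_apply,
    ContinuousLinearMap.flip_apply, zero_apply, map_zero, zero_add]
  rw [hΘ.fderiv_fderiv_fst hK.isOpen hK.smooth_ξ hq, hΘ.fderiv_fderiv_fst hK.isOpen hK.smooth_ξ hq,
    hΘ.fderiv_fst hq, sliceMetric_apply]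
  simp only [map_sum, map_smul, sum_apply, smul_apply,
    smul_eq_mul, Finset.sum_mul, Finset.mul_sum, ← Finset.sum_add_distrib]
  refine Finset.sum_congr rfl fun i _ => ?_
  have := hK.lie_g i _ (hΘ.mem_V hq) _ _ (hΘ.η_slice hq a) (hΘ.η_slice hq b)
  linear_combination t i * this

/-- The metrics of the slices are conformal along the rays. -/
lemma sliceMetric_mul {t : EuclideanSpace ℝ (Fin s)} (ht : t ∈ Metric.ball 0 r)
    (y e a b : EuclideanSpace ℝ (Fin k)) (he : e ≠ 0) :
    sliceMetric g Θ (t, y) a b = sliceMetric g Θ (t, y) e e / sliceMetric g Θ (0, y) e e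
      * sliceMetric g Θ (0, y) a b := by
  have hpos : ∀ τ ∈ Icc (0 : ℝ) 1, sliceMetric g Θ (τ • t, y) e e ≠ 0 := fun τ hτ =>
    (hK.sliceMetric_pos hΘ (hΘ.smul_mem_source ht y hτ) he).ne'
  -- Numerator and denominator solve the same scalar linear equation, so their ratio is constant
  -- along the ray.
  have hd : ∀ τ ∈ Icc (0 : ℝ) 1, HasDerivAt
      (fun τ : ℝ => sliceMetric g Θ (τ • t, y) a b / sliceMetric g Θ (τ • t, y) e e) 0 τ := by
    intro τ hτ
    have hq := hΘ.smul_mem_source ht y hτ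
    refine ((hK.hasDerivAt_sliceMetric hΘ hq a b).div (hK.hasDerivAt_sliceMetric hΘ hq e e)
      (hpos τ hτ)).congr_deriv ?_
    rw [div_eq_zero_iff]
    left; ring
  have hc := constant_of_has_deriv_right_zero
    (f := fun τ : ℝ => sliceMetric g Θ (τ • t, y) a b / sliceMetric g Θ (τ • t, y) e e)
    (fun τ hτ => (hd τ hτ).continuousAt.continuousWithinAt)
    (fun τ hτ => (hd τ ⟨hτ.1, hτ.2.le⟩).hasDerivWithinAt) 1 (right_mem_Icc.2 zero_le_one)
  simp only [one_smul, zero_smul] at hc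
  have h0 := hpos 0 (left_mem_Icc.2 zero_le_one)
  have h1 := hpos 1 (right_mem_Icc.2 zero_le_one)
  rw [zero_smul] at h0
  rw [one_smul] at h1
  rw [div_eq_div_iff h1 h0] at hc
  field_simp
  linear_combination hc

/-- Since `f` takes values in D and `η^i = dt_i`, the preimage of `f v` under the derivative of `Θ`
has no `t`-component; the projection in `sliceEnd` loses nothing. -/
lemma fderiv_sliceEnd (y a : EuclideanSpace ℝ (Fin k)) :
    fderiv ℝ Θ (0, y) (0, sliceEnd f Θ y a) = f (Θ (0, y)) (fderiv ℝ Θ (0, y) (0, a)) := by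
  have hq := hΘ.zero_mem_source y
  set v := f (Θ (0, y)) (fderiv ℝ Θ (0, y) (0, a)) with hv
  set w := fderiv ℝ Θ.symm (Θ (0, y)) v with hw
  have h1 : fderiv ℝ Θ (0, y) w = v := hΘ.fderiv_fderiv_symm hq v
  have h2 : w.1 = 0 := by
    ext i
    rw [← hΘ.η_map _ hq i w, h1, hK.η_f _ (hΘ.mem_V hq)]; rfl
  have h3 : (0, sliceEnd f Θ y a) = w := Prod.ext h2.symm rfl
  rw [h3, h1]

lemma contDiff_sliceEnd : ContDiff ℝ ∞ (sliceEnd f Θ) := by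
  rw [contDiff_iff_contDiffAt]
  intro y
  have hq := hΘ.zero_mem_source y
  have h0 : ContDiffAt ℝ ∞ (fun y : EuclideanSpace ℝ (Fin k) =>
    ((0 : EuclideanSpace ℝ (Fin s)), y)) y := contDiffAt_const.prodMk contDiffAt_id
  have h1 : ContDiffAt ℝ ∞ (fun y => Θ (0, y)) y := (hΘ.contDiffAt hq).comp y h0
  have h2 : ContDiffAt ℝ ∞ (fun y => fderiv ℝ Θ (0, y)) y := (hΘ.contDiffAt_fderiv hq).comp y h0
  have h3 : ContDiffAt ℝ ∞ (fun y => f (Θ (0, y))) y :=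
    (hK.smooth_f.contDiffAt (hK.isOpen.mem_nhds (hΘ.mem_V hq))).comp y h1
  have h4 : ContDiffAt ℝ ∞ (fun y => fderiv ℝ Θ.symm (Θ (0, y))) y :=
    ((hΘ.contDiffAt_symm (Θ.map_source hq)).fderiv_right (m := ∞) (by simp)).comp y h1
  exact contDiffAt_const.clm_comp (h4.clm_comp (h3.clm_comp (h2.clm_comp contDiffAt_const)))

/-- `f` does not depend on `t` in adapted coordinates. -/
lemma fderiv_sliceEnd_of_mem {t : EuclideanSpace ℝ (Fin s)} (ht : t ∈ Metric.ball 0 r)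
    (y a : EuclideanSpace ℝ (Fin k)) :
    fderiv ℝ Θ (t, y) (0, sliceEnd f Θ y a) = f (Θ (t, y)) (fderiv ℝ Θ (t, y) (0, a)) := by
  set b := sliceEnd f Θ y a with hb
  -- The defect `c` vanishes at `τ = 0` and, because `L_{ξ_i} f = 0`, solves the linear equation `c'
  -- = D c`; Grönwall's inequality makes it vanish throughout.
  let c : ℝ → E := fun τ => fderiv ℝ Θ (τ • t, y) (0, b)
    - f (Θ (τ • t, y)) (fderiv ℝ Θ (τ • t, y) (0, a))
  let D : ℝ → E →L[ℝ] E := fun τ => ∑ i, t i • fderiv ℝ (ξ i) (Θ (τ • t, y))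
  have hc : ∀ τ ∈ Icc (0 : ℝ) 1, HasDerivAt c (D τ (c τ)) τ := by
    intro τ hτ
    have hq := hΘ.smul_mem_source ht y hτ
    have hD := hΘ.hasFDerivAt_fderiv hq
    have h1 := (hD.clm_apply (hasFDerivAt_const (0, b) _)).sub
      ((hK.hasFDerivAt_f hΘ hq).clm_apply (hD.clm_apply (hasFDerivAt_const (0, a) _)))
    refine (hasDerivAt_ray h1).congr_deriv ?_
    simp only [add_apply, ContinuousLinearMap.comp_apply,
      ContinuousLinearMap.flip_apply, zero_apply, map_zero, zero_add,
      sub_apply]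
    rw [hΘ.fderiv_fderiv_fst hK.isOpen hK.smooth_ξ hq,
      hΘ.fderiv_fderiv_fst hK.isOpen hK.smooth_ξ hq, hΘ.fderiv_fst hq]
    simp only [map_sum, map_smul, sum_apply, smul_apply,
      ← Finset.sum_add_distrib, ← Finset.sum_sub_distrib, D, c, map_sub]
    refine Finset.sum_congr rfl fun i _ => ?_
    rw [← hK.lie_f i _ (hΘ.mem_V hq), smul_add]
    abel
  have hDc : ContinuousOn D (Icc 0 1) := by
    refine continuousOn_finsetSum _ fun i _ => ContinuousOn.fun_const_smul (fun τ hτ => ?_) _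
    have hq := hΘ.smul_mem_source ht y hτ
    have h1 : ContinuousAt (fderiv ℝ (ξ i)) (Θ (τ • t, y)) :=
      (((hK.smooth_ξ i).contDiffAt (hK.isOpen.mem_nhds (hΘ.mem_V hq))).fderiv_right
        (m := ∞) (by simp)).continuousAt
    have h2 : ContinuousAt (fun τ : ℝ => Θ (τ • t, y)) τ :=
      ContinuousAt.comp (f := fun τ : ℝ => (τ • t, y)) (hΘ.contDiffAt hq).continuousAt
        (by fun_prop)
    exact (ContinuousAt.comp (f := fun τ : ℝ => Θ (τ • t, y)) h1 h2).continuousWithinAt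
  obtain ⟨C, hC⟩ := isCompact_Icc.exists_bound_of_continuousOn hDc
  have hzero := eq_zero_of_abs_deriv_le_mul_abs_self_of_eq_zero_right (f := c) (K := C)
    (fun τ hτ => (hc τ hτ).continuousAt.continuousWithinAt)
    (fun τ hτ => (hc τ ⟨hτ.1, hτ.2.le⟩).hasDerivWithinAt)
    (by
      simp only [c, zero_smul]
      rw [sub_eq_zero]
      exact hK.fderiv_sliceEnd hΘ y a)
    (fun τ hτ => (D τ).le_of_opNorm_le (hC τ ⟨hτ.1, hτ.2.le⟩) _) 1 (right_mem_Icc.2 zero_le_one)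
  simpa [c, sub_eq_zero] using hzero

lemma sliceEnd_skew (y a b : EuclideanSpace ℝ (Fin k)) :
    sliceMetric g Θ (0, y) (sliceEnd f Θ y a) b = - sliceMetric g Θ (0, y) a (sliceEnd f Θ y b) := by
  simp only [sliceMetric_apply, hK.fderiv_sliceEnd hΘ]
  exact hK.f_skew _ (hΘ.mem_V (hΘ.zero_mem_source y)) _ _

lemma sliceEnd_eq_zero {y a : EuclideanSpace ℝ (Fin k)} (h : sliceEnd f Θ y a = 0) : a = 0 := by
  have hq := hΘ.zero_mem_source y
  have h1 := hK.fderiv_sliceEnd hΘ y a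
  rw [h, Prod.mk_zero_zero, map_zero] at h1
  exact hΘ.injective_inr hq (hK.f_inj _ (hΘ.mem_V hq) _ (hΘ.η_slice hq a) h1.symm)

/-- `f` is parallel along the slice `t = 0`. -/
lemma koszulDeriv_slice (y a b c : EuclideanSpace ℝ (Fin k)) :
    koszulDeriv (fun y => sliceMetric g Θ (0, y)) (sliceEnd f Θ) y a b c = 0 := by
  have hq := hΘ.zero_mem_source y
  set J := sliceEnd f Θ with hJ
  set A : EuclideanSpace ℝ (Fin k) → EuclideanSpace ℝ (Fin k) →L[ℝ] E := fun y =>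
    fderiv ℝ Θ (0, y) ∘L ContinuousLinearMap.inr ℝ _ _ with hA
  have hAJ : ∀ y a, A y (J y a) = f (Θ (0, y)) (A y a) := hK.fderiv_sliceEnd hΘ
  have hi : HasFDerivAt (fun y : EuclideanSpace ℝ (Fin k) => ((0 : EuclideanSpace ℝ (Fin s)), y))
      (ContinuousLinearMap.inr ℝ _ _) y :=
    hasFDerivAt_prodMk_right 0 y
  -- Second derivatives of the parametrisation enter through the pulled-back metric and
  -- endomorphism. By their symmetry, together with the symmetry of `g` and the skewness of `f`,
  -- they cancel, so the Koszul expression pulls back as a tensor.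
  set A' : EuclideanSpace ℝ (Fin k) →L[ℝ] EuclideanSpace ℝ (Fin k) →L[ℝ] E := fderiv ℝ A y with hA'
  have hAd : HasFDerivAt A A' y :=
    (((hΘ.hasFDerivAt_fderiv hq).comp (f := fun y : EuclideanSpace ℝ (Fin k) =>
      ((0 : EuclideanSpace ℝ (Fin s)), y)) y hi).clm_comp
      (hasFDerivAt_const _ _)).differentiableAt.hasFDerivAt
  have hA'e : ∀ u w, A' u w = fderiv ℝ (fderiv ℝ Θ) (0, y) (0, u) (0, w) := by
    intro u w
    have h1 := (hAd.clm_apply (hasFDerivAt_const w y)).unique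
      (((hΘ.hasFDerivAt_fderiv hq).comp (f := fun y : EuclideanSpace ℝ (Fin k) =>
      ((0 : EuclideanSpace ℝ (Fin s)), y)) y hi).clm_apply (hasFDerivAt_const (0, w) y))
    have := congrArg (fun B : _ →L[ℝ] E => B u) h1
    simpa using this
  have hA's : ∀ u w, A' u w = A' w u := by
    intro u w
    rw [hA'e, hA'e]
    exact ((hΘ.contDiffAt hq).isSymmSndFDerivAt minSmoothness_two_le).eq _ _
  have hgd := HasFDerivAt.comp (g := fun q => g (Θ q)) (f := fun y : EuclideanSpace ℝ (Fin k) =>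
      ((0 : EuclideanSpace ℝ (Fin s)), y)) y (hK.hasFDerivAt_g hΘ hq) hi
  have hfd := HasFDerivAt.comp (g := fun q => f (Θ q)) (f := fun y : EuclideanSpace ℝ (Fin k) =>
      ((0 : EuclideanSpace ℝ (Fin s)), y)) y (hK.hasFDerivAt_f hΘ hq) hi
  have hJd : HasFDerivAt J (fderiv ℝ J y) y :=
    ((hK.contDiff_sliceEnd hΘ).differentiable (by simp) y).hasFDerivAt
  have hGdiff : DifferentiableAt ℝ (fun y => sliceMetric g Θ (0, y)) y :=
    (hK.contDiff_sliceMetric_zero hΘ).differentiable (by simp) y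
  have hG : ∀ u v w, fderiv ℝ (fun y => sliceMetric g Θ (0, y)) y u v w
      = fderiv ℝ g (Θ (0, y)) (A y u) (A y v) (A y w) + g (Θ (0, y)) (A' u v) (A y w)
        + g (Θ (0, y)) (A y v) (A' u w) := by
    intro u v w
    have h1 := (hGdiff.hasFDerivAt.clm_apply (hasFDerivAt_const v y)).clm_apply
      (hasFDerivAt_const w y)
    have h2 := (hgd.clm_apply (hAd.clm_apply (hasFDerivAt_const v y))).clm_apply
      (hAd.clm_apply (hasFDerivAt_const w y))
    have h3 := congrArg (fun B : _ →L[ℝ] ℝ => B u) (h1.unique h2)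
    simp at h3
    rw [h3]
    simp [hA]
    ring
  have hf : A y (fderiv ℝ J y a b) = fderiv ℝ f (Θ (0, y)) (A y a) (A y b)
      + f (Θ (0, y)) (A' a b) - A' a (J y b) := by
    have h1 := hAd.clm_apply (hJd.clm_apply (hasFDerivAt_const b y))
    have h2 := hfd.clm_apply (hAd.clm_apply (hasFDerivAt_const b y))
    have h3 := congrArg (fun B : _ →L[ℝ] E => B a) (h1.unique (h2.congr_of_eventuallyEq
      (Filter.Eventually.of_forall fun y => hAJ y b)))
    simp at h3
    rw [eq_sub_iff_add_eq, h3]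
    simp [hA]
    abel
  have hsk := hK.f_skew _ (hΘ.mem_V hq)
  have hsy := hK.g_symm _ (hΘ.mem_V hq)
  have hpar := hK.parallel _ (hΘ.mem_V hq) (A y a) (A y b) (A y c)
    (hΘ.η_slice hq b) (hΘ.η_slice hq c)
  unfold koszulDeriv at hpar ⊢
  have hm : sliceMetric g Θ (0, y) (fderiv ℝ J y a b) c
      = g (Θ (0, y)) (A y (fderiv ℝ J y a b)) (A y c) := rfl
  simp only [hG, hm, hf, hAJ, map_add, map_sub, add_apply,
    sub_apply]
  rw [hA's (J y b) a, hA's c a, hA's c (J y b), hA's b a, hA's (J y c) a, hA's (J y c) b]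
  have e1 := hsk (A' a b) (A y c)
  have e2 := hsy (A' a c) (f (Θ (0, y)) (A y b))
  have e3 := hsy (A y a) (A' (J y b) c)
  have e4 := hsy (A y a) (A' b (J y c))
  have e5 := hsy (A' a (J y c)) (A y b)
  linarith

end IsLocalKenmotsu

end LocalStructure

/-! ### The twisting function -/

section TwistingFunction

variable {s k : ℕ} {E : Type*} [NormedAddCommGroup E] [NormedSpace ℝ E]
variable {V : Set E} {ξ : Fin s → E → E} {η : Fin s → E → E →L[ℝ] ℝ}
  {f : E → E →L[ℝ] E} {g : E → E →L[ℝ] E →L[ℝ] ℝ} {β : E → ℝ} {r : ℝ}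
  {Θ : OpenPartialHomeomorph (EuclideanSpace ℝ (Fin s) × EuclideanSpace ℝ (Fin k)) E}

/-- The logarithm of the conformal factor between the slices, measured on the vector `e`. -/
noncomputable def logFactor (g : E → E →L[ℝ] E →L[ℝ] ℝ)
    (Θ : EuclideanSpace ℝ (Fin s) × EuclideanSpace ℝ (Fin k) → E) (e : EuclideanSpace ℝ (Fin k))
    (q : EuclideanSpace ℝ (Fin s) × EuclideanSpace ℝ (Fin k)) : ℝ :=
  Real.log (sliceMetric g Θ q e e / sliceMetric g Θ (0, q.2) e e) / 2

namespace IsLocalKenmotsu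

variable (hK : IsLocalKenmotsu V ξ η f g β) (hΘ : IsAdapted V ξ η r Θ)
include hK hΘ

lemma sliceMetric_div_pos {e : EuclideanSpace ℝ (Fin k)} (he : e ≠ 0) {q} (hq : q ∈ Θ.source) :
    0 < sliceMetric g Θ q e e / sliceMetric g Θ (0, q.2) e e :=
  div_pos (hK.sliceMetric_pos hΘ hq he) (hK.sliceMetric_pos hΘ (hΘ.zero_mem_source q.2) he)

lemma contDiffAt_logFactor {e : EuclideanSpace ℝ (Fin k)} (he : e ≠ 0) {q} (hq : q ∈ Θ.source) :
    ContDiffAt ℝ ∞ (logFactor g Θ e) q := by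
  have h0 := (hK.contDiffAt_sliceMetric hΘ (hΘ.zero_mem_source q.2) e e).comp q
    (f := fun q : EuclideanSpace ℝ (Fin s) × EuclideanSpace ℝ (Fin k) =>
      ((0 : EuclideanSpace ℝ (Fin s)), q.2)) (contDiffAt_const.prodMk contDiffAt_snd)
  have h1 := (hK.contDiffAt_sliceMetric hΘ hq e e).div h0
    (hK.sliceMetric_pos hΘ (hΘ.zero_mem_source q.2) he).ne'
  exact (h1.log (hK.sliceMetric_div_pos hΘ he hq).ne').div_const 2

lemma exp_logFactor_sq {e : EuclideanSpace ℝ (Fin k)} (he : e ≠ 0) {q} (hq : q ∈ Θ.source) :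
    Real.exp (logFactor g Θ e q) ^ 2
      = sliceMetric g Θ q e e / sliceMetric g Θ (0, q.2) e e := by
  rw [← Real.exp_nat_mul, logFactor]
  push_cast
  rw [mul_div_cancel₀ _ two_ne_zero, Real.exp_log (hK.sliceMetric_div_pos hΘ he hq)]

/-- Along a ray the denominator is constant, and the numerator has logarithmic derivative `2 (∑ t_i)
β`; the 2 is absorbed by the halving that turns `σ²` into `σ`. -/
lemma hasDerivAt_logFactor {e : EuclideanSpace ℝ (Fin k)} (he : e ≠ 0)
    {t : EuclideanSpace ℝ (Fin s)} {y : EuclideanSpace ℝ (Fin k)} {τ : ℝ}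
    (hq : (τ • t, y) ∈ Θ.source) :
    HasDerivAt (fun τ : ℝ => logFactor g Θ e (τ • t, y))
      ((∑ i, t i) * β (Θ (τ • t, y))) τ := by
  have h0 := (hK.sliceMetric_pos hΘ (hΘ.zero_mem_source y) he).ne'
  have h1 := (hK.sliceMetric_pos hΘ hq he).ne'
  refine ((((hK.hasDerivAt_sliceMetric hΘ hq e e).div_const _).log
    (hK.sliceMetric_div_pos hΘ he hq).ne').div_const 2).congr_deriv ?_
  field_simp

lemma logFactor_zero {e : EuclideanSpace ℝ (Fin k)} (he : e ≠ 0) (y : EuclideanSpace ℝ (Fin k)) :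
    logFactor g Θ e (0, y) = 0 := by
  rw [logFactor, div_self (hK.sliceMetric_pos hΘ (hΘ.zero_mem_source y) he).ne', Real.log_one,
    zero_div]

/-- If `β` is constant along the contact distribution, the conformal factor depends on `t` only. -/
lemma logFactor_eq {e : EuclideanSpace ℝ (Fin k)} (he : e ≠ 0)
    (hβ : ∀ x ∈ V, ∀ v, (∀ i, η i x v = 0) → fderiv ℝ β x v = 0)
    {t : EuclideanSpace ℝ (Fin s)} (ht : t ∈ Metric.ball 0 r) (y y' : EuclideanSpace ℝ (Fin k)) :
    logFactor g Θ e (t, y) = logFactor g Θ e (t, y') := by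
  -- Slice directions lie in D, so `β` is constant on each slice.
  have hβΘ : ∀ t : EuclideanSpace ℝ (Fin s), t ∈ Metric.ball 0 r →
      β (Θ (t, y)) = β (Θ (t, y')) := by
    intro t ht
    have hd : ∀ y, HasFDerivAt (fun y => β (Θ (t, y)))
        (0 : EuclideanSpace ℝ (Fin k) →L[ℝ] ℝ) y := by
      intro y
      have hq := hΘ.mem_source ht y
      have h1 := HasFDerivAt.comp (f := fun y => Θ (t, y)) y
        ((hK.smooth_β.contDiffAt (hK.isOpen.mem_nhds (hΘ.mem_V hq))).differentiableAt
          (by simp)).hasFDerivAt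
        (HasFDerivAt.comp (f := fun y => (t, y)) y (hΘ.hasFDerivAt hq)
          (hasFDerivAt_prodMk_right t y))
      refine h1.congr_fderiv ?_
      ext a
      exact hβ _ (hΘ.mem_V hq) _ (hΘ.η_slice hq a)
    exact is_const_of_fderiv_eq_zero (𝕜 := ℝ) (fun y => (hd y).differentiableAt)
      (fun y => (hd y).fderiv) y y'
  have hd : ∀ τ ∈ Icc (0 : ℝ) 1, HasDerivAt
      (fun τ : ℝ => logFactor g Θ e (τ • t, y) - logFactor g Θ e (τ • t, y')) 0 τ := by
    intro τ hτ
    refine ((hK.hasDerivAt_logFactor hΘ he (hΘ.smul_mem_source ht y hτ)).sub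
      (hK.hasDerivAt_logFactor hΘ he (hΘ.smul_mem_source ht y' hτ))).congr_deriv ?_
    have hmem := hΘ.smul_mem_source ht y hτ
    rw [hΘ.source_eq] at hmem
    rw [hβΘ _ hmem.1, sub_self]
  have hc := constant_of_has_deriv_right_zero
    (f := fun τ : ℝ => logFactor g Θ e (τ • t, y) - logFactor g Θ e (τ • t, y'))
    (fun τ hτ => (hd τ hτ).continuousAt.continuousWithinAt)
    (fun τ hτ => (hd τ ⟨hτ.1, hτ.2.le⟩).hasDerivWithinAt) 1 (right_mem_Icc.2 zero_le_one)
  simpa [hK.logFactor_zero hΘ he, sub_eq_zero] using hc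

/-- The relation `g(ξ_i, ·) = η^i = dt_i` makes the `ξ_i` orthonormal and orthogonal to the slices
at once. -/
lemma metric_eq {q} (hq : q ∈ Θ.source)
    (v w : EuclideanSpace ℝ (Fin s) × EuclideanSpace ℝ (Fin k)) :
    g (Θ q) (fderiv ℝ Θ q v) (fderiv ℝ Θ q w) = inner ℝ v.1 w.1 + sliceMetric g Θ q v.2 w.2 := by
  have hsplit : ∀ v : EuclideanSpace ℝ (Fin s) × EuclideanSpace ℝ (Fin k),
      fderiv ℝ Θ q v = fderiv ℝ Θ q (v.1, 0) + fderiv ℝ Θ q (0, v.2) := fun v => by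
    rw [← map_add, Prod.mk_add_mk, add_zero, zero_add]
  have hfst : ∀ (t : EuclideanSpace ℝ (Fin s)) (w),
      g (Θ q) (fderiv ℝ Θ q (t, 0)) (fderiv ℝ Θ q w) = inner ℝ t w.1 := by
    intro t w
    rw [hΘ.fderiv_fst hq, map_sum, sum_apply, PiLp.inner_apply]
    refine Finset.sum_congr rfl fun i _ => ?_
    rw [map_smul, smul_apply, hK.g_ξ _ (hΘ.mem_V hq), hΘ.η_map q hq]
    simp [mul_comm]
  rw [hsplit v, map_add, add_apply, hfst, hsplit w, map_add, hK.g_symm _ (hΘ.mem_V hq) _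
    (fderiv ℝ Θ q (w.1, 0)), hfst, inner_zero_right, zero_add, sliceMetric_apply]

/-- In adapted coordinates the metric is that of a twisted product. -/
theorem exists_twisting_function {e : EuclideanSpace ℝ (Fin k)} (he : e ≠ 0) :
    ∃ σ : EuclideanSpace ℝ (Fin s) × EuclideanSpace ℝ (Fin k) → ℝ,
      ContDiff ℝ ∞ σ ∧ (∀ q, 0 < σ q) ∧
      (∀ t ∈ Metric.ball (0 : EuclideanSpace ℝ (Fin s)) (r / 2), ∀ y v w,
        g (Θ (t, y)) (fderiv ℝ Θ (t, y) v) (fderiv ℝ Θ (t, y) w)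
          = inner ℝ v.1 w.1 + σ (t, y) ^ 2 * sliceMetric g Θ (0, y) v.2 w.2) ∧
      ((∀ x ∈ V, ∀ v, (∀ i, η i x v = 0) → fderiv ℝ β x v = 0) →
        ∃ ρ : EuclideanSpace ℝ (Fin s) → ℝ, ContDiff ℝ ∞ ρ ∧ ∀ t y, σ (t, y) = ρ t) := by
  have hr := hΘ.r_pos
  -- `σ` has to be smooth and positive for all `t`, whereas `logFactor` is controlled only over the
  -- ball of radius `r`. A cutoff inside the exponential preserves positivity and leaves the true
  -- factor unchanged over the ball of radius `r / 2`.
  let χ : ContDiffBump (0 : EuclideanSpace ℝ (Fin s)) :=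
    ⟨r / 2, 3 * r / 4, by positivity, by linarith⟩
  have hχ : tsupport χ ⊆ Metric.ball 0 r := by
    rw [χ.tsupport_eq]
    exact Metric.closedBall_subset_ball (show 3 * r / 4 < r by linarith)
  set σ : EuclideanSpace ℝ (Fin s) × EuclideanSpace ℝ (Fin k) → ℝ := fun q =>
    Real.exp (χ q.1 * logFactor g Θ e q) with hσ
  have hσs : ContDiff ℝ ∞ σ := by
    refine ContDiff.exp (contDiff_iff_contDiffAt.2 fun q => ?_)
    by_cases hq : q.1 ∈ tsupport χ
    · exact (χ.contDiffAt.comp q contDiffAt_fst).mul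
        (hK.contDiffAt_logFactor hΘ he (hΘ.mem_source (hχ hq) q.2))
    · have : (fun q : EuclideanSpace ℝ (Fin s) × EuclideanSpace ℝ (Fin k) =>
          χ q.1 * logFactor g Θ e q) =ᶠ[𝓝 q] fun _ => 0 := by
        filter_upwards [((isClosed_tsupport χ).isOpen_compl.preimage continuous_fst).mem_nhds
          (show q ∈ Prod.fst ⁻¹' (tsupport χ)ᶜ from hq)] with q' hq'
        rw [image_eq_zero_of_notMem_tsupport hq', zero_mul]
      exact contDiffAt_const.congr_of_eventuallyEq this
  refine ⟨σ, hσs, fun q => Real.exp_pos _, fun t ht y v w => ?_, fun hβ =>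
    ⟨fun t => σ (t, 0), hσs.comp (contDiff_id.prodMk contDiff_const), fun t y => ?_⟩⟩
  · have htr : t ∈ Metric.ball (0 : EuclideanSpace ℝ (Fin s)) r :=
      Metric.ball_subset_ball (by linarith) ht
    have hq := hΘ.mem_source htr y
    rw [hK.metric_eq hΘ hq, hK.sliceMetric_mul hΘ htr y e v.2 w.2 he, hσ]
    simp only
    rw [χ.one_of_mem_closedBall (Metric.ball_subset_closedBall ht), one_mul,
      hK.exp_logFactor_sq hΘ he hq]
  -- Over the support of `χ` the factor is independent of `y`; off it `σ` equals 1.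
  · by_cases ht : t ∈ tsupport χ
    · simp only [hσ, hK.logFactor_eq hΘ he hβ (hχ ht) y 0]
    · simp only [hσ, image_eq_zero_of_notMem_tsupport ht, zero_mul]

end IsLocalKenmotsu

end TwistingFunction

/-! ### Smooth fields and the Koszul formula -/

section Smoothness

variable {m : ℕ} {M : Type*} [TopologicalSpace M] [ChartedSpace (EuclideanSpace ℝ (Fin m)) M]
  [IsManifold (𝓡 m) ∞ M]

lemma IsSmoothEndField.app {S : EndField m M} (hS : IsSmoothEndField S) {X : VField m M}
    (hX : IsSmoothVField X) : IsSmoothVField (S.app X) :=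
  ContMDiff.clm_bundle_apply (b := fun x : M => x) hS hX

lemma IsSmoothVField.mdifferentiableAt {X : VField m M} (hX : IsSmoothVField X) (x : M) :
    MDifferentiableAt (𝓡 m) ((𝓡 m).prod 𝓘(ℝ, EuclideanSpace ℝ (Fin m)))
      (fun x => TotalSpace.mk' (EuclideanSpace ℝ (Fin m)) x (X x)) x :=
  ContMDiff.mdifferentiableAt hX (by simp)

lemma IsLeviCivita.sub_eq {g : RMetric m M} {nabla : LinearConnection m M}
    (h : IsLeviCivita g nabla) {X Y : VField m M} (hX : IsSmoothVField X) (hY : IsSmoothVField Y)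
    (x : M) : nabla Y x (X x) - nabla X x (Y x) = mlieBracket (𝓡 m) X Y x :=
  (nabla.torsion_eq_zero_iff.1 h.torsion_free) (hX.mdifferentiableAt x) (hY.mdifferentiableAt x)

/-- The Koszul formula. -/
lemma IsLeviCivita.koszul {g : RMetric m M} {nabla : LinearConnection m M}
    (h : IsLeviCivita g nabla) {X Y Z : VField m M} (hX : IsSmoothVField X)
    (hY : IsSmoothVField Y) (hZ : IsSmoothVField Z) (x : M) :
    2 * g.inner x (nabla Y x (X x)) (Z x)
      = mvfderiv (𝓡 m) (fun y => g.inner y (Y y) (Z y)) x (X x)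
        + mvfderiv (𝓡 m) (fun y => g.inner y (X y) (Z y)) x (Y x)
        - mvfderiv (𝓡 m) (fun y => g.inner y (X y) (Y y)) x (Z x)
        + g.inner x (mlieBracket (𝓡 m) X Y x) (Z x)
        - g.inner x (mlieBracket (𝓡 m) X Z x) (Y x)
        - g.inner x (mlieBracket (𝓡 m) Y Z x) (X x) := by
  rw [h.metric Y Z hY hZ, h.metric X Z hX hZ, h.metric X Y hX hY, ← h.sub_eq hX hY,
    ← h.sub_eq hX hZ, ← h.sub_eq hY hZ]
  simp only [map_sub, sub_apply]
  rw [g.symm x (Y x) (nabla Z x (X x)), g.symm x (X x) (nabla Z x (Y x)),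
    g.symm x (X x) (nabla Y x (Z x))]
  ring

end Smoothness

/-! ### Pointwise algebra of a weak metric `f`-structure -/

namespace WeakMetricFStructure

variable {n s : ℕ} {M : Type*} [TopologicalSpace M]
  [ChartedSpace (EuclideanSpace ℝ (Fin (2 * n + s))) M] [IsManifold (𝓡 (2 * n + s)) ∞ M]
  (S : WeakMetricFStructure n s M)

/-- The formula for `f²` gives `f² ξ_i = -ξ_i + ξ_i = 0`; then `f³ + fQ = 0` reduces to `f Q ξ_i =
0`, with `Q ξ_i = ξ_i`. -/
lemma f_ξ (x : M) (i : Fin s) : S.f x (S.ξ i x) = 0 := by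
  have h1 : S.f x (S.f x (S.ξ i x)) = 0 := by
    rw [S.f_sq, S.Q_ξ]
    simp [S.η_ξ]
  have h2 := S.f_cube x (S.ξ i x)
  rwa [h1, map_zero, zero_add, S.Q_ξ] at h2

lemma η_sub_sum (x : M) (v : TangentSpace (𝓡 (2 * n + s)) x) (i : Fin s) :
    S.η i x (v - ∑ j, S.η j x v • S.ξ j x) = 0 := by
  rw [map_sub, map_sum]
  simp [S.η_ξ]

lemma f_sub_sum (x : M) (v : TangentSpace (𝓡 (2 * n + s)) x) :
    S.f x (v - ∑ j, S.η j x v • S.ξ j x) = S.f x v := by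
  rw [map_sub, map_sum]
  simp [S.f_ξ]

/-- Removing the `ξ`-components of `v` does not change `f v` and leaves a vector of the
`f`-invariant distribution D. -/
lemma η_f (x : M) (i : Fin s) (v : TangentSpace (𝓡 (2 * n + s)) x) : S.η i x (S.f x v) = 0 := by
  rw [← S.f_sub_sum]
  exact S.f_invariant x _ (S.η_sub_sum x v) i

lemma g_ξ (x : M) (i : Fin s) (v : TangentSpace (𝓡 (2 * n + s)) x) :
    S.g.inner x (S.ξ i x) v = S.η i x v := by
  have h := S.compatible x v (S.ξ i x)
  rw [S.f_ξ, map_zero, S.Q_ξ] at h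
  simp only [S.η_ξ] at h
  rw [S.g.symm]
  simp at h
  linarith

/-- On vectors `f w` the equations for `f²` and `f³` give `Q f = f Q`. Compatibility applied to `v`
and `f w` becomes `-g(f v, Q w) = g(v, f Q w)`, and `Q` is surjective. -/
lemma f_skew (x : M) (v w : TangentSpace (𝓡 (2 * n + s)) x) :
    S.g.inner x (S.f x v) w = - S.g.inner x v (S.f x w) := by
  obtain ⟨w, rfl⟩ := (S.nonsingular_Q x).2 w
  have h1 := S.compatible x v (S.f x w)
  have h2 : S.Q x (S.f x w) = S.f x (S.Q x w) := by
    have h3 := S.f_cube x w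
    have h4 := S.f_sq x (S.f x w)
    simp only [S.η_f, zero_smul, Finset.sum_const_zero, add_zero] at h4
    rw [h4, neg_add_eq_zero] at h3
    exact h3
  rw [h2, S.f_sq] at h1
  simp only [S.η_f, mul_zero, Finset.sum_const_zero, sub_zero, map_add, map_neg, map_sum,
    map_smul] at h1
  rw [Finset.sum_eq_zero (fun i _ => by
    rw [S.g.symm, S.g_ξ, S.η_f, smul_zero]), add_zero] at h1
  linarith

/-- On D the square of `f` is `-Q`, which is injective. This is the test used below to show that a
vector vanishes: check `η^i` and `f` on it. -/
lemma eq_zero_of_f_eq_zero (x : M) (v : TangentSpace (𝓡 (2 * n + s)) x)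
    (hη : ∀ i, S.η i x v = 0) (hf : S.f x v = 0) : v = 0 := by
  have h := S.f_sq x v
  rw [hf, map_zero] at h
  simp only [hη, zero_smul, Finset.sum_const_zero, add_zero] at h
  exact (S.nonsingular_Q x).1 ((neg_eq_zero.1 h.symm).trans (map_zero _).symm)

lemma app_ξ (i : Fin s) : S.f.app (S.ξ i) = 0 := funext fun x => S.f_ξ x i

variable {S} {β : M → ℝ} {nabla : LinearConnection (2 * n + s) M}

/-! ### Consequences of normality and of the equation for `∇f` -/

section Kenmotsu

variable (hN : S.IsNormal) (hLC : IsLeviCivita S.g nabla)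
  (hf : ∀ X Y : VField (2 * n + s) M, IsSmoothVField X → IsSmoothVField Y → ∀ x,
      covDerivEnd nabla S.f X Y x
        = β x • (S.g.inner x (S.f x (X x)) (Y x) • S.xiBar x - S.etaBar x (Y x) • S.f x (X x)))

-- At `Y = ξ_i` only `-f(∇_X ξ_i)` survives on the left, and on the right `g(fX, ξ_i) = 0` and
-- `η̄(ξ_i) = 1`.
include hf in
lemma f_nabla_ξ {X : VField (2 * n + s) M} (hX : IsSmoothVField X) (i : Fin s) (x : M) :
    S.f x (nabla (S.ξ i) x (X x)) = β x • S.f x (X x) := by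
  have h := hf X (S.ξ i) hX (S.smooth_ξ i) x
  rw [covDerivEnd, S.app_ξ, nabla.zero, S.g.symm, S.g_ξ, S.η_f] at h
  simp [etaBar, S.η_ξ] at h
  exact h

/-- `2 dη^k(X, Y)` in terms of the Levi-Civita connection. -/
lemma two_mul_extDeriv (hLC : IsLeviCivita S.g nabla) {X Y : VField (2 * n + s) M}
    (hX : IsSmoothVField X) (hY : IsSmoothVField Y) (k : Fin s) (x : M) :
    2 * extDerivOneForm (S.η k) X Y x
      = S.g.inner x (nabla (S.ξ k) x (X x)) (Y x)
        - S.g.inner x (nabla (S.ξ k) x (Y x)) (X x) := by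
  have h1 := hLC.metric _ _ (S.smooth_ξ k) hY x (X x)
  have h2 := hLC.metric _ _ (S.smooth_ξ k) hX x (Y x)
  simp only [S.g_ξ] at h1 h2
  rw [extDerivOneForm, h1, h2, ← hLC.sub_eq hX hY, map_sub]
  ring

-- As `f ξ_i = 0`, the torsion `[f,f](ξ_i, Y)` lies in the image of `f`, which `η^k` annihilates;
-- applying `η^k` to normality isolates `dη^k`.
include hN in
lemma extDeriv_ξ {Y : VField (2 * n + s) M} (hY : IsSmoothVField Y) (i k : Fin s) (x : M) :
    2 * extDerivOneForm (S.η k) (S.ξ i) Y x = 0 := by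
  have h := congrArg (S.η k x) (hN (S.ξ i) Y (S.smooth_ξ i) hY x)
  rw [nijenhuis, S.app_ξ, mlieBracket_zero_left, mlieBracket_zero_left] at h
  simp [S.η_f, S.η_ξ] at h
  rw [h, mul_zero]

-- Normality reduces to `f²[ξ_i, ξ_j] = 0`, so `f[ξ_i, ξ_j] = 0` by injectivity on D. The
-- `η^k`-components vanish since `dη^k(ξ_i, ξ_j) = 0` and the functions `η^k(ξ_j)` are constant.
include hN in
lemma mlieBracket_ξ_ξ (i j : Fin s) (x : M) :
    mlieBracket (𝓡 (2 * n + s)) (S.ξ i) (S.ξ j) x = 0 := by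
  set w := mlieBracket (𝓡 (2 * n + s)) (S.ξ i) (S.ξ j) x with hw
  have h1 : S.f x (S.f x w) = 0 := by
    have h := hN (S.ξ i) (S.ξ j) (S.smooth_ξ i) (S.smooth_ξ j) x
    rw [Finset.sum_eq_zero (fun k _ => by rw [extDeriv_ξ hN (S.smooth_ξ j), zero_smul]), add_zero,
      nijenhuis, S.app_ξ, S.app_ξ, mlieBracket_zero_left, mlieBracket_zero_left,
      mlieBracket_zero_right] at h
    simpa using h
  have h2 : S.f x w = 0 := S.eq_zero_of_f_eq_zero x _ (fun k => S.η_f x k w) h1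
  have h3 : ∀ k, S.η k x w = 0 := by
    intro k
    have h := extDeriv_ξ hN (S.smooth_ξ j) i k x
    rw [extDerivOneForm] at h
    simp only [S.η_ξ, mvfderiv_const] at h
    simp at h
    exact h
  exact S.eq_zero_of_f_eq_zero x w h3 h2

include hLC in
lemma inner_nabla_ξ_ξ {X : VField (2 * n + s) M} (i k : Fin s) (x : M) :
    S.g.inner x (nabla (S.ξ i) x (X x)) (S.ξ k x)
      = - S.g.inner x (nabla (S.ξ k) x (X x)) (S.ξ i x) := by
  have h := hLC.metric _ _ (S.smooth_ξ i) (S.smooth_ξ k) x (X x)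
  simp only [S.g_ξ, S.η_ξ, mvfderiv_const] at h
  rw [S.g.symm, S.g_ξ]
  rw [S.g.symm, S.g_ξ] at h
  rw [S.g.symm, S.g_ξ]
  simp at h
  linarith

-- The numbers `g(∇_{ξ_j} ξ_i, ξ_k)` are symmetric in `i, j` because the fields commute, and skew in
-- `i, k` because the frame is orthonormal; such an array is zero. The remaining part of the vector
-- is killed through `f`.
include hN hLC hf in
lemma nabla_ξ_ξ (i j : Fin s) (x : M) : nabla (S.ξ i) x (S.ξ j x) = 0 := by
  have hsymm : ∀ i j, nabla (S.ξ i) x (S.ξ j x) = nabla (S.ξ j) x (S.ξ i x) := fun i j =>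
    sub_eq_zero.1 ((hLC.sub_eq (S.smooth_ξ j) (S.smooth_ξ i) x).trans (mlieBracket_ξ_ξ hN j i x))
  have hanti := fun i j k => inner_nabla_ξ_ξ hLC (X := S.ξ j) i k x
  have hη : ∀ k, S.η k x (nabla (S.ξ i) x (S.ξ j x)) = 0 := by
    intro k
    rw [← S.g_ξ, S.g.symm]
    have h1 := hanti i j k
    have h2 := hanti k i j
    have h3 := hanti j k i
    rw [hsymm k j] at h1
    rw [hsymm j i] at h2
    rw [hsymm k i] at h2
    rw [hsymm i k] at h2
    rw [hsymm k i] at h2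
    linarith [hsymm i k ▸ h3]
  refine S.eq_zero_of_f_eq_zero x _ hη ?_
  rw [f_nabla_ξ hf (S.smooth_ξ j), S.f_ξ, smul_zero]

include hN hLC hf in
/-- `∇_X ξ_i = β (X - ∑ η^j(X) ξ_j)`. -/
lemma nabla_ξ {X : VField (2 * n + s) M} (hX : IsSmoothVField X) (i : Fin s) (x : M) :
    nabla (S.ξ i) x (X x) = β x • (X x - ∑ j, S.η j x (X x) • S.ξ j x) := by
  -- In `dη^k(ξ_i, X) = 0` the term with `∇_{ξ_i} ξ_k` is zero; the other is `g(∇_X ξ_k, ξ_i) =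
  -- -g(∇_X ξ_i, ξ_k)`.
  have hη : ∀ k, S.η k x (nabla (S.ξ i) x (X x)) = 0 := by
    intro k
    have h1 := extDeriv_ξ hN hX i k x
    rw [two_mul_extDeriv hLC (S.smooth_ξ i) hX, nabla_ξ_ξ hN hLC hf, inner_nabla_ξ_ξ hLC, map_zero,
      zero_apply, zero_sub, neg_neg, S.g.symm, S.g_ξ] at h1
    exact h1
  refine sub_eq_zero.1 (S.eq_zero_of_f_eq_zero x _ (fun k => ?_) ?_)
  · rw [map_sub, hη, map_smul, S.η_sub_sum, smul_zero, sub_zero]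
  · rw [map_sub, f_nabla_ξ hf hX, map_smul, S.f_sub_sum, sub_self]

-- `dη^k` is the skew part of `X ↦ ∇_X ξ_k`, and the formula for the latter is self-adjoint.
include hN hLC hf in
lemma extDeriv_eq_zero {X Y : VField (2 * n + s) M} (hX : IsSmoothVField X)
    (hY : IsSmoothVField Y) (k : Fin s) (x : M) : 2 * extDerivOneForm (S.η k) X Y x = 0 := by
  rw [two_mul_extDeriv hLC hX hY, nabla_ξ hN hLC hf hX, nabla_ξ hN hLC hf hY]
  simp only [map_smul, smul_apply, map_sub, sub_apply, map_sum, sum_apply, S.g_ξ]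
  rw [S.g.symm x (Y x) (X x)]
  simp only [smul_eq_mul, mul_comm]
  ring

include hN hLC hf in
/-- The Lie derivative of the metric along `ξ_i`. -/
lemma lie_ξ_g {X Y : VField (2 * n + s) M} (hX : IsSmoothVField X)
    (hY : IsSmoothVField Y) (i : Fin s) (x : M) (hXη : ∀ j, S.η j x (X x) = 0)
    (hYη : ∀ j, S.η j x (Y x) = 0) :
    mvfderiv (𝓡 (2 * n + s)) (fun y => S.g.inner y (X y) (Y y)) x (S.ξ i x)
      - S.g.inner x (mlieBracket (𝓡 (2 * n + s)) (S.ξ i) X x) (Y x)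
      - S.g.inner x (X x) (mlieBracket (𝓡 (2 * n + s)) (S.ξ i) Y x)
      = 2 * β x * S.g.inner x (X x) (Y x) := by
  rw [hLC.metric X Y hX hY, ← hLC.sub_eq (S.smooth_ξ i) hX, ← hLC.sub_eq (S.smooth_ξ i) hY,
    nabla_ξ hN hLC hf hX, nabla_ξ hN hLC hf hY]
  simp only [hXη, hYη, zero_smul, Finset.sum_const_zero, sub_zero, map_sub, sub_apply, map_smul,
    smul_apply, smul_eq_mul]
  ring

include hN hLC hf in
/-- The Lie derivative of `f` along `ξ_i` vanishes. -/
lemma lie_ξ_f {X : VField (2 * n + s) M} (hX : IsSmoothVField X) (i : Fin s) (x : M) :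
    mlieBracket (𝓡 (2 * n + s)) (S.ξ i) (S.f.app X) x
      = S.f x (mlieBracket (𝓡 (2 * n + s)) (S.ξ i) X x) := by
  have hfX := S.smooth_f.app hX
  have h := hf (S.ξ i) X (S.smooth_ξ i) hX x
  rw [S.f_ξ, covDerivEnd] at h
  simp only [map_zero, zero_apply, zero_smul, smul_zero, sub_zero] at h
  rw [← hLC.sub_eq (S.smooth_ξ i) hX, ← hLC.sub_eq (S.smooth_ξ i) hfX, sub_eq_zero.1 h,
    nabla_ξ hN hLC hf hX, nabla_ξ hN hLC hf hfX, map_sub, map_smul, S.f_sub_sum]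
  simp [EndField.app, S.η_f]

include hf in
/-- The equation for `∇f`, after the Koszul formula. -/
lemma koszul_f {X Y Z : VField (2 * n + s) M} (hX : IsSmoothVField X)
    (hY : IsSmoothVField Y) (x : M)
    (hYη : ∀ j, S.η j x (Y x) = 0) (hZη : ∀ j, S.η j x (Z x) = 0) :
    S.g.inner x (nabla (S.f.app Y) x (X x)) (Z x)
      + S.g.inner x (nabla Y x (X x)) (S.f.app Z x) = 0 := by
  have h := congrArg (fun v => S.g.inner x v (Z x)) (hf X Y hX hY x)
  simp only [covDerivEnd, map_sub, sub_apply, map_smul, smul_apply, S.f_skew] at h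
  have h1 : S.g.inner x (S.xiBar x) (Z x) = 0 := by
    simp [xiBar, S.g_ξ, hZη]
  have h2 : S.etaBar x (Y x) = 0 := by simp [etaBar, hYη]
  rw [h1, h2] at h
  simp at h
  rw [EndField.app]
  linarith

end Kenmotsu

end WeakMetricFStructure

/-! ### Vector fields and tensors read in a chart -/

section ChartRepresentation

variable {m : ℕ} {M : Type*} [TopologicalSpace M] [ChartedSpace (EuclideanSpace ℝ (Fin m)) M]

/-- The inverse of the preferred chart at `p`. -/
noncomputable def chartInv (p : M) : EuclideanSpace ℝ (Fin m) → M := (extChartAt (𝓡 m) p).symm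

/-- The domain of `chartInv p`. -/
def chartDom (m : ℕ) {M : Type*} [TopologicalSpace M] [ChartedSpace (EuclideanSpace ℝ (Fin m)) M]
    (p : M) : Set (EuclideanSpace ℝ (Fin m)) := (extChartAt (𝓡 m) p).target

/-- The derivative of `chartInv p`. -/
noncomputable def chartD (p : M) (y : EuclideanSpace ℝ (Fin m)) :
    EuclideanSpace ℝ (Fin m) →L[ℝ] TangentSpace (𝓡 m) (chartInv (m := m) p y) :=
  mfderiv 𝓘(ℝ, EuclideanSpace ℝ (Fin m)) (𝓡 m) (chartInv (m := m) p) y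

/-- The inverse of the derivative of `chartInv p`. -/
noncomputable def chartDInv (p : M) (y : EuclideanSpace ℝ (Fin m)) :
    TangentSpace (𝓡 m) (chartInv (m := m) p y) →L[ℝ] EuclideanSpace ℝ (Fin m) :=
  (chartD (m := m) p y).inverse

/-- A vector field in a chart. -/
noncomputable def chartField (p : M) (X : VField m M) (y : EuclideanSpace ℝ (Fin m)) :
    EuclideanSpace ℝ (Fin m) := chartDInv p y (X (chartInv p y))

/-- A `1`-form in a chart. -/
noncomputable def chartForm (p : M) (α : OneForm m M) (y : EuclideanSpace ℝ (Fin m)) :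
    EuclideanSpace ℝ (Fin m) →L[ℝ] ℝ := α (chartInv p y) ∘L chartD p y

/-- A `(1,1)`-tensor field in a chart. -/
noncomputable def chartEnd (p : M) (S : EndField m M) (y : EuclideanSpace ℝ (Fin m)) :
    EuclideanSpace ℝ (Fin m) →L[ℝ] EuclideanSpace ℝ (Fin m) :=
  chartDInv p y ∘L S (chartInv p y) ∘L chartD p y

lemma isOpen_chartDom (p : M) : IsOpen (chartDom m p) := isOpen_extChartAt_target p

lemma mlieBracket_vectorSpace (A B : EuclideanSpace ℝ (Fin m) → EuclideanSpace ℝ (Fin m))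
    (y : EuclideanSpace ℝ (Fin m)) :
    mlieBracket 𝓘(ℝ, EuclideanSpace ℝ (Fin m)) A B y
      = fderiv ℝ B y (A y) - fderiv ℝ A y (B y) := by
  have h1 : mlieBracketWithin 𝓘(ℝ, EuclideanSpace ℝ (Fin m)) A B univ y
      = lieBracketWithin ℝ A B univ y :=
    congrFun mlieBracketWithin_eq_lieBracketWithin y
  rw [lieBracketWithin_univ] at h1
  exact (congrFun mlieBracketWithin_univ.symm y).trans h1

variable [IsManifold (𝓡 m) ∞ M]

/-- A Riemannian metric in a chart. -/
noncomputable def chartMetric (p : M) (g : RMetric m M) (y : EuclideanSpace ℝ (Fin m)) :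
    EuclideanSpace ℝ (Fin m) →L[ℝ] EuclideanSpace ℝ (Fin m) →L[ℝ] ℝ :=
  ContinuousLinearMap.bilinearComp
    (show EuclideanSpace ℝ (Fin m) →L[ℝ] EuclideanSpace ℝ (Fin m) →L[ℝ] ℝ from
      g.inner (chartInv p y))
    (show EuclideanSpace ℝ (Fin m) →L[ℝ] EuclideanSpace ℝ (Fin m) from chartD p y)
    (show EuclideanSpace ℝ (Fin m) →L[ℝ] EuclideanSpace ℝ (Fin m) from chartD p y)

lemma chartMetric_apply (p : M) (g : RMetric m M) (y v w : EuclideanSpace ℝ (Fin m)) :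
    chartMetric p g y v w = g.inner (chartInv p y) (chartD p y v) (chartD p y w) := rfl

lemma contMDiffAt_chartInv {p : M} {y : EuclideanSpace ℝ (Fin m)} (hy : y ∈ chartDom m p) :
    ContMDiffAt 𝓘(ℝ, EuclideanSpace ℝ (Fin m)) (𝓡 m) ∞ (chartInv (m := m) p) y :=
  (contMDiffOn_extChartAt_symm p).contMDiffAt ((isOpen_chartDom p).mem_nhds hy)

lemma chartD_isInvertible {p : M} {y : EuclideanSpace ℝ (Fin m)} (hy : y ∈ chartDom m p) :
    (chartD (m := m) p y).IsInvertible := by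
  have : IsManifold (𝓡 m) 1 M := IsManifold.of_le (n := ∞) (by simp)
  have := isInvertible_mfderivWithin_extChartAt_symm (I := 𝓡 m) hy
  rwa [ModelWithCorners.range_eq_univ, mfderivWithin_univ] at this

lemma chartD_chartDInv {p : M} {y : EuclideanSpace ℝ (Fin m)} (hy : y ∈ chartDom m p)
    (v : TangentSpace (𝓡 m) (chartInv (m := m) p y)) : chartD p y (chartDInv p y v) = v := by
  obtain ⟨A, hA⟩ := chartD_isInvertible hy
  rw [chartDInv, ← hA, ContinuousLinearMap.inverse_equiv]
  exact A.apply_symm_apply v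

lemma chartDInv_chartD {p : M} {y : EuclideanSpace ℝ (Fin m)} (hy : y ∈ chartDom m p)
    (v : EuclideanSpace ℝ (Fin m)) : chartDInv p y (chartD p y v) = v := by
  obtain ⟨A, hA⟩ := chartD_isInvertible hy
  rw [chartDInv, ← hA, ContinuousLinearMap.inverse_equiv]
  exact A.symm_apply_apply v

lemma chartD_chartField {p : M} {y : EuclideanSpace ℝ (Fin m)} (hy : y ∈ chartDom m p)
    (X : VField m M) : chartD p y (chartField p X y) = X (chartInv p y) :=
  chartD_chartDInv hy _

lemma contDiffAt_chartField {p : M} {y : EuclideanSpace ℝ (Fin m)} (hy : y ∈ chartDom m p)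
    {X : VField m M} (hX : IsSmoothVField X) : ContDiffAt ℝ ∞ (chartField p X) y := by
  refine (contMDiffAt_vectorSpace_iff_contDiffAt (V := fun y => chartField p X y)).1 ?_
  have : IsManifold (𝓡 m) (∞ + 1) M := by simpa
  exact ContMDiffAt.mpullback_vectorField_preimage (hX _) (contMDiffAt_chartInv hy)
    (chartD_isInvertible hy) (by simp)

/-- Naturality of the Lie bracket under pullback by the local diffeomorphism `chartInv p`. -/
lemma mlieBracket_chartInv {p : M} {y : EuclideanSpace ℝ (Fin m)} (hy : y ∈ chartDom m p)
    {X Y : VField m M} (hX : IsSmoothVField X) (hY : IsSmoothVField Y) :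
    mlieBracket (𝓡 m) X Y (chartInv p y) = chartD p y
      (fderiv ℝ (chartField p Y) y (chartField p X y)
        - fderiv ℝ (chartField p X) y (chartField p Y y)) := by
  have : IsManifold (𝓡 m) (minSmoothness ℝ 2) M := IsManifold.of_le (n := ∞) minSmoothness_two_le
  have h := mpullback_mlieBracket (hX.mdifferentiableAt _) (hY.mdifferentiableAt _)
    (contMDiffAt_chartInv hy) minSmoothness_two_le
  have h2 : chartDInv p y (mlieBracket (𝓡 m) X Y (chartInv p y))
      = fderiv ℝ (chartField p Y) y (chartField p X y)
        - fderiv ℝ (chartField p X) y (chartField p Y y) := h.trans (mlieBracket_vectorSpace _ _ _)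
  rw [← h2, chartD_chartDInv hy]

lemma mvfderiv_chartInv {p : M} {y : EuclideanSpace ℝ (Fin m)} (hy : y ∈ chartDom m p)
    {u : M → ℝ} (hu : MDifferentiableAt (𝓡 m) 𝓘(ℝ, ℝ) u (chartInv (m := m) p y))
    (w : EuclideanSpace ℝ (Fin m)) :
    mvfderiv (𝓡 m) u (chartInv p y) (chartD p y w) = fderiv ℝ (fun y => u (chartInv p y)) y w := by
  have h := mvfderiv_comp_apply y hu ((contMDiffAt_chartInv hy).mdifferentiableAt (by simp)) w
  rw [mvfderiv] at h
  refine h.symm.trans ?_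
  rw [mfderiv_eq_fderiv]
  rfl

/-- Coordinate fields near `p` extend to global smooth vector fields. -/
lemma exists_global_coordinate_fields [T2Space M] (p : M) :
    ∃ U : Set (EuclideanSpace ℝ (Fin m)), IsOpen U ∧ extChartAt (𝓡 m) p p ∈ U ∧ U ⊆ chartDom m p ∧
      ∀ v : EuclideanSpace ℝ (Fin m), ∃ X : VField m M, IsSmoothVField X ∧
        ∀ y ∈ U, chartField p X y = v := by
  -- Normality and the equation for `∇f` are identities for globally smooth fields, so the
  -- coordinate fields are cut off by `χ`; `U` lies where `χ = 1`.
  let χ : SmoothBumpFunction (𝓡 m) p := Classical.arbitrary _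
  obtain ⟨O, hO1, hOo, hpO⟩ := eventually_nhds_iff.1 χ.eventuallyEq_one
  refine ⟨chartDom m p ∩ chartInv (m := m) p ⁻¹' O, ?_, ?_, inter_subset_left, fun v => ?_⟩
  · exact (continuousOn_extChartAt_symm p).isOpen_inter_preimage (isOpen_chartDom p) hOo
  · refine ⟨mem_extChartAt_target p, ?_⟩
    change (extChartAt (𝓡 m) p).symm _ ∈ O
    rwa [extChartAt_to_inv]
  · have : IsManifold (𝓡 m) 1 M := IsManifold.of_le (n := ∞) (by simp)
    have : IsManifold (𝓡 m) (∞ + 1) M := by simpa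
    let Y : VField m M := mpullback (𝓡 m) 𝓘(ℝ, EuclideanSpace ℝ (Fin m)) (extChartAt (𝓡 m) p)
      (fun _ => v)
    refine ⟨fun x => χ x • Y x, ?_, ?_⟩
    · have hY : ContMDiffOn (𝓡 m) ((𝓡 m).prod 𝓘(ℝ, EuclideanSpace ℝ (Fin m))) ∞
          (fun x => TotalSpace.mk' (EuclideanSpace ℝ (Fin m)) x (Y x))
          (chartAt (EuclideanSpace ℝ (Fin m)) p).source := by
        intro x hx
        refine ContMDiffAt.contMDiffWithinAt ?_
        refine ContMDiffAt.mpullback_vectorField_preimage (n := ∞) ?_ (contMDiffAt_extChartAt' hx)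
          (isInvertible_mfderiv_extChartAt (by rwa [extChartAt_source])) (m := ∞) (by simp)
        refine contMDiffAt_vectorSpace_iff_contDiffAt.2 ?_
        exact contDiffAt_const
      exact ContMDiffOn.smul_section_of_tsupport χ.contMDiff.contMDiffOn
        (chartAt (EuclideanSpace ℝ (Fin m)) p).open_source χ.tsupport_subset_chartAt_source hY
    · rintro y ⟨hy, hyO⟩
      have h1 : χ (chartInv (m := m) p y) = 1 := hO1 _ hyO
      have h2 : (mfderiv (𝓡 m) 𝓘(ℝ, EuclideanSpace ℝ (Fin m)) (extChartAt (𝓡 m) p)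
          (chartInv (m := m) p y)).inverse = chartD p y := by
        have h3 := mfderiv_extChartAt_comp_mfderivWithin_extChartAt_symm (I := 𝓡 m) hy
        have h4 := mfderivWithin_extChartAt_symm_comp_mfderiv_extChartAt (I := 𝓡 m) hy
        rw [ModelWithCorners.range_eq_univ, mfderivWithin_univ] at h3 h4
        exact ContinuousLinearMap.inverse_eq h3 h4
      have h5 : Y (chartInv p y) = chartD p y v :=
        DFunLike.congr_fun (F := EuclideanSpace ℝ (Fin m) →L[ℝ] EuclideanSpace ℝ (Fin m)) h2 v
      rw [chartField, h1, one_smul, h5, chartDInv_chartD hy]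

end ChartRepresentation

/-! ### Derivatives of tensors in a chart -/

section ChartTensors

variable {m : ℕ} {M : Type*} [TopologicalSpace M] [ChartedSpace (EuclideanSpace ℝ (Fin m)) M]
  [IsManifold (𝓡 m) ∞ M] {p : M} {y : EuclideanSpace ℝ (Fin m)}

lemma chartForm_chartField (hy : y ∈ chartDom m p) (α : OneForm m M) (X : VField m M) :
    chartForm p α y (chartField p X y) = α (chartInv p y) (X (chartInv p y)) :=
  congrArg (α (chartInv p y)) (chartD_chartField hy X)

lemma chartMetric_chartField (hy : y ∈ chartDom m p) (g : RMetric m M) (X Y : VField m M) :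
    chartMetric p g y (chartField p X y) (chartField p Y y)
      = g.inner (chartInv p y) (X (chartInv p y)) (Y (chartInv p y)) := by
  rw [chartMetric_apply, chartD_chartField hy, chartD_chartField hy]

lemma chartD_chartEnd (hy : y ∈ chartDom m p) (S : EndField m M) (v : EuclideanSpace ℝ (Fin m)) :
    chartD p y (chartEnd p S y v) = S (chartInv p y) (chartD p y v) :=
  chartD_chartDInv hy _

lemma chartEnd_chartField (hy : y ∈ chartDom m p) (S : EndField m M) (X : VField m M) :
    chartEnd p S y (chartField p X y) = chartField p (S.app X) y :=
  congrArg (fun v => chartDInv p y (S (chartInv p y) v)) (chartD_chartField hy X)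

lemma IsSmoothOneForm.apply {α : OneForm m M} (hα : IsSmoothOneForm α) {X : VField m M}
    (hX : IsSmoothVField X) : ContMDiff (𝓡 m) 𝓘(ℝ, ℝ) ∞ (fun x => α x (X x)) := by
  have h := ContMDiff.clm_bundle_apply (F₂ := ℝ) (E₂ := Bundle.Trivial M ℝ) (b := fun x : M => x)
    hα hX
  exact fun x => (Bundle.contMDiffAt_section _ |>.1 (h x) :)

lemma contMDiff_inner (g : RMetric m M) {X Y : VField m M} (hX : IsSmoothVField X)
    (hY : IsSmoothVField Y) : ContMDiff (𝓡 m) 𝓘(ℝ, ℝ) ∞ (fun x => g.inner x (X x) (Y x)) := by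
  have h := ContMDiff.clm_bundle_apply₂ (F₃ := ℝ) (E₃ := Bundle.Trivial M ℝ) (b := fun x : M => x)
    g.contMDiff hX hY
  exact fun x => (Bundle.contMDiffAt_section _ |>.1 (h x) :)

lemma contDiffAt_comp_chartInv (hy : y ∈ chartDom m p) {u : M → ℝ}
    (hu : ContMDiff (𝓡 m) 𝓘(ℝ, ℝ) ∞ u) : ContDiffAt ℝ ∞ (fun y => u (chartInv p y)) y :=
  ((hu _).comp y (contMDiffAt_chartInv hy)).contDiffAt

lemma mvfderiv_inner (hy : y ∈ chartDom m p) {g : RMetric m M}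
    (hg : DifferentiableAt ℝ (chartMetric p g) y) {X Y : VField m M} (hX : IsSmoothVField X)
    (hY : IsSmoothVField Y) (W : VField m M) :
    mvfderiv (𝓡 m) (fun x => g.inner x (X x) (Y x)) (chartInv p y) (W (chartInv p y))
      = fderiv ℝ (chartMetric p g) y (chartField p W y) (chartField p X y) (chartField p Y y)
        + chartMetric p g y (fderiv ℝ (chartField p X) y (chartField p W y)) (chartField p Y y)
        + chartMetric p g y (chartField p X y)
            (fderiv ℝ (chartField p Y) y (chartField p W y)) := by
  have hX' := ((contDiffAt_chartField hy hX).differentiableAt (by simp)).hasFDerivAt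
  have hY' := ((contDiffAt_chartField hy hY).differentiableAt (by simp)).hasFDerivAt
  have h1 : HasFDerivAt (fun y => chartMetric p g y (chartField p X y) (chartField p Y y)) _ y :=
    (hg.hasFDerivAt.clm_apply hX').clm_apply hY'
  have h2 := h1.congr_of_eventuallyEq (f₁ := fun y => g.inner (chartInv p y) (X (chartInv p y))
    (Y (chartInv p y))) (by
      filter_upwards [(isOpen_chartDom p).mem_nhds hy] with z hz
      rw [chartMetric_chartField hz])
  rw [← chartD_chartField hy W,
    mvfderiv_chartInv hy ((contMDiff_inner g hX hY _).mdifferentiableAt (by simp)), h2.fderiv]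
  simp
  ring

lemma mvfderiv_oneForm (hy : y ∈ chartDom m p) {α : OneForm m M} (hα : IsSmoothOneForm α)
    (hα' : DifferentiableAt ℝ (chartForm p α) y) {X : VField m M} (hX : IsSmoothVField X)
    (W : VField m M) :
    mvfderiv (𝓡 m) (fun x => α x (X x)) (chartInv p y) (W (chartInv p y))
      = fderiv ℝ (chartForm p α) y (chartField p W y) (chartField p X y)
        + chartForm p α y (fderiv ℝ (chartField p X) y (chartField p W y)) := by
  have hX' := ((contDiffAt_chartField hy hX).differentiableAt (by simp)).hasFDerivAt
  have h1 : HasFDerivAt (fun y => chartForm p α y (chartField p X y)) _ y :=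
    hα'.hasFDerivAt.clm_apply hX'
  have h2 := h1.congr_of_eventuallyEq (f₁ := fun y => α (chartInv p y) (X (chartInv p y))) (by
      filter_upwards [(isOpen_chartDom p).mem_nhds hy] with z hz
      rw [chartForm_chartField hz])
  rw [← chartD_chartField hy W,
    mvfderiv_chartInv hy ((hα.apply hX _).mdifferentiableAt (by simp)), h2.fderiv]
  simp
  ring

lemma inner_mlieBracket (hy : y ∈ chartDom m p) (g : RMetric m M) {X Y : VField m M}
    (hX : IsSmoothVField X) (hY : IsSmoothVField Y) (Z : VField m M) :
    g.inner (chartInv p y) (mlieBracket (𝓡 m) X Y (chartInv p y)) (Z (chartInv p y))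
      = chartMetric p g y (fderiv ℝ (chartField p Y) y (chartField p X y))
          (chartField p Z y)
        - chartMetric p g y (fderiv ℝ (chartField p X) y (chartField p Y y))
          (chartField p Z y) := by
  rw [mlieBracket_chartInv hy hX hY, ← chartD_chartField hy Z, ← chartMetric_apply, map_sub,
    sub_apply]

section CoordinateFields

variable {U : Set (EuclideanSpace ℝ (Fin m))} {C : EuclideanSpace ℝ (Fin m) → VField m M}
  (hU : IsOpen U) (hUp : U ⊆ chartDom m p) (hC : ∀ v, IsSmoothVField (C v))
  (hCU : ∀ v, ∀ y ∈ U, chartField p (C v) y = v)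

include hUp hC hCU

/-- In finite dimension, smoothness of an operator-valued map can be tested on fixed vectors, and
these represent the smooth fields `C v` over `U`. -/
lemma contDiffOn_chartForm {α : OneForm m M} (hα : IsSmoothOneForm α) :
    ContDiffOn ℝ ∞ (chartForm p α) U := by
  refine contDiffOn_clm_apply.2 fun v => ContDiffOn.congr (f := fun y => α (chartInv p y)
    (C v (chartInv p y))) ?_ fun z hz => ?_
  · exact fun z hz => (contDiffAt_comp_chartInv (hUp hz) (hα.apply (hC v))).contDiffWithinAt
  · rw [← chartForm_chartField (hUp hz), hCU v z hz]

lemma contDiffOn_chartEnd {S : EndField m M} (hS : IsSmoothEndField S) :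
    ContDiffOn ℝ ∞ (chartEnd p S) U := by
  refine contDiffOn_clm_apply.2 fun v => ContDiffOn.congr (f := chartField p (S.app (C v))) ?_
    fun z hz => ?_
  · exact fun z hz => (contDiffAt_chartField (hUp hz) (hS.app (hC v))).contDiffWithinAt
  · rw [← chartEnd_chartField (hUp hz), hCU v z hz]

lemma contDiffOn_chartMetric (g : RMetric m M) : ContDiffOn ℝ ∞ (chartMetric p g) U := by
  refine contDiffOn_clm_apply.2 fun v => contDiffOn_clm_apply.2 fun w =>
    ContDiffOn.congr (f := fun y => g.inner (chartInv p y) (C v (chartInv p y))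
      (C w (chartInv p y))) ?_ fun z hz => ?_
  · exact fun z hz =>
      (contDiffAt_comp_chartInv (hUp hz) (contMDiff_inner g (hC v) (hC w))).contDiffWithinAt
  · rw [← chartMetric_chartField (hUp hz), hCU v z hz, hCU w z hz]

omit hUp hC [IsManifold (𝓡 m) ∞ M] in
include hU in
lemma fderiv_chartField_coordinate (hy : y ∈ U) (v : EuclideanSpace ℝ (Fin m)) :
    fderiv ℝ (chartField p (C v)) y = 0 := by
  have h : chartField p (C v) =ᶠ[𝓝 y] fun _ => v := by
    filter_upwards [hU.mem_nhds hy] with z hz using hCU v z hz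
  rw [h.fderiv_eq, fderiv_fun_const]
  rfl

-- The image of a coordinate field under a tensor is no longer constant in the chart; through its
-- derivative the partial derivatives of the tensor enter the Lie bracket and Koszul identities.
include hU in
lemma fderiv_chartField_app (hy : y ∈ U) {S : EndField m M} (hS : IsSmoothEndField S)
    (v w : EuclideanSpace ℝ (Fin m)) :
    fderiv ℝ (chartField p (S.app (C v))) y w = fderiv ℝ (chartEnd p S) y w v := by
  have h : chartField p (S.app (C v)) =ᶠ[𝓝 y] fun z => chartEnd p S z v := by
    filter_upwards [hU.mem_nhds hy] with z hz
    rw [← chartEnd_chartField (hUp hz), hCU v z hz]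
  have h1 := ((contDiffOn_chartEnd hUp hC hCU hS).contDiffAt (hU.mem_nhds hy)).differentiableAt
    (by simp)
  rw [h.fderiv_eq, (h1.hasFDerivAt.clm_apply (hasFDerivAt_const v y)).fderiv]
  simp

end CoordinateFields

end ChartTensors

/-! ### The structure equations in a chart -/

namespace WeakMetricFStructure

variable {n s : ℕ} {M : Type*} [TopologicalSpace M]
  [ChartedSpace (EuclideanSpace ℝ (Fin (2 * n + s))) M] [IsManifold (𝓡 (2 * n + s)) ∞ M]
  {S : WeakMetricFStructure n s M} {β : M → ℝ}

set_option maxHeartbeats 2000000 in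
/-- A weak `β`-Kenmotsu `f`-structure in a chart. -/
lemma IsWeakKenmotsu.isLocalKenmotsu (hS : S.IsWeakKenmotsu β) {p : M}
    {U : Set (EuclideanSpace ℝ (Fin (2 * n + s)))} (hU : IsOpen U)
    (hUp : U ⊆ chartDom (2 * n + s) p)
    {C : EuclideanSpace ℝ (Fin (2 * n + s)) → VField (2 * n + s) M}
    (hC : ∀ v, IsSmoothVField (C v)) (hCU : ∀ v, ∀ y ∈ U, chartField p (C v) y = v) :
    IsLocalKenmotsu U (fun i => chartField p (S.ξ i)) (fun i => chartForm p (S.η i))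
      (chartEnd p S.f) (chartMetric p S.g) (fun y => β (chartInv p y)) := by
  obtain ⟨nabla, hLC, hf⟩ := hS.nabla_f
  have hN := hS.normal
  have hinj : ∀ {y}, y ∈ U → ∀ {v w}, chartD (M := M) p y v = chartD p y w → v = w :=
    fun {y} hy {v w} h => by
      rw [← chartDInv_chartD (hUp hy) v, h, chartDInv_chartD (hUp hy)]
  have hg : ∀ {y}, y ∈ U → DifferentiableAt ℝ (chartMetric p S.g) y := fun {y} hy =>
    ((contDiffOn_chartMetric hUp hC hCU S.g).contDiffAt (hU.mem_nhds hy)).differentiableAt (by simp)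
  have hDC : ∀ {y}, y ∈ U → ∀ v, chartD p y v = C v (chartInv p y) := fun {y} hy v => by
    rw [← chartD_chartField (hUp hy) (C v), hCU v y hy]
  have hfield : ∀ {y}, y ∈ U → ∀ v, fderiv ℝ (chartField p (C v)) y = 0 := fun {y} hy v =>
    fderiv_chartField_coordinate hU hCU hy v
  have hη : ∀ {y}, y ∈ U → ∀ i v, chartForm p (S.η i) y v
      = S.η i (chartInv p y) (C v (chartInv p y)) := fun {y} hy i v => by
    rw [← hDC hy]; rfl
  have hfC : ∀ {y}, y ∈ U → ∀ v, chartField p (S.f.app (C v)) y = chartEnd p S.f y v :=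
    fun {y} hy v => by rw [← chartEnd_chartField (hUp hy), hCU v y hy]
  refine
    { isOpen := hU
      smooth_ξ := fun i y hy => (contDiffAt_chartField (hUp hy) (S.smooth_ξ i)).contDiffWithinAt
      smooth_η := fun i => contDiffOn_chartForm hUp hC hCU (S.smooth_η i)
      smooth_f := contDiffOn_chartEnd hUp hC hCU S.smooth_f
      smooth_g := contDiffOn_chartMetric hUp hC hCU S.g
      smooth_β := fun y hy => (contDiffAt_comp_chartInv (hUp hy) hS.smooth_β).contDiffWithinAt
      η_ξ := ?_, η_f := ?_, g_ξ := ?_, g_symm := ?_, g_pos := ?_, f_skew := ?_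
      f_inj := ?_, comm := ?_, closed := ?_, lie_g := ?_, lie_f := ?_, parallel := ?_ }
  · intro y hy i j
    rw [chartForm_chartField (hUp hy), S.η_ξ]
  · intro y hy i v
    exact (congrArg (S.η i _) (chartD_chartEnd (hUp hy) S.f v)).trans (S.η_f _ i _)
  · intro y hy i v
    rw [chartMetric_apply, chartD_chartField (hUp hy), S.g_ξ]
    rfl
  · intro y hy v w
    exact S.g.symm _ _ _
  · intro y hy v hv
    exact S.g.pos _ _ fun h => hv (hinj hy (h.trans (map_zero (chartD p y)).symm))
  · intro y hy v w
    rw [chartMetric_apply, chartMetric_apply, chartD_chartEnd (hUp hy), chartD_chartEnd (hUp hy),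
      S.f_skew]
  · intro y hy v hv hfv
    refine hinj hy ((S.eq_zero_of_f_eq_zero _ (chartD p y v) hv ?_).trans
      (map_zero (chartD p y)).symm)
    exact (chartD_chartEnd (hUp hy) S.f v).symm.trans
      ((congrArg (chartD p y) hfv).trans (map_zero _))
  · intro i j y hy
    have h := mlieBracket_chartInv (hUp hy) (S.smooth_ξ j) (S.smooth_ξ i)
    rw [mlieBracket_ξ_ξ hN, ← map_zero (chartD p y)] at h
    exact (sub_eq_zero.1 (hinj hy h).symm)
  · intro i y hy v w
    have h := extDeriv_eq_zero hN hLC hf (hC v) (hC w) i (chartInv p y)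
    have hd := ((contDiffOn_chartForm hUp hC hCU (S.smooth_η i)).contDiffAt
      (hU.mem_nhds hy)).differentiableAt (by simp)
    rw [extDerivOneForm, mvfderiv_oneForm (hUp hy) (S.smooth_η i) hd (hC w),
      mvfderiv_oneForm (hUp hy) (S.smooth_η i) hd (hC v),
      mlieBracket_chartInv (hUp hy) (hC v) (hC w)] at h
    simp only [hfield hy, hCU _ y hy, zero_apply, sub_self, map_zero] at h
    linarith
  · intro i y hy v w hv hw
    simp only [hη hy] at hv hw
    have h := lie_ξ_g hN hLC hf (hC v) (hC w) i _ hv hw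
    rw [mvfderiv_inner (hUp hy) (hg hy) (hC v) (hC w),
      inner_mlieBracket (hUp hy) S.g (S.smooth_ξ i) (hC v), S.g.symm _ (C v _),
      inner_mlieBracket (hUp hy) S.g (S.smooth_ξ i) (hC w), ← hDC hy, ← hDC hy,
      ← chartMetric_apply] at h
    simp only [hfield hy, hCU _ y hy, zero_apply, map_zero] at h
    have h2 : chartMetric p S.g y (fderiv ℝ (chartField p (S.ξ i)) y w) v
      = chartMetric p S.g y v (fderiv ℝ (chartField p (S.ξ i)) y w) := S.g.symm _ _ _
    linarith
  · intro i y hy v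
    have h := lie_ξ_f hN hLC hf (hC v) i (chartInv p y)
    rw [mlieBracket_chartInv (hUp hy) (S.smooth_ξ i) (S.smooth_f.app (hC v)),
      mlieBracket_chartInv (hUp hy) (S.smooth_ξ i) (hC v), ← chartD_chartEnd (hUp hy)] at h
    have h2 := hinj hy h
    rw [fderiv_chartField_app hU hUp hC hCU hy S.smooth_f, hfC hy, hfield hy, hCU v y hy,
      zero_apply, zero_sub, map_neg] at h2
    rw [← sub_eq_zero] at h2 ⊢
    rw [← h2]
    abel
  -- Both terms of `koszul_f` are expanded by the Koszul formula, on the triples `(v, f y, z)` and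
  -- `(v, y, f z)`. The coordinate fields themselves have zero derivative; the derivatives of their
  -- `f`-images either cancel or produce the term `g((∂_v f) y, z)`.
  · intro x hx v y z hy hz
    simp only [hη hx] at hy hz
    have h := koszul_f hf (hC v) (hC y) _ hy hz
    have h1 := hLC.koszul (hC v) (S.smooth_f.app (hC y)) (hC z) (chartInv p x)
    have h2 := hLC.koszul (hC v) (hC y) (S.smooth_f.app (hC z)) (chartInv p x)
    rw [mvfderiv_inner (hUp hx) (hg hx) (S.smooth_f.app (hC y)) (hC z),
      mvfderiv_inner (hUp hx) (hg hx) (hC v) (hC z),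
      mvfderiv_inner (hUp hx) (hg hx) (hC v) (S.smooth_f.app (hC y)),
      inner_mlieBracket (hUp hx) S.g (hC v) (S.smooth_f.app (hC y)),
      inner_mlieBracket (hUp hx) S.g (hC v) (hC z),
      inner_mlieBracket (hUp hx) S.g (S.smooth_f.app (hC y)) (hC z)] at h1
    rw [mvfderiv_inner (hUp hx) (hg hx) (hC y) (S.smooth_f.app (hC z)),
      mvfderiv_inner (hUp hx) (hg hx) (hC v) (S.smooth_f.app (hC z)),
      mvfderiv_inner (hUp hx) (hg hx) (hC v) (hC y),
      inner_mlieBracket (hUp hx) S.g (hC v) (hC y),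
      inner_mlieBracket (hUp hx) S.g (hC v) (S.smooth_f.app (hC z)),
      inner_mlieBracket (hUp hx) S.g (hC y) (S.smooth_f.app (hC z))] at h2
    simp only [fderiv_chartField_app hU hUp hC hCU hx S.smooth_f, hfC hx, hfield hx, hCU _ x hx,
      zero_apply, map_zero] at h1 h2
    have hs : ∀ a b, chartMetric p S.g x a b = chartMetric p S.g x b a := fun a b => S.g.symm _ _ _
    rw [hs v] at h1 h2
    rw [hs y] at h2
    rw [koszulDeriv]
    linarith

end WeakMetricFStructure

/-! ### Metrics, Levi-Civita connections and weak Kählerian structures on a Euclidean space -/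

section VectorSpaceMetric

set_option maxSynthPendingDepth 3

variable {k : ℕ}

/-- The constant is the minimum of the form on the compact unit sphere. It yields boundedness of the
unit ball of each inner product, a field of the metric structure. -/
lemma exists_pos_mul_sq_norm_le {F : Type*} [NormedAddCommGroup F] [NormedSpace ℝ F]
    [FiniteDimensional ℝ F] (B : F →L[ℝ] F →L[ℝ] ℝ) (hB : ∀ v, v ≠ 0 → 0 < B v v) :
    ∃ c > 0, ∀ v, c * ‖v‖ ^ 2 ≤ B v v := by
  cases subsingleton_or_nontrivial F
  · exact ⟨1, one_pos, fun v => by rw [Subsingleton.elim v 0]; simp⟩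
  obtain ⟨u, hu, hmin⟩ := (isCompact_sphere (0 : F) 1).exists_isMinOn
    (NormedSpace.sphere_nonempty.2 zero_le_one) (f := fun v => B v v) (by fun_prop)
  have hu0 : u ≠ 0 := by
    rintro rfl
    simp at hu
  refine ⟨B u u, hB u hu0, fun v => ?_⟩
  rcases eq_or_ne v 0 with rfl | hv
  · simp
  · have hv' := norm_ne_zero_iff.2 hv
    have h1 : B u u ≤ B (‖v‖⁻¹ • v) (‖v‖⁻¹ • v) := hmin (by
      rw [mem_sphere_zero_iff_norm, norm_smul, norm_inv, norm_norm, inv_mul_cancel₀ hv'])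
    simp only [map_smul, smul_apply, smul_eq_mul] at h1
    have h2 : 0 < ‖v‖ := norm_pos_iff.2 hv
    calc B u u * ‖v‖ ^ 2 ≤ ‖v‖⁻¹ * (‖v‖⁻¹ * B v v) * ‖v‖ ^ 2 := by gcongr
      _ = B v v := by field_simp

lemma isVonNBounded_setOf_lt {F : Type*} [NormedAddCommGroup F] [NormedSpace ℝ F]
    [FiniteDimensional ℝ F] (B : F →L[ℝ] F →L[ℝ] ℝ) (hB : ∀ v, v ≠ 0 → 0 < B v v) :
    Bornology.IsVonNBounded ℝ {v | B v v < 1} := by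
  obtain ⟨c, hc, h⟩ := exists_pos_mul_sq_norm_le B hB
  refine (NormedSpace.isVonNBounded_ball ℝ F (√(1 / c))).subset fun v hv => ?_
  rw [mem_ball_zero_iff]
  refine Real.lt_sqrt_of_sq_lt ?_
  rw [lt_div_iff₀ hc, mul_comm]
  exact (h v).trans_lt hv

/-- A smooth family of inner products on a Euclidean space, as a Riemannian metric. -/
noncomputable def vectorSpaceMetric
    (h : EuclideanSpace ℝ (Fin k) → EuclideanSpace ℝ (Fin k) →L[ℝ] EuclideanSpace ℝ (Fin k) →L[ℝ] ℝ)
    (hh : ContDiff ℝ ∞ h) (hsymm : ∀ x v w, h x v w = h x w v)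
    (hpos : ∀ x v, v ≠ 0 → 0 < h x v v) : RMetric k (EuclideanSpace ℝ (Fin k)) where
  inner x := (h x : EuclideanSpace ℝ (Fin k) →L[ℝ] EuclideanSpace ℝ (Fin k) →L[ℝ] ℝ)
  symm := hsymm
  pos := hpos
  isVonNBounded x := isVonNBounded_setOf_lt (h x) (hpos x)
  contMDiff := by
    intro x
    refine (contMDiffAt_section (E := fun x : EuclideanSpace ℝ (Fin k) =>
      TangentSpace (𝓡 k) x →L[ℝ] TangentSpace (𝓡 k) x →L[ℝ] ℝ) (s := h) x).2 ?_
    refine (hh.contMDiff.contMDiffAt (x := x)).congr_of_eventuallyEq (.of_forall fun y => ?_)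
    refine ContinuousLinearMap.ext fun v => ContinuousLinearMap.ext fun w => ?_
    -- The trivialisation of the tangent bundle of a vector space is the identity on fibres, so the
    -- coordinate expression of the metric is `h` itself.
    have hs : ∀ u : EuclideanSpace ℝ (Fin k),
        (trivializationAt (EuclideanSpace ℝ (Fin k)) (TangentSpace (𝓡 k)) x).symm y u = u :=
      fun u => (Trivialization.symmL_apply (R := ℝ) _ (mem_univ y) u).symm.trans
        (congrArg (fun A : EuclideanSpace ℝ (Fin k) →L[ℝ] EuclideanSpace ℝ (Fin k) => A u)
          (TangentBundle.symmL_model_space (𝕜 := ℝ) x y))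
    refine (inCoordinates_apply_eq₂ (B := EuclideanSpace ℝ (Fin k)) (x₀ := x) (x := y)
      (F₁ := EuclideanSpace ℝ (Fin k)) (F₂ := EuclideanSpace ℝ (Fin k))
      (E₁ := TangentSpace (𝓡 k)) (E₂ := TangentSpace (𝓡 k))
      (E₃ := Bundle.Trivial (EuclideanSpace ℝ (Fin k)) ℝ) (F₃ := ℝ)
      (ϕ := (h y : TangentSpace (𝓡 k) y →L[ℝ] TangentSpace (𝓡 k) y →L[ℝ] ℝ))
      (mem_univ _) (mem_univ _) (mem_univ _)).trans ?_
    rw [hs, hs]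
    simp
    rfl

lemma isSmoothEndField_vectorSpace
    {J : EuclideanSpace ℝ (Fin k) → EuclideanSpace ℝ (Fin k) →L[ℝ] EuclideanSpace ℝ (Fin k)}
    (hJ : ContDiff ℝ ∞ J) :
    IsSmoothEndField (M := EuclideanSpace ℝ (Fin k)) (m := k) J := by
  intro x
  refine (contMDiffAt_section (E := fun x : EuclideanSpace ℝ (Fin k) =>
    TangentSpace (𝓡 k) x →L[ℝ] TangentSpace (𝓡 k) x) (s := J) x).2 ?_
  refine (hJ.contMDiff.contMDiffAt (x := x)).congr_of_eventuallyEq (.of_forall fun y => ?_)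
  exact inCoordinates_tangent_bundle_core_model_space (I := 𝓡 k) (I' := 𝓡 k) x y x y (J y)

lemma differentiableAt_vectorSpace {Y : VField k (EuclideanSpace ℝ (Fin k))}
    {x : EuclideanSpace ℝ (Fin k)}
    (hY : MDifferentiableAt (𝓡 k) ((𝓡 k).prod 𝓘(ℝ, EuclideanSpace ℝ (Fin k)))
      (fun x => TotalSpace.mk' (EuclideanSpace ℝ (Fin k)) x (Y x)) x) :
    DifferentiableAt ℝ (F := EuclideanSpace ℝ (Fin k)) Y x :=
  ((((contMDiff_snd_tangentBundle_modelSpace (EuclideanSpace ℝ (Fin k)) (𝓡 k)).contMDiffAt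
    (n := 1)).mdifferentiableAt (by simp)).comp x hY).differentiableAt

/-- The flat connection of a Euclidean space. -/
lemma isCovariantDerivativeOn_fderiv :
    IsCovariantDerivativeOn (I := 𝓡 k) (EuclideanSpace ℝ (Fin k))
      (fun (Y : VField k (EuclideanSpace ℝ (Fin k))) x =>
        (fderiv ℝ (F := EuclideanSpace ℝ (Fin k)) Y x :
          EuclideanSpace ℝ (Fin k) →L[ℝ] EuclideanSpace ℝ (Fin k))) univ where
  add hσ hσ' _ := fderiv_add (differentiableAt_vectorSpace hσ) (differentiableAt_vectorSpace hσ')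
  leibniz hσ hg _ := by
    refine (fderiv_smul hg.differentiableAt (differentiableAt_vectorSpace hσ)).trans ?_
    rw [mvfderiv, mfderiv_eq_fderiv]
    rfl

/-- The Christoffel symbols of the first kind. -/
noncomputable def christoffel {F : Type*} [NormedAddCommGroup F] [NormedSpace ℝ F]
    (D : F →L[ℝ] F →L[ℝ] F →L[ℝ] ℝ) : F →L[ℝ] F →L[ℝ] F →L[ℝ] ℝ :=
  let D' : F →L[ℝ] F →L[ℝ] F →L[ℝ] ℝ := D.flip
  let D'' : F →L[ℝ] F →L[ℝ] F →L[ℝ] ℝ :=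
    (ContinuousLinearMap.flipₗᵢ ℝ F F ℝ).toContinuousLinearEquiv.toContinuousLinearMap.comp D'
  (1 / 2 : ℝ) • (D + D' - D'')

lemma christoffel_apply {F : Type*} [NormedAddCommGroup F] [NormedSpace ℝ F]
    (D : F →L[ℝ] F →L[ℝ] F →L[ℝ] ℝ) (u v w : F) :
    christoffel D u v w = (D u v w + D v u w - D w u v) / 2 := by
  change (1 / 2 : ℝ) * (D u v w + D v u w - D w u v) = _
  ring

section LeviCivita

variable
  (h : EuclideanSpace ℝ (Fin k) → EuclideanSpace ℝ (Fin k) →L[ℝ] EuclideanSpace ℝ (Fin k) →L[ℝ] ℝ)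

/-- The Christoffel symbols of the second kind. -/
noncomputable def christoffelMap (x : EuclideanSpace ℝ (Fin k)) :
    EuclideanSpace ℝ (Fin k) →L[ℝ] EuclideanSpace ℝ (Fin k) →L[ℝ] EuclideanSpace ℝ (Fin k) :=
  ContinuousLinearMap.compL ℝ _ _ _ (h x).inverse ∘L christoffel (fderiv ℝ h x)

/-- The Levi-Civita connection of a metric on a Euclidean space. -/
noncomputable def vectorSpaceLeviCivita : LinearConnection k (EuclideanSpace ℝ (Fin k)) where
  toFun Y x := (fderiv ℝ (F := EuclideanSpace ℝ (Fin k)) Y x + christoffelMap h x (Y x) :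
    EuclideanSpace ℝ (Fin k) →L[ℝ] EuclideanSpace ℝ (Fin k))
  isCovariantDerivativeOnUniv := isCovariantDerivativeOn_fderiv.add_one_form (christoffelMap h)

variable {h} (hh : ContDiff ℝ ∞ h) (hsymm : ∀ x v w, h x v w = h x w v)
    (hpos : ∀ x v, v ≠ 0 → 0 < h x v v)

-- Positivity makes `h x` injective into the dual, hence invertible by dimension, so `inverse` in
-- `christoffelMap` is a genuine inverse that raises the index.
include hpos in
lemma apply_christoffelMap (x u v w : EuclideanSpace ℝ (Fin k)) :
    h x (christoffelMap h x u v) w = christoffel (fderiv ℝ h x) u v w := by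
  have hinj : Function.Injective (h x) := (injective_iff_map_eq_zero _).2 fun v hv => by
    by_contra hv0
    simpa [hv] using hpos x v hv0
  have hinv : (h x).IsInvertible :=
    ⟨(LinearEquiv.ofInjectiveOfFinrankEq (h x).toLinearMap hinj
      (by rw [LinearMap.toContinuousLinearMap.symm.finrank_eq, Subspace.dual_finrank_eq])
      ).toContinuousLinearEquiv, by ext; rfl⟩
  obtain ⟨A, hA⟩ := hinv
  simp only [christoffelMap, ContinuousLinearMap.comp_apply, ContinuousLinearMap.compL_apply]
  rw [← hA, ContinuousLinearMap.inverse_equiv]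
  exact congrArg (fun l : EuclideanSpace ℝ (Fin k) →L[ℝ] ℝ => l w) (A.apply_symm_apply _)

lemma fderiv_apply_apply {Y Z : EuclideanSpace ℝ (Fin k) → EuclideanSpace ℝ (Fin k)}
    {x : EuclideanSpace ℝ (Fin k)} (hh : DifferentiableAt ℝ h x) (hY : DifferentiableAt ℝ Y x)
    (hZ : DifferentiableAt ℝ Z x) (v : EuclideanSpace ℝ (Fin k)) :
    fderiv ℝ (fun y => h y (Y y) (Z y)) x v
      = fderiv ℝ h x v (Y x) (Z x) + h x (fderiv ℝ Y x v) (Z x) + h x (Y x) (fderiv ℝ Z x v) := by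
  have h1 := (hh.hasFDerivAt.clm_apply hY.hasFDerivAt).clm_apply hZ.hasFDerivAt
  rw [h1.fderiv]
  simp only [add_apply, ContinuousLinearMap.comp_apply, ContinuousLinearMap.flip_apply]
  ring

include hh hsymm in
lemma fderiv_symm_apply (x u v w : EuclideanSpace ℝ (Fin k)) :
    fderiv ℝ h x u v w = fderiv ℝ h x u w v := by
  have h1 := (hh.differentiable (by simp)) x
  have h2 := fderiv_apply_apply h1 (differentiableAt_const v) (differentiableAt_const w) u
  have h3 := fderiv_apply_apply h1 (differentiableAt_const w) (differentiableAt_const v) u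
  simp only [fderiv_fun_const, Pi.zero_apply, zero_apply, map_zero, add_zero, hsymm _ w v] at h2 h3
  exact h2.symm.trans h3

include hpos in
lemma eq_of_forall_apply_eq {x u v : EuclideanSpace ℝ (Fin k)} (huv : ∀ w, h x u w = h x v w) :
    u = v := by
  by_contra hne
  have h0 : h x (u - v) = 0 := by
    ext w
    rw [map_sub, sub_apply, huv, sub_self, zero_apply]
  simpa [h0] using hpos x _ (sub_ne_zero.2 hne)

include hh hsymm hpos in
lemma christoffelMap_comm (x u v : EuclideanSpace ℝ (Fin k)) :
    christoffelMap h x u v = christoffelMap h x v u := by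
  refine eq_of_forall_apply_eq hpos (x := x) fun w => ?_
  rw [apply_christoffelMap hpos, apply_christoffelMap hpos, christoffel_apply,
    christoffel_apply, fderiv_symm_apply hh hsymm x w]
  ring

-- Infinitesimal form of metricity: in the sum of the two Christoffel symbols the terms with
-- derivatives along `u` and `w` cancel.
include hh hsymm hpos in
lemma apply_christoffelMap_add (x u v w : EuclideanSpace ℝ (Fin k)) :
    h x (christoffelMap h x u v) w + h x u (christoffelMap h x w v) = fderiv ℝ h x v u w := by
  rw [hsymm x u, apply_christoffelMap hpos, apply_christoffelMap hpos,
    christoffel_apply, christoffel_apply, fderiv_symm_apply hh hsymm x v w u,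
    fderiv_symm_apply hh hsymm x w u v, fderiv_symm_apply hh hsymm x u w v]
  ring

-- Paired with `w`, and with `J` moved across by skewness, the left side is exactly `koszulDeriv h J
-- x u v w`; nondegeneracy concludes.
include hh hsymm hpos in
lemma christoffelMap_parallel
    {J : EuclideanSpace ℝ (Fin k) → EuclideanSpace ℝ (Fin k) →L[ℝ] EuclideanSpace ℝ (Fin k)}
    (hskew : ∀ x v w, h x (J x v) w = - h x v (J x w))
    (hpar : ∀ x v y z, koszulDeriv h J x v y z = 0) (x u v : EuclideanSpace ℝ (Fin k)) :
    fderiv ℝ J x u v + christoffelMap h x (J x v) u - J x (christoffelMap h x v u) = 0 := by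
  refine eq_of_forall_apply_eq hpos (x := x) fun w => ?_
  rw [map_sub, map_add, sub_apply, add_apply, hskew, apply_christoffelMap hpos,
    apply_christoffelMap hpos, christoffel_apply, christoffel_apply, map_zero, zero_apply]
  have h4 := hpar x u v w
  rw [koszulDeriv] at h4
  rw [fderiv_symm_apply hh hsymm x w, fderiv_symm_apply hh hsymm x (J x w)]
  linarith

/-- The flat derivative contributes the Lie bracket and the product rule; what remains is the
symmetry `christoffelMap_comm` and the metricity `apply_christoffelMap_add`. -/
lemma isLeviCivita_vectorSpaceLeviCivita :
    IsLeviCivita (vectorSpaceMetric h hh hsymm hpos) (vectorSpaceLeviCivita h) where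
  torsion_free := by
    refine (vectorSpaceLeviCivita h).torsion_eq_zero_iff.2 fun {X Y x} hX hY => ?_
    refine Eq.trans ?_ (mlieBracket_vectorSpace X Y x).symm
    refine (congrArg (fun a => _ + a - _) (christoffelMap_comm hh hsymm hpos x (Y x) (X x))).trans ?_
    exact add_sub_add_right_eq_sub (G := EuclideanSpace ℝ (Fin k)) _ _ _
  metric Y Z hY hZ x v := by
    have h2 := fderiv_apply_apply ((hh.differentiable (by simp)) x)
      (differentiableAt_vectorSpace (hY.mdifferentiableAt x))
      (differentiableAt_vectorSpace (hZ.mdifferentiableAt x)) v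
    have h3 : ∀ a b c d e : EuclideanSpace ℝ (Fin k),
        h x (a + christoffelMap h x b c) d + h x b (e + christoffelMap h x d c)
          = fderiv ℝ h x c b d + h x a d + h x b e := by
      intro a b c d e
      rw [map_add, map_add, add_apply, ← apply_christoffelMap_add hh hsymm hpos]
      ring
    rw [mvfderiv, mfderiv_eq_fderiv]
    exact h2.trans (h3 _ _ _ _ _).symm

/-- A metric and a skew-symmetric nondegenerate endomorphism field that is parallel according to
the Koszul formula form a weak Kählerian structure. -/
lemma isWeakKahlerian_vectorSpace
    {J : EuclideanSpace ℝ (Fin k) → EuclideanSpace ℝ (Fin k) →L[ℝ] EuclideanSpace ℝ (Fin k)}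
    (hJ : ContDiff ℝ ∞ J) (hskew : ∀ x v w, h x (J x v) w = - h x v (J x w))
    (hJ0 : ∀ x v, J x v = 0 → v = 0) (hpar : ∀ x v y z, koszulDeriv h J x v y z = 0) :
    IsWeakKahlerian (M := EuclideanSpace ℝ (Fin k)) (vectorSpaceMetric h hh hsymm hpos) J where
  smooth := isSmoothEndField_vectorSpace hJ
  skew := hskew
  sq_neg x v hv := by
    refine (hskew x (J x v) v).trans_lt (neg_lt_zero.2 (hpos x _ fun h0 => hv (hJ0 x v h0)))
  parallel := by
    refine ⟨vectorSpaceLeviCivita h, isLeviCivita_vectorSpaceLeviCivita hh hsymm hpos,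
      fun X Y hX hY x => ?_⟩
    have hY' := (differentiableAt_vectorSpace (hY.mdifferentiableAt x)).hasFDerivAt
    have h1 := (((hJ.differentiable (by simp)) x).hasFDerivAt.clm_apply hY').fderiv
    have h3 : ∀ u : EuclideanSpace ℝ (Fin k), fderiv ℝ (F := EuclideanSpace ℝ (Fin k))
        (EndField.app (M := EuclideanSpace ℝ (Fin k)) J Y) x u
        = J x (fderiv ℝ (F := EuclideanSpace ℝ (Fin k)) Y x u) + fderiv ℝ J x u (Y x) := fun u =>
      (congrArg (fun l : EuclideanSpace ℝ (Fin k) →L[ℝ] EuclideanSpace ℝ (Fin k) => l u) h1).trans rfl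
    have h4 : ∀ u y d : EuclideanSpace ℝ (Fin k),
        J x d + fderiv ℝ J x u y + christoffelMap h x (J x y) u
          - J x (d + christoffelMap h x y u) = 0 := fun u y d => by
      rw [← christoffelMap_parallel hh hsymm hpos hskew hpar x u y, map_add]
      abel
    exact (congrArg (fun a : EuclideanSpace ℝ (Fin k) => a + _ - _) (h3 (X x))).trans
      (h4 (X x) (Y x) _)

end LeviCivita

end VectorSpaceMetric

/-! ### Calculus on the product of two Euclidean spaces -/

section ProductModel

variable {s k : ℕ} {G : Type*} [NormedAddCommGroup G] [NormedSpace ℝ G]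

/-- The product of the two standard models coincides with the standard model of the product space,
so manifold derivatives over the product are ordinary ones. -/
lemma hasMFDerivAt_prodModel
    {Θ : EuclideanSpace ℝ (Fin s) × EuclideanSpace ℝ (Fin k) → G}
    {Θ' : EuclideanSpace ℝ (Fin s) × EuclideanSpace ℝ (Fin k) →L[ℝ] G}
    {q : EuclideanSpace ℝ (Fin s) × EuclideanSpace ℝ (Fin k)} (h : HasFDerivAt Θ Θ' q) :
    HasMFDerivAt ((𝓡 s).prod (𝓡 k)) 𝓘(ℝ, G) Θ q Θ' := by
  have h1 := h.hasMFDerivAt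
  rw [modelWithCornersSelf_prod, ← chartedSpaceSelf_prod] at h1
  exact h1

lemma contMDiffOn_prodModel
    {Θ : EuclideanSpace ℝ (Fin s) × EuclideanSpace ℝ (Fin k) → G}
    {A : Set (EuclideanSpace ℝ (Fin s) × EuclideanSpace ℝ (Fin k))} (h : ContDiffOn ℝ ∞ Θ A) :
    ContMDiffOn ((𝓡 s).prod (𝓡 k)) 𝓘(ℝ, G) ∞ Θ A := by
  have h1 := h.contMDiffOn
  rw [modelWithCornersSelf_prod, ← chartedSpaceSelf_prod] at h1
  exact h1

lemma contMDiffOn_prodModel_right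
    {Θ : G → EuclideanSpace ℝ (Fin s) × EuclideanSpace ℝ (Fin k)}
    {A : Set G} (h : ContDiffOn ℝ ∞ Θ A) :
    ContMDiffOn 𝓘(ℝ, G) ((𝓡 s).prod (𝓡 k)) ∞ Θ A := by
  have h1 := h.contMDiffOn
  rw [modelWithCornersSelf_prod, ← chartedSpaceSelf_prod] at h1
  exact h1

lemma twistedInner_vectorSpace (h : RMetric k (EuclideanSpace ℝ (Fin k)))
    (σ : EuclideanSpace ℝ (Fin s) × EuclideanSpace ℝ (Fin k) → ℝ)
    (q v w : EuclideanSpace ℝ (Fin s) × EuclideanSpace ℝ (Fin k)) :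
    twistedInner h σ q v w = inner ℝ v.1 w.1 + σ q ^ 2 * h.inner q.2 v.2 w.2 := by
  have h1 := (hasMFDerivAt_fst (I := 𝓡 s) (I' := 𝓡 k) q).mfderiv
  have h2 := (hasMFDerivAt_snd (I := 𝓡 s) (I' := 𝓡 k) q).mfderiv
  have e1 : ∀ u : EuclideanSpace ℝ (Fin s) × EuclideanSpace ℝ (Fin k),
      mvfderiv ((𝓡 s).prod (𝓡 k))
        (fun z : EuclideanSpace ℝ (Fin s) × EuclideanSpace ℝ (Fin k) => z.1) q u = u.1 :=
    fun u => congrArg (fun l : EuclideanSpace ℝ (Fin s) × EuclideanSpace ℝ (Fin k) →L[ℝ]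
      EuclideanSpace ℝ (Fin s) => l u) h1
  have e2 : ∀ u : EuclideanSpace ℝ (Fin s) × EuclideanSpace ℝ (Fin k),
      mfderiv ((𝓡 s).prod (𝓡 k)) (𝓡 k)
        (fun z : EuclideanSpace ℝ (Fin s) × EuclideanSpace ℝ (Fin k) => z.2) q u = u.2 :=
    fun u => congrArg (fun l : EuclideanSpace ℝ (Fin s) × EuclideanSpace ℝ (Fin k) →L[ℝ]
      EuclideanSpace ℝ (Fin k) => l u) h2
  exact congrArg₂ (· + ·) (congrArg₂ (inner ℝ) (e1 v) (e1 w)) (congrArg (σ q ^ 2 * ·)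
    (congrArg₂ (fun a b : EuclideanSpace ℝ (Fin k) => h.inner q.2 a b) (e2 v) (e2 w)))

end ProductModel

/-! ### From adapted coordinates in a chart to a parametrisation of the manifold -/

section ChartComposition

variable {m s k : ℕ} {M : Type*} [TopologicalSpace M] [ChartedSpace (EuclideanSpace ℝ (Fin m)) M]

/-- A local diffeomorphism into the model space followed by the inverse of a chart, on a cylinder
over a ball. -/
noncomputable def cylinderChart (p : M) (Θ : OpenPartialHomeomorph
    (EuclideanSpace ℝ (Fin s) × EuclideanSpace ℝ (Fin k)) (EuclideanSpace ℝ (Fin m))) (r : ℝ) :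
    OpenPartialHomeomorph (EuclideanSpace ℝ (Fin s) × EuclideanSpace ℝ (Fin k)) M :=
  (Θ.restrOpen (Metric.ball 0 r ×ˢ univ) (Metric.isOpen_ball.prod isOpen_univ)).trans
    (chartAt (EuclideanSpace ℝ (Fin m)) p).symm

variable {p : M} {Θ : OpenPartialHomeomorph
    (EuclideanSpace ℝ (Fin s) × EuclideanSpace ℝ (Fin k)) (EuclideanSpace ℝ (Fin m))} {r : ℝ}

lemma cylinderChart_apply (q : EuclideanSpace ℝ (Fin s) × EuclideanSpace ℝ (Fin k)) :
    cylinderChart p Θ r q = chartInv p (Θ q) := rfl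

lemma cylinderChart_source (hsub : Metric.ball 0 r ×ˢ univ ⊆ Θ.source)
    (hΘ : Θ.target ⊆ chartDom m p) :
    (cylinderChart p Θ r).source = Metric.ball 0 r ×ˢ univ := by
  rw [cylinderChart, OpenPartialHomeomorph.trans_source, OpenPartialHomeomorph.restrOpen_source,
    inter_eq_right.2 hsub, inter_eq_left]
  intro q hq
  have h := hΘ (Θ.map_source (hsub hq))
  rw [chartDom, extChartAt_target] at h
  exact h.1

variable [IsManifold (𝓡 m) ∞ M]

lemma contMDiffOn_cylinderChart (hΘ : Θ.target ⊆ chartDom m p) (hs : ContDiffOn ℝ ∞ Θ Θ.source) :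
    ContMDiffOn ((𝓡 s).prod (𝓡 k)) (𝓡 m) ∞ (cylinderChart p Θ r) (cylinderChart p Θ r).source := by
  have h1 := (contMDiffOn_extChartAt_symm (I := 𝓡 m) (n := ∞) p).comp (contMDiffOn_prodModel hs)
    fun q hq => hΘ (Θ.map_source hq)
  exact h1.mono fun q hq => hq.1.1

lemma contMDiffOn_cylinderChart_symm (hs : ContDiffOn ℝ ∞ Θ.symm Θ.target) :
    ContMDiffOn (𝓡 m) ((𝓡 s).prod (𝓡 k)) ∞ (cylinderChart p Θ r).symm
      (cylinderChart p Θ r).target := by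
  have h1 := (contMDiffOn_prodModel_right hs).comp
    (contMDiffOn_extChartAt (I := 𝓡 m) (n := ∞) (x := p)
      |>.mono (inter_subset_left (t := extChartAt (𝓡 m) p ⁻¹' Θ.target))) fun q hq => hq.2
  exact h1.mono fun x hx => ⟨hx.1, hx.2.1⟩

lemma mfderiv_chartInv_comp {F H : Type*} [NormedAddCommGroup F] [NormedSpace ℝ F]
    [TopologicalSpace H] {I : ModelWithCorners ℝ F H} {P : Type*} [TopologicalSpace P]
    [ChartedSpace H P] {u : P → EuclideanSpace ℝ (Fin m)} {q : P}
    {u' : TangentSpace I q →L[ℝ] EuclideanSpace ℝ (Fin m)} (hq : u q ∈ chartDom m p)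
    (hu : HasMFDerivAt I (𝓡 m) u q u') (v : TangentSpace I q) :
    mfderiv I (𝓡 m) (fun z => chartInv p (u z)) q v = chartD p (u q) (u' v) := by
  have h := (((contMDiffAt_chartInv hq).mdifferentiableAt (by simp)).hasMFDerivAt.comp q hu).mfderiv
  exact DFunLike.congr_fun h v

section Derivatives

variable {q : EuclideanSpace ℝ (Fin s) × EuclideanSpace ℝ (Fin k)}
  {Θ' : EuclideanSpace ℝ (Fin s) × EuclideanSpace ℝ (Fin k) →L[ℝ] EuclideanSpace ℝ (Fin m)}
  (hq : Θ q ∈ chartDom m p) (hΘ' : HasFDerivAt Θ Θ' q)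

include hq hΘ'

lemma mfderiv_cylinderChart (v : EuclideanSpace ℝ (Fin s) × EuclideanSpace ℝ (Fin k)) :
    mfderiv ((𝓡 s).prod (𝓡 k)) (𝓡 m) (cylinderChart p Θ r) q v = chartD p (Θ q) (Θ' v) :=
  mfderiv_chartInv_comp (u := Θ) (I := (𝓡 s).prod (𝓡 k)) hq (hasMFDerivAt_prodModel hΘ') v

lemma mfderiv_cylinderChart_left (a : EuclideanSpace ℝ (Fin s)) :
    mfderiv (𝓡 s) (𝓡 m) (fun t => cylinderChart p Θ r (t, q.2)) q.1 a
      = chartD p (Θ q) (Θ' (a, 0)) := by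
  have h1 : HasFDerivAt (fun t => Θ (t, q.2)) (Θ' ∘L ContinuousLinearMap.inl ℝ _ _) q.1 :=
    hΘ'.comp q.1 (hasFDerivAt_prodMk_left q.1 q.2)
  exact mfderiv_chartInv_comp (u := fun t => Θ (t, q.2)) (I := 𝓡 s) hq h1.hasMFDerivAt a

lemma mfderiv_cylinderChart_right (a : EuclideanSpace ℝ (Fin k)) :
    mfderiv (𝓡 k) (𝓡 m) (fun y => cylinderChart p Θ r (q.1, y)) q.2 a
      = chartD p (Θ q) (Θ' (0, a)) := by
  have h1 : HasFDerivAt (fun y => Θ (q.1, y)) (Θ' ∘L ContinuousLinearMap.inr ℝ _ _) q.2 :=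
    hΘ'.comp q.2 (hasFDerivAt_prodMk_right q.1 q.2)
  exact mfderiv_chartInv_comp (u := fun y => Θ (q.1, y)) (I := 𝓡 k) hq h1.hasMFDerivAt a

end Derivatives

end ChartComposition

/-- The hypotheses are the required identities read in the chart at `p`. Each is transported by
`chartD`, which intertwines the chart representatives with the tensors on the manifold. -/
lemma isTwistedProductChart_cylinderChart {n s : ℕ} {M : Type*} [TopologicalSpace M]
    [ChartedSpace (EuclideanSpace ℝ (Fin (2 * n + s))) M] [IsManifold (𝓡 (2 * n + s)) ∞ M]
    {S : WeakMetricFStructure n s M} {p : M} {h : RMetric (2 * n) (EuclideanSpace ℝ (Fin (2 * n)))}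
    {J : EuclideanSpace ℝ (Fin (2 * n)) →
      EuclideanSpace ℝ (Fin (2 * n)) →L[ℝ] EuclideanSpace ℝ (Fin (2 * n))}
    {σ : EuclideanSpace ℝ (Fin s) × EuclideanSpace ℝ (Fin (2 * n)) → ℝ} {r : ℝ}
    {Θ : OpenPartialHomeomorph (EuclideanSpace ℝ (Fin s) × EuclideanSpace ℝ (Fin (2 * n)))
      (EuclideanSpace ℝ (Fin (2 * n + s)))}
    (hr : 0 < r) (hsub : Metric.ball 0 r ×ˢ univ ⊆ Θ.source)
    (htarget : Θ.target ⊆ chartDom (2 * n + s) p) (h0 : Θ (0, 0) = extChartAt (𝓡 (2 * n + s)) p p)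
    (hΘ : ContDiffOn ℝ ∞ Θ Θ.source) (hΘsymm : ContDiffOn ℝ ∞ Θ.symm Θ.target)
    (hiso : ∀ t ∈ Metric.ball (0 : EuclideanSpace ℝ (Fin s)) r, ∀ y v w,
      chartMetric p S.g (Θ (t, y)) (fderiv ℝ Θ (t, y) v) (fderiv ℝ Θ (t, y) w)
        = inner ℝ v.1 w.1 + σ (t, y) ^ 2 * h.inner y v.2 w.2)
    (hξ : ∀ t ∈ Metric.ball (0 : EuclideanSpace ℝ (Fin s)) r, ∀ y i,
      fderiv ℝ Θ (t, y) (EuclideanSpace.single i 1, 0) = chartField p (S.ξ i) (Θ (t, y)))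
    (hf : ∀ t ∈ Metric.ball (0 : EuclideanSpace ℝ (Fin s)) r, ∀ y w,
      fderiv ℝ Θ (t, y) (0, J y w) = chartEnd p S.f (Θ (t, y)) (fderiv ℝ Θ (t, y) (0, w))) :
    IsTwistedProductChart S p h J σ r (cylinderChart p Θ r) := by
  have hsource := cylinderChart_source (p := p) hsub htarget
  have hfst : ∀ {q}, q ∈ (cylinderChart p Θ r).source → q.1 ∈ Metric.ball 0 r := fun {q} hq => by
    rw [hsource] at hq
    exact hq.1
  have hmem : ∀ {q}, q ∈ (cylinderChart p Θ r).source → q ∈ Θ.source := fun {q} hq =>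
    hsub ⟨hfst hq, mem_univ _⟩
  have hdom : ∀ {q}, q ∈ (cylinderChart p Θ r).source → Θ q ∈ chartDom (2 * n + s) p :=
    fun {q} hq => htarget (Θ.map_source (hmem hq))
  have hd : ∀ {q}, q ∈ (cylinderChart p Θ r).source → HasFDerivAt Θ (fderiv ℝ Θ q) q :=
    fun {q} hq => ((hΘ.contDiffAt (Θ.open_source.mem_nhds (hmem hq))).differentiableAt
      (by simp)).hasFDerivAt
  refine
    { source_eq := hsource
      mem_target := ?_
      smooth := contMDiffOn_cylinderChart htarget hΘ
      smooth_symm := contMDiffOn_cylinderChart_symm hΘsymm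
      isometry := fun q hq v w => ?_
      map_ξ := fun q hq i => ?_
      map_f := fun q hq w => ?_ }
  · have h1 : ((0, 0) : EuclideanSpace ℝ (Fin s) × EuclideanSpace ℝ (Fin (2 * n)))
        ∈ (cylinderChart p Θ r).source := by
      rw [hsource]
      exact ⟨Metric.mem_ball_self hr, mem_univ _⟩
    have h2 := (cylinderChart p Θ r).map_source h1
    have hp : chartInv p (extChartAt (𝓡 (2 * n + s)) p p) = p := extChartAt_to_inv p
    rwa [cylinderChart_apply, h0, hp] at h2
  · have h1 := mfderiv_cylinderChart (r := r) (hdom hq) (hd hq)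
    have h2 := hiso q.1 (hfst hq) q.2 v w
    refine (congrArg₂ (fun a b => S.g.inner (chartInv p (Θ q)) a b) (h1 v) (h1 w)).trans ?_
    exact h2.trans (twistedInner_vectorSpace h σ q v w).symm
  · refine (mfderiv_cylinderChart_left (hdom hq) (hd hq) _).trans ?_
    refine (congrArg (chartD p (Θ q)) (hξ q.1 (hfst hq) q.2 i)).trans ?_
    exact chartD_chartField (hdom hq) (S.ξ i)
  · have h1 := mfderiv_cylinderChart_right (r := r) (hdom hq) (hd hq)
    refine (h1 _).trans (Eq.trans ?_ (congrArg (S.f _) (h1 w)).symm)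
    refine (congrArg (chartD p (Θ q)) (hf q.1 (hfst hq) q.2 w)).trans ?_
    exact chartD_chartEnd (hdom hq) S.f _

end WeakKenmotsu

/-! ### The local twisted product decomposition -/

theorem theorem2p2 (n s : ℕ) (hn : 0 < n) (hs : 1 < s) (M : Type*) [TopologicalSpace M]
    [T2Space M] [SecondCountableTopology M]
    [ChartedSpace (EuclideanSpace ℝ (Fin (2 * n + s))) M] [IsManifold (𝓡 (2 * n + s)) ∞ M]
    (S : WeakKenmotsu.WeakMetricFStructure n s M) (β : M → ℝ) (hS : S.IsWeakKenmotsu β) (p : M) :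
    ∃ (N : Type) (_ : TopologicalSpace N) (_ : T2Space N) (_ : SecondCountableTopology N)
      (_ : ChartedSpace (EuclideanSpace ℝ (Fin (2 * n))) N) (_ : IsManifold (𝓡 (2 * n)) ∞ N)
      (h : WeakKenmotsu.RMetric (2 * n) N) (J : WeakKenmotsu.EndField (2 * n) N)
      (σ : EuclideanSpace ℝ (Fin s) × N → ℝ) (r : ℝ)
      (Φ : OpenPartialHomeomorph (EuclideanSpace ℝ (Fin s) × N) M),
      WeakKenmotsu.IsWeakKahlerian h J ∧
      ContMDiff ((𝓡 s).prod (𝓡 (2 * n))) 𝓘(ℝ, ℝ) ∞ σ ∧ (∀ q, 0 < σ q) ∧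
      WeakKenmotsu.IsTwistedProductChart S p h J σ r Φ ∧
      ((∀ (x : M) (v : TangentSpace (𝓡 (2 * n + s)) x), S.InContact v →
          mvfderiv (𝓡 (2 * n + s)) β x v = 0) →
        ∃ ρ : EuclideanSpace ℝ (Fin s) → ℝ, ContDiff ℝ ∞ ρ ∧ ∀ t y, σ (t, y) = ρ t) := by
  obtain ⟨U, hU, hpU, hUp, hC⟩ := WeakKenmotsu.exists_global_coordinate_fields (m := 2 * n + s) p
  choose C hC hCU using hC
  have hK := hS.isLocalKenmotsu hU hUp hC hCU
  obtain ⟨r, Θ, hΘ, hΘ0⟩ := WeakKenmotsu.exists_adapted_coordinates (k := 2 * n)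
    (by rw [finrank_euclideanSpace_fin, add_comm]) hK.isOpen hK.smooth_ξ hK.smooth_η hK.η_ξ
    hK.comm hK.closed hpU
  -- The conformal factor is measured on one nonzero slice vector; the first basis vector exists
  -- since `0 < n`.
  obtain ⟨σ, hσ, hσ0, hiso, hρ⟩ := hK.exists_twisting_function hΘ
    (e := EuclideanSpace.single (⟨0, by lia⟩ : Fin (2 * n)) (1 : ℝ)) (by simp)
  have hT2 : T2Space (EuclideanSpace ℝ (Fin (2 * n))) :=
    TopologicalSpace.t2Space_of_metrizableSpace
  have hsub : Metric.ball (0 : EuclideanSpace ℝ (Fin s)) (r / 2) ×ˢ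
      (Set.univ : Set (EuclideanSpace ℝ (Fin (2 * n)))) ⊆ Θ.source := by
    rw [hΘ.source_eq]
    exact Set.prod_mono (Metric.ball_subset_ball (half_le_self hΘ.r_pos.le)) subset_rfl
  -- The Kählerian factor is the slice `t = 0`, parametrised by a whole Euclidean space. The radius
  -- `r / 2` is where the cutoff in `σ` equals 1.
  refine ⟨EuclideanSpace ℝ (Fin (2 * n)), inferInstance, hT2, inferInstance,
    inferInstance, inferInstance,
    WeakKenmotsu.vectorSpaceMetric _ (hK.contDiff_sliceMetric_zero hΘ)
      (fun y => hK.sliceMetric_symm hΘ (hΘ.zero_mem_source y))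
      (fun y _ => hK.sliceMetric_pos hΘ (hΘ.zero_mem_source y)),
    WeakKenmotsu.sliceEnd (WeakKenmotsu.chartEnd p S.f) Θ, σ, r / 2,
    WeakKenmotsu.cylinderChart p Θ (r / 2),
    WeakKenmotsu.isWeakKahlerian_vectorSpace _ _ _ (hK.contDiff_sliceEnd hΘ) (hK.sliceEnd_skew hΘ)
      (fun _ _ => hK.sliceEnd_eq_zero hΘ) (hK.koszulDeriv_slice hΘ),
    contMDiffOn_univ.1 (WeakKenmotsu.contMDiffOn_prodModel hσ.contDiffOn), hσ0, ?_, fun hβ => hρ ?_⟩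
  · refine WeakKenmotsu.isTwistedProductChart_cylinderChart (half_pos hΘ.r_pos) hsub
      (hΘ.target_subset.trans hUp) hΘ0 hΘ.contDiffOn hΘ.contDiffOn_symm hiso
      (fun t ht y i => hΘ.map_single (t, y) (hsub ⟨ht, Set.mem_univ _⟩) i)
      (fun t ht y => hK.fderiv_sliceEnd_of_mem hΘ
        (Metric.ball_subset_ball (half_le_self hΘ.r_pos.le) ht) y)
  · intro x hx v hv
    rw [← WeakKenmotsu.mvfderiv_chartInv (hUp hx) (hS.smooth_β.mdifferentiableAt (by simp))]
    exact hβ _ _ hv
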